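/- Let $\eta\in\mathbb C$ and let $V$ be a complex vector space. Consider operators $A(u),B(u),C(u),D(u)$ $(u\in\mathbb C)$ on $V$ such that the monodromy matrix $T(u)=\begin{pmatrix}A(u)&B(u)\\ C(u)&D(u)\end{pmatrix}$ satisfies, for all $u,v\in\mathbb C$, $$R(u-v)\,(T(u)\otimes I)\,(I\otimes T(v))=(I\otimes T(v))\,(T(u)\otimes I)\,R(u-v),$$ $$R(u)=\begin{pmatrix}\sinh(u+\eta)&0&0&0\\0&\sinh u&\sinh\eta&0\\0&\sinh\eta&\sinh u&0\\0&0&0&\sinh(u+\eta)\end{pmatrix}.$$ Suppose there are a vector $|0\rangle\in V$, a linear functional $\langle0|$ on $V$ with $\langle0|0\rangle=1$, and arbitrary functions $a,d:\mathbb C\to\mathbb C$ such that for all $u$ $$A(u)|0\rangle=a(u)|0\rangle,\quad D(u)|0\rangle=d(u)|0\rangle,\quad C(u)|0\rangle=0,$$ $$\langle0|A(u)=a(u)\langle0|,\quad \langle0|D(u)=d(u)\langle0|,\quad \langle0|B(u)=0.$$ Put $t(u,v)=\dfrac{\sinh\eta}{\sinh(u-v)\sinh(u-v+\eta)}$. Let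 $\kappa\in\mathbb C$, $N\ge0$, and let $\lambda_1,\dots,\lambda_N$ satisfy the twisted Bethe equations $$a(\lambda_j)\prod_{k=1}^N\sinh(\lambda_k-\lambda_j+\eta)+\kappa\,d(\lambda_j)\prod_{k=1}^N\sinh(\lambda_k-\lambda_j-\eta)=0,\qquad j=1,\dots,N.$$ Let $\mu_1,\dots,\mu_N$ be arbitrary complex numbers for which all denominators below are non-zero, that is, $\sinh(\lambda_j-\lambda_k)\ne0$ and $\sinh(\mu_j-\mu_k)\ne0$ for $j\ne k$, and $\sinh(\lambda_j-\mu_k)$, $\sinh(\lambda_j-\mu_k+\eta)$, $\sinh(\mu_k-\lambda_j+\eta)$ are non-zero for all $j,k$. Let $\Omega_\kappa(\{\lambda\},\{\mu\}|\{\lambda\})$ be the $N\times N$ matrix with entries $$(\Omega_\kappa)_{jk}=a(\mu_k)\,t(\lambda_j,\mu_k)\prod_{i=1}^N\sinh(\lambda_i-\mu_k+\eta)-\kappa\,d(\mu_k)\,t(\mu_k,\lambda_j)\prod_{i=1}^N\sinh(\lambda_i-\mu_k-\eta).$$ Then, with $|\psi_\kappa(\{\lambda\})\rangle=\prod_{j=1}^NB(\lambda_j)|0\rangle$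 and $\langle\psi_\kappa(\{\lambda\})|=\langle0|\prod_{j=1}^NC(\lambda_j)$ (products taken in the order $j=1,\dots,N$), $$\langle0|\prod_{j=1}^NC(\mu_j)\,|\psi_\kappa(\{\lambda\})\rangle=\langle\psi_\kappa(\{\lambda\})|\prod_{j=1}^NB(\mu_j)|0\rangle=\frac{\prod_{j=1}^Nd(\lambda_j)}{\prod_{1\le k<j\le N}\sinh(\lambda_j-\lambda_k)\sinh(\mu_k-\mu_j)}\,\det_N\Omega_\kappa(\{\lambda\},\{\mu\}|\{\lambda\}).$$ -/

import Mathlib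

open scoped Kronecker

noncomputable section

namespace AlgebraicBetheAnsatz

/-- The six-vertex `R`-matrix as a `4 × 4` matrix, basis order `11, 12, 21, 22`. -/
def sixVertexR (η u : ℂ) : Matrix (Fin 4) (Fin 4) ℂ :=
  !![Complex.sinh (u + η), 0, 0, 0;
     0, Complex.sinh u, Complex.sinh η, 0;
     0, Complex.sinh η, Complex.sinh u, 0;
     0, 0, 0, Complex.sinh (u + η)]

/-- The `R`-matrix on `ℂ² ⊗ ℂ²`, indexed by pairs in lexicographic order, with its scalar
entries regarded as operators on the quantum space `V`. -/
def operatorR (V : Type*) [AddCommGroup V] [Module ℂ V] (η u : ℂ) :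
    Matrix (Fin 2 × Fin 2) (Fin 2 × Fin 2) (Module.End ℂ V) :=
  ((sixVertexR η u).submatrix finProdFinEquiv finProdFinEquiv).map
    (algebraMap ℂ (Module.End ℂ V))

/-- A generalized model of the algebraic Bethe ansatz with the six-vertex `R`-matrix: a monodromy
matrix `T(u) = [[A(u), B(u)], [C(u), D(u)]]` of operators on a complex vector space `V`, satisfying
the quadratic relations `R(u - v) T₁(u) T₂(v) = T₂(v) T₁(u) R(u - v)`, together with a pseudovacuum
vector `|0⟩`, a dual pseudovacuum `⟨0|` and arbitrary vacuum eigenvalues `a`, `d`. -/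
structure GeneralizedModel (η : ℂ) (V : Type*) [AddCommGroup V] [Module ℂ V] where
  /-- the monodromy matrix -/
  T : ℂ → Matrix (Fin 2) (Fin 2) (Module.End ℂ V)
  /-- the vacuum eigenvalue of `A` -/
  a : ℂ → ℂ
  /-- the vacuum eigenvalue of `D` -/
  d : ℂ → ℂ
  /-- the pseudovacuum `|0⟩` -/
  vac : V
  /-- the dual pseudovacuum `⟨0|` -/
  dualVac : Module.Dual ℂ V
  rtt : ∀ u v : ℂ,
    operatorR V η (u - v) *
        ((T u ⊗ₖ (1 : Matrix (Fin 2) (Fin 2) (Module.End ℂ V))) *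
          ((1 : Matrix (Fin 2) (Fin 2) (Module.End ℂ V)) ⊗ₖ T v)) =
      (((1 : Matrix (Fin 2) (Fin 2) (Module.End ℂ V)) ⊗ₖ T v) *
          (T u ⊗ₖ (1 : Matrix (Fin 2) (Fin 2) (Module.End ℂ V)))) *
        operatorR V η (u - v)
  A_vac : ∀ u, T u 0 0 vac = a u • vac
  D_vac : ∀ u, T u 1 1 vac = d u • vac
  C_vac : ∀ u, T u 1 0 vac = 0
  dualVac_A : ∀ u, dualVac ∘ₗ T u 0 0 = a u • dualVac
  dualVac_D : ∀ u, dualVac ∘ₗ T u 1 1 = d u • dualVac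
  dualVac_B : ∀ u, dualVac ∘ₗ T u 0 1 = 0
  dualVac_vac : dualVac vac = 1

namespace GeneralizedModel

variable {η : ℂ} {V : Type*} [AddCommGroup V] [Module ℂ V] (M : GeneralizedModel η V)

/-- The entry `B(u)` of the monodromy matrix. -/
def B (u : ℂ) : Module.End ℂ V := M.T u 0 1

/-- The entry `C(u)` of the monodromy matrix. -/
def C (u : ℂ) : Module.End ℂ V := M.T u 1 0

/-- The ordered product `B(x₁) ⋯ B(x_N)`. -/
def prodB {N : ℕ} (x : Fin N → ℂ) : Module.End ℂ V := (List.ofFn fun j => M.B (x j)).prod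

/-- The ordered product `C(x₁) ⋯ C(x_N)`. -/
def prodC {N : ℕ} (x : Fin N → ℂ) : Module.End ℂ V := (List.ofFn fun j => M.C (x j)).prod

/-- The Bethe vector `B(x₁) ⋯ B(x_N)|0⟩`. -/
def betheVector {N : ℕ} (x : Fin N → ℂ) : V := M.prodB x M.vac

/-- The dual Bethe vector `⟨0|C(x₁) ⋯ C(x_N)`. -/
def dualBetheVector {N : ℕ} (x : Fin N → ℂ) : Module.Dual ℂ V := M.dualVac ∘ₗ M.prodC x

/-- `𝒴_κ(u|{x}) = a(u) ∏ₖ sinh(xₖ - u + η) + κ d(u) ∏ₖ sinh(xₖ - u - η)`. -/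
def twistedY (κ : ℂ) {N : ℕ} (x : Fin N → ℂ) (u : ℂ) : ℂ :=
  M.a u * ∏ k, Complex.sinh (x k - u + η) + κ * M.d u * ∏ k, Complex.sinh (x k - u - η)

/-- The twisted Bethe equations `𝒴_κ(xⱼ|{x}) = 0` for all `j`. -/
def TwistedBethe (κ : ℂ) {N : ℕ} (x : Fin N → ℂ) : Prop := ∀ j, M.twistedY κ x (x j) = 0

end GeneralizedModel

/-- `t(u, v) = sinh η / (sinh(u - v) sinh(u - v + η))`. -/
def tFun (η u v : ℂ) : ℂ :=
  Complex.sinh η / (Complex.sinh (u - v) * Complex.sinh (u - v + η))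

/-- The matrix `Ω_κ({lam}, {mu} | {nu})`. -/
def GeneralizedModel.Omega {η : ℂ} {V : Type*} [AddCommGroup V] [Module ℂ V]
    (M : GeneralizedModel η V) (κ : ℂ) {n n' : ℕ} (lam mu : Fin n → ℂ) (nu : Fin n' → ℂ) :
    Matrix (Fin n) (Fin n) ℂ :=
  Matrix.of fun j k =>
    M.a (mu k) * tFun η (lam j) (mu k) * ∏ i, Complex.sinh (nu i - mu k + η) -
      κ * M.d (mu k) * tFun η (mu k) (lam j) * ∏ i, Complex.sinh (nu i - mu k - η)

end AlgebraicBetheAnsatz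

end

open scoped Kronecker TensorProduct

noncomputable section

namespace AlgebraicBetheAnsatz

/-! Moving every operator to the right until it meets the vacuum shows that ⟨0|∏C∏B|0⟩ is
multilinear in the values of a and d at the 2N points, with coefficients that depend only on the
exchange relations and not on the representation (`isUniversal_word`). The coefficients may
therefore be read off in conveniently chosen models. Tensor products of oscillator sites give models
in which a and d vanish at prescribed points (`exists_model`). In a product of two models with a = 0
off J and d = 0 on J, only the coefficient of ∏_{J} a ∏_{Jᶜ} d survives, and the matrix element
factors into two domain wall partition functions Z (`tensor_scalarProduct`). The detour through
models also avoids commuting the B's or the C's of the given representation: the quadratic relation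
yields their commutation only after cancelling sinh(u - v + η) or sinh(v - u + η), whereas in the
models it holds at all separated points.

The outcome is a double sum over subsets I of {λ} and J of {μ}. On the Bethe roots, in the presence
of Z, ∏_{i ∈ I} a(λ_i) ∏ f(λ_j, λ_i) may be replaced by κ^|I| ∏ d(λ_i) ∏ f(λ_i, λ_j)
(`onShell_term_eq`). Then ∏ d(λ_j) factors out, and for each J there remains a sum over I of
products of two partition functions, `pairSum`.

On the other side, every column of Ω is a(μ_k) times one vector plus κ d(μ_k) times another, so det
Ω is also a sum over J (`det_Omega_eq`). The two sums agree term by term by `pairSum_eq_det`, an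
identity involving neither a, d nor the Bethe equations. It is proved by induction on N and
interpolation: after clearing denominators both sides are trigonometric polynomials in one λ, of
degree one less than the number of remaining points λ and μ. Both vanish at the other λ's, and at
each μ_k both reduce to the identity with one pair of variables fewer. The reduction of Z at such a
point is the transfer relation `zF_transfer`, itself obtained by letting A(u) act to the left and to
the right in a model. -/

/-- `f(u, v) = sinh(u - v + η) / sinh(u - v)`. -/
def fFun (η u v : ℂ) : ℂ := Complex.sinh (u - v + η) / Complex.sinh (u - v)

/-- `g(u, v) = sinh η / sinh(u - v)`. -/
def gFun (η u v : ℂ) : ℂ := Complex.sinh η / Complex.sinh (u - v)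

theorem fFun_neg (η u v : ℂ) : fFun η (-u) (-v) = fFun η v u := by
  have h : -u - -v = v - u := by ring
  rw [fFun, fFun, h]

theorem gFun_neg (η u v : ℂ) : gFun η (-u) (-v) = gFun η v u := by
  have h : -u - -v = v - u := by ring
  rw [gFun, gFun, h]

theorem sinh_sub_swap (u v : ℂ) : Complex.sinh (u - v) = -Complex.sinh (v - u) := by
  rw [← Complex.sinh_neg]; congr 1; ring

theorem sinh_sub_ne_zero_symm {u v : ℂ} (h : Complex.sinh (u - v) ≠ 0) :
    Complex.sinh (v - u) ≠ 0 := by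
  rw [sinh_sub_swap]; exact neg_ne_zero.mpr h

theorem gFun_swap (η u v : ℂ) : gFun η u v = -gFun η v u := by
  unfold gFun; rw [sinh_sub_swap u v, div_neg]

/-! ### Exchange relations, vacuum representations and their symmetries -/

/-- Operators `A, B, C, D` obeying the exchange relations of the six-vertex algebra at pairs of
points separated modulo `iπ`, with a vacuum and a dual vacuum. -/
structure VacuumRep (η : ℂ) (V : Type*) [AddCommGroup V] [Module ℂ V] where
  A : ℂ → Module.End ℂ V
  B : ℂ → Module.End ℂ V
  C : ℂ → Module.End ℂ V
  D : ℂ → Module.End ℂ V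
  a : ℂ → ℂ
  d : ℂ → ℂ
  vac : V
  dualVac : Module.Dual ℂ V
  AB : ∀ u v, Complex.sinh (u - v) ≠ 0 →
    A u * B v = fFun η v u • (B v * A u) + gFun η u v • (B u * A v)
  DB : ∀ u v, Complex.sinh (u - v) ≠ 0 →
    D u * B v = fFun η u v • (B v * D u) + gFun η v u • (B u * D v)
  CA : ∀ u v, Complex.sinh (u - v) ≠ 0 →
    C u * A v = fFun η u v • (A v * C u) + gFun η v u • (A u * C v)
  CD : ∀ u v, Complex.sinh (u - v) ≠ 0 →
    C u * D v = fFun η v u • (D v * C u) + gFun η u v • (D u * C v)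
  CB : ∀ u v, Complex.sinh (u - v) ≠ 0 →
    C u * B v = B v * C u + gFun η u v • (A v * D u - A u * D v)
  CB' : ∀ u v, Complex.sinh (u - v) ≠ 0 →
    C u * B v = B v * C u + gFun η u v • (D u * A v - D v * A u)
  A_vac : ∀ u, A u vac = a u • vac
  D_vac : ∀ u, D u vac = d u • vac
  C_vac : ∀ u, C u vac = 0
  dual_A : ∀ u x, dualVac (A u x) = a u * dualVac x
  dual_D : ∀ u x, dualVac (D u x) = d u * dualVac x
  dual_B : ∀ u x, dualVac (B u x) = 0
  dual_vac : dualVac vac = 1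

section RTT

variable {η : ℂ} {V : Type*} [AddCommGroup V] [Module ℂ V]

/-- The entries of the six-vertex `R`-matrix, indexed by pairs. -/
def rEntry (η x : ℂ) (p q : Fin 2 × Fin 2) : ℂ :=
  sixVertexR η x (finProdFinEquiv p) (finProdFinEquiv q)

theorem rtt_entry (T : ℂ → Matrix (Fin 2) (Fin 2) (Module.End ℂ V)) (u v x : ℂ) :
    operatorR V η x *
        ((T u ⊗ₖ (1 : Matrix (Fin 2) (Fin 2) (Module.End ℂ V))) *
          ((1 : Matrix (Fin 2) (Fin 2) (Module.End ℂ V)) ⊗ₖ T v)) =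
      (((1 : Matrix (Fin 2) (Fin 2) (Module.End ℂ V)) ⊗ₖ T v) *
          (T u ⊗ₖ (1 : Matrix (Fin 2) (Fin 2) (Module.End ℂ V)))) *
        operatorR V η x ↔
    ∀ i k j l, ∑ p, ∑ q, rEntry η x (i, k) (p, q) • (T u p j * T v q l) =
      ∑ p, ∑ q, rEntry η x (p, q) (j, l) • (T v k q * T u i p) := by
  have h1 : (T u ⊗ₖ (1 : Matrix (Fin 2) (Fin 2) (Module.End ℂ V))) *
          ((1 : Matrix (Fin 2) (Fin 2) (Module.End ℂ V)) ⊗ₖ T v) =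
      Matrix.of fun p q => T u p.1 q.1 * T v p.2 q.2 := by
    ext1 ⟨i, k⟩ ⟨j, l⟩
    simp [Matrix.mul_apply, Fintype.sum_prod_type, Matrix.kroneckerMap_apply, Matrix.one_apply]
  have h2 : ((1 : Matrix (Fin 2) (Fin 2) (Module.End ℂ V)) ⊗ₖ T v) *
          (T u ⊗ₖ (1 : Matrix (Fin 2) (Fin 2) (Module.End ℂ V))) =
      Matrix.of fun p q => T v p.2 q.2 * T u p.1 q.1 := by
    ext1 ⟨i, k⟩ ⟨j, l⟩
    simp [Matrix.mul_apply, Fintype.sum_prod_type, Matrix.kroneckerMap_apply, Matrix.one_apply]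
  rw [h1, h2, ← Matrix.ext_iff]
  simp only [Prod.forall, Matrix.mul_apply, Fintype.sum_prod_type, Matrix.of_apply, operatorR,
    Matrix.map_apply, Matrix.submatrix_apply, rEntry, Algebra.smul_def, ← Algebra.commutes]

theorem sum_rEntry_left (η x : ℂ) {W : Type*} [AddCommGroup W] [Module ℂ W]
    (X : Fin 2 → Fin 2 → W) (i k : Fin 2) :
    ∑ p, ∑ q, rEntry η x (i, k) (p, q) • X p q =
      if i = k then Complex.sinh (x + η) • X i k
      else Complex.sinh x • X i k + Complex.sinh η • X k i := by
  fin_cases i <;> fin_cases k <;>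
    simp [rEntry, sixVertexR, Fin.sum_univ_two, finProdFinEquiv, add_comm]

theorem sum_rEntry_right (η x : ℂ) {W : Type*} [AddCommGroup W] [Module ℂ W]
    (X : Fin 2 → Fin 2 → W) (j l : Fin 2) :
    ∑ p, ∑ q, rEntry η x (p, q) (j, l) • X p q =
      if j = l then Complex.sinh (x + η) • X j l
      else Complex.sinh x • X j l + Complex.sinh η • X l j := by
  fin_cases j <;> fin_cases l <;>
    simp [rEntry, sixVertexR, Fin.sum_univ_two, finProdFinEquiv, add_comm]

/-- The quadratic relations in components. -/
theorem rtt_components (T : ℂ → Matrix (Fin 2) (Fin 2) (Module.End ℂ V)) (u v x : ℂ) :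
    operatorR V η x *
        ((T u ⊗ₖ (1 : Matrix (Fin 2) (Fin 2) (Module.End ℂ V))) *
          ((1 : Matrix (Fin 2) (Fin 2) (Module.End ℂ V)) ⊗ₖ T v)) =
      (((1 : Matrix (Fin 2) (Fin 2) (Module.End ℂ V)) ⊗ₖ T v) *
          (T u ⊗ₖ (1 : Matrix (Fin 2) (Fin 2) (Module.End ℂ V)))) *
        operatorR V η x ↔
    ∀ i k j l,
      (if i = k then Complex.sinh (x + η) • (T u i j * T v k l)
        else Complex.sinh x • (T u i j * T v k l) + Complex.sinh η • (T u k j * T v i l)) =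
      if j = l then Complex.sinh (x + η) • (T v k l * T u i j)
        else Complex.sinh x • (T v k l * T u i j) + Complex.sinh η • (T v k j * T u i l) := by
  rw [rtt_entry]
  refine forall_congr' fun i => forall_congr' fun k => forall_congr' fun j => forall_congr' fun l => ?_
  rw [sum_rEntry_left η x (fun p q => T u p j * T v q l),
    sum_rEntry_right η x (fun p q => T v k q * T u i p)]

end RTT

section

variable {η : ℂ} {V : Type*} [AddCommGroup V] [Module ℂ V]

theorem eq_of_sinh_smul {W : Type*} [AddCommGroup W] [Module ℂ W] {u v : ℂ}
    (h : Complex.sinh (u - v) ≠ 0) {X Y Z : W} {p q : ℂ}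
    (hX : Complex.sinh (u - v) • X + q • Z = p • Y) :
    X = (p / Complex.sinh (u - v)) • Y + (q / Complex.sinh (v - u)) • Z := by
  rw [sinh_sub_swap v u, div_neg, neg_smul, ← sub_eq_add_neg, eq_sub_iff_add_eq]
  have := congrArg (fun t => (Complex.sinh (u - v))⁻¹ • t) hX
  simp only [smul_add, smul_smul, inv_mul_cancel₀ h, one_smul] at this
  rw [div_eq_inv_mul, div_eq_inv_mul]
  exact this

theorem eq_of_sinh_smul_sub {W : Type*} [AddCommGroup W] [Module ℂ W] {u v : ℂ}
    (h : Complex.sinh (u - v) ≠ 0) {X Y P Q : W} {q : ℂ}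
    (hX : Complex.sinh (u - v) • X + q • P = Complex.sinh (u - v) • Y + q • Q) :
    X = Y + (q / Complex.sinh (u - v)) • (Q - P) := by
  have h2 : Complex.sinh (u - v) • X = Complex.sinh (u - v) • Y + q • (Q - P) := by
    rw [smul_sub, ← add_sub_assoc, ← hX, add_sub_cancel_right]
  have := congrArg (fun t => (Complex.sinh (u - v))⁻¹ • t) h2
  simp only [smul_add, smul_smul, inv_mul_cancel₀ h, one_smul] at this
  rw [div_eq_inv_mul]
  exact this

/-- The operators of a generalized model obey the exchange relations. -/
def GeneralizedModel.toRep (M : GeneralizedModel η V) : VacuumRep η V where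
  A u := M.T u 0 0
  B u := M.T u 0 1
  C u := M.T u 1 0
  D u := M.T u 1 1
  a := M.a
  d := M.d
  vac := M.vac
  dualVac := M.dualVac
  AB u v h := by
    have h1 := (rtt_components M.T v u (v - u)).mp (M.rtt v u) 0 0 1 0
    simp only [if_true, one_ne_zero, if_false] at h1
    exact eq_of_sinh_smul (sinh_sub_ne_zero_symm h) h1.symm
  DB u v h := by
    have h1 := (rtt_components M.T u v (u - v)).mp (M.rtt u v) 1 0 1 1
    simp only [if_true, one_ne_zero, if_false] at h1
    exact eq_of_sinh_smul h h1
  CA u v h := by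
    have h1 := (rtt_components M.T u v (u - v)).mp (M.rtt u v) 1 0 0 0
    simp only [if_true, one_ne_zero, if_false] at h1
    exact eq_of_sinh_smul h h1
  CD u v h := by
    have h1 := (rtt_components M.T v u (v - u)).mp (M.rtt v u) 1 1 1 0
    simp only [if_true, one_ne_zero, if_false] at h1
    exact eq_of_sinh_smul (sinh_sub_ne_zero_symm h) h1.symm
  CB u v h := by
    have h1 := (rtt_components M.T u v (u - v)).mp (M.rtt u v) 1 0 0 1
    simp only [one_ne_zero, zero_ne_one, if_false] at h1
    exact eq_of_sinh_smul_sub h h1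
  CB' u v h := by
    have h1 := (rtt_components M.T v u (v - u)).mp (M.rtt v u) 0 1 1 0
    simp only [one_ne_zero, zero_ne_one, if_false] at h1
    have h2 := eq_of_sinh_smul_sub (sinh_sub_ne_zero_symm h) h1.symm
    rw [h2, gFun_swap, gFun, neg_smul, ← smul_neg, neg_sub]
  A_vac := M.A_vac
  D_vac := M.D_vac
  C_vac := M.C_vac
  dual_A u x := by have := LinearMap.congr_fun (M.dualVac_A u) x; simpa using this
  dual_D u x := by have := LinearMap.congr_fun (M.dualVac_D u) x; simpa using this
  dual_B u x := by have := LinearMap.congr_fun (M.dualVac_B u) x; simpa using this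
  dual_vac := M.dualVac_vac

namespace VacuumRep

/-- The automorphism `A(u) ↔ D(-u)`, `B(u) ↦ B(-u)`, `C(u) ↦ C(-u)`. -/
def reflect (R : VacuumRep η V) : VacuumRep η V where
  A u := R.D (-u)
  B u := R.B (-u)
  C u := R.C (-u)
  D u := R.A (-u)
  a u := R.d (-u)
  d u := R.a (-u)
  vac := R.vac
  dualVac := R.dualVac
  AB u v h := by
    have h' : Complex.sinh (-u - -v) ≠ 0 := by
      rw [neg_sub_neg]; exact sinh_sub_ne_zero_symm h
    simpa only [fFun_neg, gFun_neg] using R.DB (-u) (-v) h'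
  DB u v h := by
    have h' : Complex.sinh (-u - -v) ≠ 0 := by
      rw [neg_sub_neg]; exact sinh_sub_ne_zero_symm h
    simpa only [fFun_neg, gFun_neg] using R.AB (-u) (-v) h'
  CA u v h := by
    have h' : Complex.sinh (-u - -v) ≠ 0 := by
      rw [neg_sub_neg]; exact sinh_sub_ne_zero_symm h
    simpa only [fFun_neg, gFun_neg] using R.CD (-u) (-v) h'
  CD u v h := by
    have h' : Complex.sinh (-u - -v) ≠ 0 := by
      rw [neg_sub_neg]; exact sinh_sub_ne_zero_symm h
    simpa only [fFun_neg, gFun_neg] using R.CA (-u) (-v) h'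
  CB u v h := by
    have h' : Complex.sinh (-u - -v) ≠ 0 := by
      rw [neg_sub_neg]; exact sinh_sub_ne_zero_symm h
    rw [R.CB' (-u) (-v) h', gFun_neg, gFun_swap, neg_smul, ← smul_neg, neg_sub]
  CB' u v h := by
    have h' : Complex.sinh (-u - -v) ≠ 0 := by
      rw [neg_sub_neg]; exact sinh_sub_ne_zero_symm h
    rw [R.CB (-u) (-v) h', gFun_neg, gFun_swap, neg_smul, ← smul_neg, neg_sub]
  A_vac u := R.D_vac (-u)
  D_vac u := R.A_vac (-u)
  C_vac u := R.C_vac (-u)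
  dual_A u := R.dual_D (-u)
  dual_D u := R.dual_A (-u)
  dual_B u := R.dual_B (-u)
  dual_vac := R.dual_vac

theorem dualMap_mul (X Y : Module.End ℂ V) :
    LinearMap.dualMap (X * Y) = LinearMap.dualMap Y * LinearMap.dualMap X := rfl

/-- The transposed representation on the dual space, with `B` and `C` exchanged. -/
def transpose (R : VacuumRep η V) : VacuumRep η (Module.Dual ℂ V) where
  A u := (R.A u).dualMap
  B u := (R.C u).dualMap
  C u := (R.B u).dualMap
  D u := (R.D u).dualMap
  a := R.a
  d := R.d
  vac := R.dualVac
  dualVac := Module.Dual.eval ℂ V R.vac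
  AB u v h := by
    simp only [← dualMap_mul]
    rw [R.CA v u (sinh_sub_ne_zero_symm h)]; ext; simp
  DB u v h := by
    simp only [← dualMap_mul]
    rw [R.CD v u (sinh_sub_ne_zero_symm h)]; ext; simp
  CA u v h := by
    simp only [← dualMap_mul]
    rw [R.AB v u (sinh_sub_ne_zero_symm h)]; ext; simp
  CD u v h := by
    simp only [← dualMap_mul]
    rw [R.DB v u (sinh_sub_ne_zero_symm h)]; ext; simp
  -- Transposition turns A D into D A, so this relation comes from `CB'` of the original; hence both
  -- forms are kept in the structure.
  CB u v h := by
    simp only [← dualMap_mul]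
    rw [R.CB' v u (sinh_sub_ne_zero_symm h), gFun_swap]; ext; simp; ring
  CB' u v h := by
    simp only [← dualMap_mul]
    rw [R.CB v u (sinh_sub_ne_zero_symm h), gFun_swap]; ext; simp; ring
  A_vac u := LinearMap.ext fun x => by simp [R.dual_A]
  D_vac u := LinearMap.ext fun x => by simp [R.dual_D]
  C_vac u := LinearMap.ext fun x => by simp [R.dual_B]
  dual_A u x := by simp [R.A_vac]
  dual_D u x := by simp [R.D_vac]
  dual_B u x := by simp [R.C_vac]
  dual_vac := by simp [R.dual_vac]

/-- `⟨0| ∏ C(x) ∏ B(y) |0⟩`. -/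
def scalarProduct (R : VacuumRep η V) (X Y : List ℂ) : ℂ :=
  R.dualVac ((X.map R.C).prod ((Y.map R.B).prod R.vac))

theorem prod_dualMap (F : ℂ → Module.End ℂ V) (X : List ℂ) (φ : Module.Dual ℂ V) (x : V) :
    (X.map fun u => (F u).dualMap).prod φ x = φ ((X.reverse.map F).prod x) := by
  induction X generalizing x with
  | nil => simp
  | cons u X ih => simp [ih, Module.End.mul_apply]

theorem scalarProduct_transpose (R : VacuumRep η V) (X Y : List ℂ) :
    R.transpose.scalarProduct X Y = R.scalarProduct Y.reverse X.reverse := by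
  simp only [scalarProduct, transpose, Module.Dual.eval_apply, prod_dualMap]

theorem scalarProduct_reflect (R : VacuumRep η V) (X Y : List ℂ) :
    R.reflect.scalarProduct X Y = R.scalarProduct (X.map Neg.neg) (Y.map Neg.neg) := by
  simp [scalarProduct, reflect, Function.comp_def]

end VacuumRep

end

/-- Pairwise separation modulo `iπ`. -/
def Sep (l : List ℂ) : Prop := l.Pairwise fun u v => Complex.sinh (u - v) ≠ 0

theorem Sep.perm {l l' : List ℂ} (h : Sep l) (hp : l.Perm l') : Sep l' :=
  (hp.pairwise_iff fun h => sinh_sub_ne_zero_symm h).mp h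

theorem Sep.sublist {l l' : List ℂ} (h : Sep l) (hs : l'.Sublist l) : Sep l' :=
  List.Pairwise.sublist hs h

theorem Sep.nodup {l : List ℂ} (h : Sep l) : l.Nodup :=
  List.Pairwise.imp (fun {u v} h' => by rintro rfl; simp at h') h

/-! ### Universality of vacuum expectation values -/

/-- The names of the four operators. -/
inductive Letter
  | A | B | C | D

/-- A vacuum functional: the values on words of a representation with a vacuum. -/
structure IsVacuumFunctional (η : ℂ) (E : List (Letter × ℂ) → ℂ) (a d : ℂ → ℂ) : Prop where
  nil : E [] = 1
  B_left : ∀ u w, E ((Letter.B, u) :: w) = 0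
  A_right : ∀ u w, E (w ++ [(Letter.A, u)]) = a u * E w
  D_right : ∀ u w, E (w ++ [(Letter.D, u)]) = d u * E w
  C_right : ∀ u w, E (w ++ [(Letter.C, u)]) = 0
  AB : ∀ u v w w', Complex.sinh (u - v) ≠ 0 →
    E (w ++ (Letter.A, u) :: (Letter.B, v) :: w') =
      fFun η v u * E ((w ++ [(Letter.B, v)]) ++ (Letter.A, u) :: w') +
      gFun η u v * E ((w ++ [(Letter.B, u)]) ++ (Letter.A, v) :: w')
  DB : ∀ u v w w', Complex.sinh (u - v) ≠ 0 →
    E (w ++ (Letter.D, u) :: (Letter.B, v) :: w') =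
      fFun η u v * E ((w ++ [(Letter.B, v)]) ++ (Letter.D, u) :: w') +
      gFun η v u * E ((w ++ [(Letter.B, u)]) ++ (Letter.D, v) :: w')
  CB : ∀ u v w w', Complex.sinh (u - v) ≠ 0 →
    E (w ++ (Letter.C, u) :: (Letter.B, v) :: w') =
      E ((w ++ [(Letter.B, v)]) ++ (Letter.C, u) :: w') +
      (gFun η u v * E ((w ++ [(Letter.A, v)]) ++ (Letter.D, u) :: w') +
      -gFun η u v * E ((w ++ [(Letter.A, u)]) ++ (Letter.D, v) :: w'))

namespace VacuumRep

variable {η : ℂ} {V : Type*} [AddCommGroup V] [Module ℂ V] (R : VacuumRep η V)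

/-- The operator with a given name. -/
def op : Letter → ℂ → Module.End ℂ V
  | Letter.A => R.A
  | Letter.B => R.B
  | Letter.C => R.C
  | Letter.D => R.D

/-- The vacuum expectation value of a word in the operators. -/
def evalWord (w : List (Letter × ℂ)) : ℂ :=
  R.dualVac ((w.map fun p => R.op p.1 p.2).prod R.vac)

theorem evalWord_isVacuumFunctional : IsVacuumFunctional η R.evalWord R.a R.d where
  nil := by simp [evalWord, R.dual_vac]
  B_left u w := by simp [evalWord, op, R.dual_B]
  A_right u w := by simp [evalWord, op, R.A_vac]
  D_right u w := by simp [evalWord, op, R.D_vac]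
  C_right u w := by simp [evalWord, op, R.C_vac]
  AB u v w w' h := by
    have := congrArg (fun X => R.dualVac ((w.map fun p => R.op p.1 p.2).prod
      (X ((w'.map fun p => R.op p.1 p.2).prod R.vac)))) (R.AB u v h)
    simpa [evalWord, op] using this
  DB u v w w' h := by
    have := congrArg (fun X => R.dualVac ((w.map fun p => R.op p.1 p.2).prod
      (X ((w'.map fun p => R.op p.1 p.2).prod R.vac)))) (R.DB u v h)
    simpa [evalWord, op] using this
  CB u v w w' h := by
    have := congrArg (fun X => R.dualVac ((w.map fun p => R.op p.1 p.2).prod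
      (X ((w'.map fun p => R.op p.1 p.2).prod R.vac)))) (R.CB u v h)
    simp [evalWord, op] at this ⊢
    rw [this]; ring

end VacuumRep

/-- The value of the word `w` depends only on the vacuum eigenvalues at the points of `P`, and
is multilinear in them. -/
def IsUniversal (η : ℂ) (P : Finset ℂ) (w : List (Letter × ℂ)) : Prop :=
  ∃ c : Finset ℂ → ℂ, ∀ E a d, IsVacuumFunctional η E a d →
    E w = ∑ J ∈ P.powerset, c J * ((∏ p ∈ J, a p) * ∏ p ∈ P \ J, d p)

theorem IsUniversal.of_add {η : ℂ} {P : Finset ℂ} {w w₁ w₂ : List (Letter × ℂ)} (r s : ℂ)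
    (h₁ : IsUniversal η P w₁) (h₂ : IsUniversal η P w₂)
    (h : ∀ E a d, IsVacuumFunctional η E a d → E w = r * E w₁ + s * E w₂) :
    IsUniversal η P w := by
  obtain ⟨c₁, hc₁⟩ := h₁
  obtain ⟨c₂, hc₂⟩ := h₂
  refine ⟨fun J => r * c₁ J + s * c₂ J, fun E a d hE => ?_⟩
  rw [h E a d hE, hc₁ E a d hE, hc₂ E a d hE, Finset.mul_sum, Finset.mul_sum,
    ← Finset.sum_add_distrib]
  exact Finset.sum_congr rfl fun J _ => by ring

theorem IsUniversal.of_add₃ {η : ℂ} {P : Finset ℂ} {w w₁ w₂ w₃ : List (Letter × ℂ)} (r s : ℂ)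
    (h₁ : IsUniversal η P w₁) (h₂ : IsUniversal η P w₂) (h₃ : IsUniversal η P w₃)
    (h : ∀ E a d, IsVacuumFunctional η E a d → E w = E w₁ + (r * E w₂ + s * E w₃)) :
    IsUniversal η P w := by
  obtain ⟨c₁, hc₁⟩ := h₁
  obtain ⟨c₂, hc₂⟩ := h₂
  obtain ⟨c₃, hc₃⟩ := h₃
  refine ⟨fun J => c₁ J + (r * c₂ J + s * c₃ J), fun E a d hE => ?_⟩
  rw [h E a d hE, hc₁ E a d hE, hc₂ E a d hE, hc₃ E a d hE, Finset.mul_sum, Finset.mul_sum,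
    ← Finset.sum_add_distrib, ← Finset.sum_add_distrib]
  exact Finset.sum_congr rfl fun J _ => by ring

theorem IsUniversal.of_zero {η : ℂ} {P : Finset ℂ} {w : List (Letter × ℂ)}
    (h : ∀ E a d, IsVacuumFunctional η E a d → E w = 0) : IsUniversal η P w :=
  ⟨0, fun E a d hE => by simp [h E a d hE]⟩

theorem IsUniversal.of_a_mul {η : ℂ} {P : Finset ℂ} {w w₁ : List (Letter × ℂ)} {u : ℂ}
    (hu : u ∉ P) (h₁ : IsUniversal η P w₁)
    (h : ∀ E a d, IsVacuumFunctional η E a d → E w = a u * E w₁) :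
    IsUniversal η (insert u P) w := by
  obtain ⟨c, hc⟩ := h₁
  refine ⟨fun J => if u ∈ J then c (J.erase u) else 0, fun E a d hE => ?_⟩
  rw [h E a d hE, hc E a d hE, Finset.sum_powerset_insert hu, Finset.mul_sum]
  symm
  refine (congrArg₂ (· + ·) (Finset.sum_eq_zero fun J hJ => ?_)
    (Finset.sum_congr rfl fun J hJ => ?_)).trans (zero_add _)
  · beta_reduce
    rw [if_neg fun h => hu (Finset.mem_powerset.mp hJ h), zero_mul]
  · have huJ : u ∉ J := fun h => hu (Finset.mem_powerset.mp hJ h)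
    beta_reduce
    rw [if_pos (Finset.mem_insert_self _ _), Finset.erase_insert huJ, Finset.prod_insert huJ,
      Finset.insert_sdiff_insert, Finset.sdiff_insert_of_notMem hu]
    ring

theorem IsUniversal.of_d_mul {η : ℂ} {P : Finset ℂ} {w w₁ : List (Letter × ℂ)} {u : ℂ}
    (hu : u ∉ P) (h₁ : IsUniversal η P w₁)
    (h : ∀ E a d, IsVacuumFunctional η E a d → E w = d u * E w₁) :
    IsUniversal η (insert u P) w := by
  obtain ⟨c, hc⟩ := h₁
  refine ⟨fun J => if u ∈ J then 0 else c J, fun E a d hE => ?_⟩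
  rw [h E a d hE, hc E a d hE, Finset.sum_powerset_insert hu, Finset.mul_sum]
  symm
  refine (congrArg₂ (· + ·) (Finset.sum_congr rfl fun J hJ => ?_)
    (Finset.sum_eq_zero fun J hJ => ?_)).trans (add_zero _)
  · have huJ : u ∉ J := fun h => hu (Finset.mem_powerset.mp hJ h)
    beta_reduce
    rw [if_neg huJ, Finset.insert_sdiff_of_notMem _ huJ, Finset.prod_insert]
    · ring
    · simp [hu]
  · beta_reduce
    rw [if_pos (Finset.mem_insert_self _ _), zero_mul]

theorem exists_last_non_B (w : List (Letter × ℂ)) :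
    (∃ L : List ℂ, w = L.map fun y => (Letter.B, y)) ∨
      ∃ (w₁ : List (Letter × ℂ)) (X : Letter) (u : ℂ) (L : List ℂ), X ≠ Letter.B ∧
        w = w₁ ++ (X, u) :: L.map fun y => (Letter.B, y) := by
  induction w with
  | nil => exact Or.inl ⟨[], rfl⟩
  | cons p w ih =>
    rcases ih with ⟨L, rfl⟩ | ⟨w₁, X, u, L, hX, rfl⟩
    · obtain ⟨X, u⟩ := p
      by_cases hX : X = Letter.B
      · exact Or.inl ⟨u :: L, by simp [hX]⟩
      · exact Or.inr ⟨[], X, u, L, hX, rfl⟩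
    · exact Or.inr ⟨p :: w₁, X, u, L, hX, rfl⟩

/-- The points of a word. -/
def points (w : List (Letter × ℂ)) : List ℂ := w.map Prod.snd

/-- The last letter that is not a B is pushed to the right through the remaining B's. Each exchange
permutes points and leaves a non-B letter with one B fewer behind it; the C–B relation trades C, B
for A, D at the same two points. On reaching the vacuum the letter becomes a scalar and the word
gets shorter. Separation is invariant under permutation and makes each point occur once, hence
multilinearity. -/
theorem isUniversal_of_shorter {η : ℂ} (L : List ℂ) :
    ∀ (w₁ : List (Letter × ℂ)) (X : Letter) (u : ℂ), X ≠ Letter.B →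
      Sep (points (w₁ ++ (X, u) :: L.map fun y => (Letter.B, y))) →
      (∀ w : List (Letter × ℂ),
        w.length < (w₁ ++ (X, u) :: L.map fun y => (Letter.B, y)).length →
        Sep (points w) → IsUniversal η (points w).toFinset w) →
      IsUniversal η (points (w₁ ++ (X, u) :: L.map fun y => (Letter.B, y))).toFinset
        (w₁ ++ (X, u) :: L.map fun y => (Letter.B, y)) := by
  induction L with
  | nil =>
    intro w₁ X u hX hs ih
    have hp : (points (w₁ ++ [(X, u)])).Perm (u :: points w₁) := by
      simp [points, List.perm_append_singleton]
    have hs' : Sep (u :: points w₁) := hs.perm hp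
    have hu : u ∉ (points w₁).toFinset := by
      rw [List.mem_toFinset]; exact (List.nodup_cons.mp hs'.nodup).1
    have h₁ := ih w₁ (by simp) (hs'.sublist (List.sublist_cons_self _ _))
    rw [List.map_nil, List.toFinset_eq_of_perm _ _ hp, List.toFinset_cons]
    cases X with
    | A => exact h₁.of_a_mul hu fun E a d hE => hE.A_right u w₁
    | B => exact absurd rfl hX
    | C => exact IsUniversal.of_zero fun E a d hE => hE.C_right u w₁
    | D => exact h₁.of_d_mul hu fun E a d hE => hE.D_right u w₁
  | cons v L ihL =>
    intro w₁ X u hX hs ih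
    have huv : Complex.sinh (u - v) ≠ 0 := by
      have h2 : Sep [u, v] := hs.sublist (by
        simp only [points, List.map_append, List.map_cons]
        refine List.Sublist.trans ?_ (List.sublist_append_right _ _)
        simp)
      simpa [Sep] using h2
    -- All terms on the right of the three exchange relations have this shape: some letter Y, then a
    -- non-B letter Z, at the same two points in either order.
    have key : ∀ (Y Z : Letter) (u' v' : ℂ), Z ≠ Letter.B → [v', u'].Perm [u, v] →
        IsUniversal η (points (w₁ ++ (X, u) :: (v :: L).map fun y => (Letter.B, y))).toFinset
        ((w₁ ++ [(Y, v')]) ++ (Z, u') :: L.map fun y => (Letter.B, y)) := by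
      intro Y Z u' v' hZ hp
      have hp' : (points (w₁ ++ (X, u) :: (v :: L).map fun y => (Letter.B, y))).Perm
          (points ((w₁ ++ [(Y, v')]) ++ (Z, u') :: L.map fun y => (Letter.B, y))) := by
        simp only [points, List.map_append, List.map_cons, List.append_assoc,
          List.singleton_append]
        refine List.Perm.append_left _ ?_
        exact (hp.symm.append_right (List.map Prod.snd (L.map fun y => (Letter.B, y))))
      rw [List.toFinset_eq_of_perm _ _ hp']
      refine ihL _ _ _ hZ (hs.perm hp') fun w hw => ih w ?_
      simpa using hw
    have p1 : [v, u].Perm [u, v] := List.Perm.swap _ _ _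
    have p2 : [u, v].Perm [u, v] := List.Perm.refl _
    cases X with
    | A => exact (key Letter.B Letter.A u v (by simp) p1).of_add _ _
              (key Letter.B Letter.A v u (by simp) p2)
              fun E a d hE => hE.AB u v w₁ (L.map fun y => (Letter.B, y)) huv
    | B => exact absurd rfl hX
    | C => exact (key Letter.B Letter.C u v (by simp) p1).of_add₃ _ _
              (key Letter.A Letter.D u v (by simp) p1) (key Letter.A Letter.D v u (by simp) p2)
              fun E a d hE => hE.CB u v w₁ (L.map fun y => (Letter.B, y)) huv
    | D => exact (key Letter.B Letter.D u v (by simp) p1).of_add _ _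
              (key Letter.B Letter.D v u (by simp) p2)
              fun E a d hE => hE.DB u v w₁ (L.map fun y => (Letter.B, y)) huv

/-- Vacuum expectation values are universal multilinear functions of the vacuum eigenvalues. -/
theorem isUniversal_word {η : ℂ} (w : List (Letter × ℂ)) (hs : Sep (points w)) :
    IsUniversal η (points w).toFinset w := by
  induction hn : w.length using Nat.strong_induction_on generalizing w with
  | _ n ih =>
    rcases exists_last_non_B w with ⟨L, hL⟩ | ⟨w₁, X, u, L, hX, hw⟩
    · cases L with
      | nil => subst hL; exact ⟨1, fun E a d hE => by simp [hE.nil, points]⟩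
      | cons y L => subst hL; exact IsUniversal.of_zero fun E a d hE => hE.B_left _ _
    · rw [hw] at hs hn ⊢
      exact isUniversal_of_shorter L w₁ X u hX hs fun w' hw' hs' => ih _ (hn ▸ hw') w' hs' rfl

/-! ### Explicit models: tensor products and oscillator sites -/

namespace GeneralizedModel

variable {η : ℂ} {V W : Type*} [AddCommGroup V] [Module ℂ V] [AddCommGroup W] [Module ℂ W]

/-- Each entry of the monodromy matrix commutes with itself at separated points. -/
def EntriesCommute (M : GeneralizedModel η V) : Prop :=
  ∀ u v, Complex.sinh (u - v) ≠ 0 → ∀ i j, M.T u i j * M.T v i j = M.T v i j * M.T u i j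

theorem row_exchange (M : GeneralizedModel η V) {u v : ℂ} (h : Complex.sinh (u - v) ≠ 0)
    (i : Fin 2) : M.T u i 0 * M.T v i 1 =
      fFun η v u • (M.T v i 1 * M.T u i 0) + gFun η u v • (M.T u i 1 * M.T v i 0) := by
  have h1 := (rtt_components M.T v u (v - u)).mp (M.rtt v u) i i 1 0
  simp only [if_true, one_ne_zero, if_false] at h1
  exact eq_of_sinh_smul (sinh_sub_ne_zero_symm h) h1.symm

theorem col_exchange (M : GeneralizedModel η V) {u v : ℂ} (h : Complex.sinh (u - v) ≠ 0)
    (j : Fin 2) : M.T u 1 j * M.T v 0 j =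
      fFun η u v • (M.T v 0 j * M.T u 1 j) + gFun η v u • (M.T u 0 j * M.T v 1 j) := by
  have h1 := (rtt_components M.T u v (u - v)).mp (M.rtt u v) 1 0 j j
  simp only [if_true, one_ne_zero, if_false] at h1
  exact eq_of_sinh_smul h h1

/-- This is the coproduct argument: R is carried through the first monodromy matrix, its entries t
reappear between the factors, and it is then carried through the second. Only bilinearity of the
pairing is used. -/
theorem sum_bilinear_exchange {E F G : Type*} [AddCommGroup E] [Module ℂ E] [AddCommGroup F]
    [Module ℂ F] [AddCommGroup G] [Module ℂ G] (b : E →ₗ[ℂ] F →ₗ[ℂ] G)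
    (r s : Fin 2 → Fin 2 → ℂ) (t : Fin 2 → Fin 2 → Fin 2 → Fin 2 → ℂ)
    (X : Fin 2 → Fin 2 → Fin 2 → Fin 2 → E) (X' : Fin 2 → Fin 2 → E)
    (Y : Fin 2 → Fin 2 → F) (Y' : Fin 2 → Fin 2 → Fin 2 → Fin 2 → F)
    (hX : ∀ m n, ∑ p, ∑ q, r p q • X p q m n = ∑ p, ∑ q, t p q m n • X' p q)
    (hY : ∀ p q, ∑ m, ∑ n, t p q m n • Y m n = ∑ m, ∑ n, s m n • Y' p q m n) :
    ∑ p, ∑ q, r p q • ∑ m, ∑ n, b (X p q m n) (Y m n) =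
      ∑ m, ∑ n, s m n • ∑ p, ∑ q, b (X' p q) (Y' p q m n) := by
  calc _ = ∑ m, ∑ n, b (∑ p, ∑ q, r p q • X p q m n) (Y m n) := by
        simp only [Fin.sum_univ_two, map_add, map_smul, LinearMap.add_apply,
          LinearMap.smul_apply, smul_add]
        abel
    _ = ∑ p, ∑ q, b (X' p q) (∑ m, ∑ n, t p q m n • Y m n) := by
        simp only [hX]
        simp only [Fin.sum_univ_two, map_add, map_smul, LinearMap.add_apply,
          LinearMap.smul_apply]
        abel
    _ = _ := by
        simp only [hY]
        simp only [Fin.sum_univ_two, map_add, map_smul, smul_add]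
        abel

/-- The tensor product of operators as a bilinear map. -/
def tensorEnd (V W : Type*) [AddCommGroup V] [Module ℂ V] [AddCommGroup W] [Module ℂ W] :
    Module.End ℂ V →ₗ[ℂ] Module.End ℂ W →ₗ[ℂ] Module.End ℂ (V ⊗[ℂ] W) :=
  TensorProduct.mapBilinear (RingHom.id ℂ) V W V W

theorem tensorEnd_tmul (X : Module.End ℂ V) (Y : Module.End ℂ W) (x : V) (y : W) :
    tensorEnd V W X Y (x ⊗ₜ y) = X x ⊗ₜ Y y := rfl

theorem tensorEnd_mul (X X' : Module.End ℂ V) (Y Y' : Module.End ℂ W) :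
    tensorEnd V W X Y * tensorEnd V W X' Y' = tensorEnd V W (X * X') (Y * Y') :=
  TensorProduct.ext' fun _ _ => rfl

/-- The entries of the product of two monodromy matrices. -/
def tensorT (M₁ : GeneralizedModel η V) (M₂ : GeneralizedModel η W) (u : ℂ) :
    Matrix (Fin 2) (Fin 2) (Module.End ℂ (V ⊗[ℂ] W)) :=
  Matrix.of fun i j => ∑ k, tensorEnd V W (M₁.T u i k) (M₂.T u k j)

theorem tensorT_tmul (M₁ : GeneralizedModel η V) (M₂ : GeneralizedModel η W) (u : ℂ)
    (i j : Fin 2) (x : V) (y : W) : tensorT M₁ M₂ u i j (x ⊗ₜ y) =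
      M₁.T u i 0 x ⊗ₜ M₂.T u 0 j y + M₁.T u i 1 x ⊗ₜ M₂.T u 1 j y := by
  simp only [tensorT, Matrix.of_apply, Fin.sum_univ_two, LinearMap.add_apply, tensorEnd_tmul]

theorem tensorT_mul (M₁ : GeneralizedModel η V) (M₂ : GeneralizedModel η W) (u v : ℂ)
    (i j k l : Fin 2) : tensorT M₁ M₂ u i j * tensorT M₁ M₂ v k l =
      ∑ m, ∑ n, tensorEnd V W (M₁.T u i m * M₁.T v k n) (M₂.T u m j * M₂.T v n l) := by
  simp only [tensorT, Matrix.of_apply, Finset.sum_mul_sum, tensorEnd_mul]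

theorem tensorT_mul' (M₁ : GeneralizedModel η V) (M₂ : GeneralizedModel η W) (u v : ℂ)
    (i j k l : Fin 2) : tensorT M₁ M₂ v k l * tensorT M₁ M₂ u i j =
      ∑ m, ∑ n, tensorEnd V W (M₁.T v k n * M₁.T u i m) (M₂.T v n l * M₂.T u m j) := by
  rw [tensorT_mul, Finset.sum_comm]

/-- The product of two dual vectors. -/
def tensorDual (φ : Module.Dual ℂ V) (χ : Module.Dual ℂ W) : Module.Dual ℂ (V ⊗[ℂ] W) :=
  LinearMap.mul' ℂ ℂ ∘ₗ TensorProduct.map φ χ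

theorem tensorDual_tmul (φ : Module.Dual ℂ V) (χ : Module.Dual ℂ W) (x : V) (y : W) :
    tensorDual φ χ (x ⊗ₜ y) = φ x * χ y := rfl

/-- The tensor product of two generalized models, with `T(u) = T₁(u) T₂(u)`. -/
def tensor (M₁ : GeneralizedModel η V) (M₂ : GeneralizedModel η W) :
    GeneralizedModel η (V ⊗[ℂ] W) where
  T := tensorT M₁ M₂
  a u := M₁.a u * M₂.a u
  d u := M₁.d u * M₂.d u
  vac := M₁.vac ⊗ₜ M₂.vac
  dualVac := tensorDual M₁.dualVac M₂.dualVac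
  rtt u v := by
    rw [rtt_entry (tensorT M₁ M₂)]
    intro i k j l
    have h₁ := (rtt_entry M₁.T u v (u - v)).mp (M₁.rtt u v)
    have h₂ := (rtt_entry M₂.T u v (u - v)).mp (M₂.rtt u v)
    simp only [tensorT_mul M₁ M₂ u v, tensorT_mul' M₁ M₂ u v]
    exact sum_bilinear_exchange (tensorEnd V W) (fun p q => rEntry η (u - v) (i, k) (p, q))
      (fun m n => rEntry η (u - v) (m, n) (j, l))
      (fun p q m n => rEntry η (u - v) (p, q) (m, n))
      (fun p q m n => M₁.T u p m * M₁.T v q n) (fun p q => M₁.T v k q * M₁.T u i p)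
      (fun m n => M₂.T u m j * M₂.T v n l) (fun p q m n => M₂.T v q n * M₂.T u p m)
      (fun m n => h₁ i k m n) (fun p q => h₂ p q j l)
  A_vac u := by
    rw [tensorT_tmul, M₁.A_vac, M₂.A_vac, M₂.C_vac, TensorProduct.tmul_zero, add_zero,
      TensorProduct.smul_tmul_smul]
  D_vac u := by
    rw [tensorT_tmul, M₁.C_vac, M₁.D_vac, M₂.D_vac, TensorProduct.zero_tmul, zero_add,
      TensorProduct.smul_tmul_smul]
  C_vac u := by
    rw [tensorT_tmul, M₁.C_vac, M₂.C_vac, TensorProduct.zero_tmul, zero_add,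
      TensorProduct.tmul_zero]
  dualVac_A u := TensorProduct.ext' fun x y => by
    have h₁ := M₁.toRep.dual_A u x
    have h₂ := M₂.toRep.dual_A u y
    have h₃ := M₁.toRep.dual_B u x
    simp only [toRep] at h₁ h₂ h₃
    rw [LinearMap.comp_apply, tensorT_tmul, map_add, LinearMap.smul_apply]
    simp only [tensorDual_tmul, h₁, h₂, h₃, smul_eq_mul]
    ring
  dualVac_D u := TensorProduct.ext' fun x y => by
    have h₁ := M₁.toRep.dual_D u x
    have h₂ := M₂.toRep.dual_D u y
    have h₃ := M₂.toRep.dual_B u y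
    simp only [toRep] at h₁ h₂ h₃
    rw [LinearMap.comp_apply, tensorT_tmul, map_add, LinearMap.smul_apply]
    simp only [tensorDual_tmul, h₁, h₂, h₃, smul_eq_mul]
    ring
  dualVac_B u := TensorProduct.ext' fun x y => by
    have h₁ := M₁.toRep.dual_B u x
    have h₂ := M₂.toRep.dual_B u y
    simp only [toRep] at h₁ h₂
    rw [LinearMap.comp_apply, tensorT_tmul, map_add]
    simp only [tensorDual_tmul, h₁, h₂, LinearMap.zero_apply]
    ring
  dualVac_vac := by rw [tensorDual_tmul, M₁.dualVac_vac, M₂.dualVac_vac, one_mul]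

/-- Of the four intermediate index pairs, the two mixed ones are reordered by the row relation in
the first factor and the column relation in the second. Their g-terms involve the same operator and
cancel since g is odd; what remains is symmetric in u and v. -/
theorem EntriesCommute.tensor {M₁ : GeneralizedModel η V} {M₂ : GeneralizedModel η W}
    (h₁ : M₁.EntriesCommute) (h₂ : M₂.EntriesCommute) : (M₁.tensor M₂).EntriesCommute := by
  have key : ∀ u v, Complex.sinh (u - v) ≠ 0 → ∀ i j,
      (M₁.tensor M₂).T u i j * (M₁.tensor M₂).T v i j =
      tensorEnd V W (M₁.T u i 0 * M₁.T v i 0) (M₂.T u 0 j * M₂.T v 0 j) +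
      tensorEnd V W (M₁.T u i 1 * M₁.T v i 1) (M₂.T u 1 j * M₂.T v 1 j) +
      (fFun η v u • tensorEnd V W (M₁.T v i 1 * M₁.T u i 0) (M₂.T u 0 j * M₂.T v 1 j) +
      fFun η u v • tensorEnd V W (M₁.T u i 1 * M₁.T v i 0) (M₂.T v 0 j * M₂.T u 1 j)) := by
    intro u v h i j
    have h0 : (M₁.tensor M₂).T = tensorT M₁ M₂ := rfl
    rw [h0, tensorT_mul, Fin.sum_univ_two, Fin.sum_univ_two, Fin.sum_univ_two]
    rw [M₁.row_exchange h i, M₂.col_exchange h j, gFun_swap η v u]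
    simp only [map_add, map_smul, LinearMap.add_apply, LinearMap.smul_apply, neg_smul, map_neg]
    abel
  intro u v h i j
  rw [key u v h, key v u (sinh_sub_ne_zero_symm h), h₁ u v h, h₁ u v h, h₂ u v h, h₂ u v h]
  abel

end GeneralizedModel

/-- A diagonal operator on sequences. -/
def seqDiag (c : ℕ → ℂ) : Module.End ℂ (ℕ → ℂ) where
  toFun ψ n := c n * ψ n
  map_add' ψ φ := by ext n; simp [mul_add]
  map_smul' r ψ := by ext n; simp; ring

/-- The right shift on sequences. -/
def seqRaise : Module.End ℂ (ℕ → ℂ) where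
  toFun ψ n := Nat.casesOn n 0 ψ
  map_add' ψ φ := by ext n; cases n <;> simp
  map_smul' r ψ := by ext n; cases n <;> simp

/-- A weighted left shift on sequences. -/
def seqLower (c : ℕ → ℂ) : Module.End ℂ (ℕ → ℂ) where
  toFun ψ n := c n * ψ (n + 1)
  map_add' ψ φ := by ext n; simp [mul_add]
  map_smul' r ψ := by ext n; simp; ring

theorem seqDiag_apply (c : ℕ → ℂ) (ψ : ℕ → ℂ) (n : ℕ) : seqDiag c ψ n = c n * ψ n := rfl
theorem seqLower_apply (c : ℕ → ℂ) (ψ : ℕ → ℂ) (n : ℕ) :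
    seqLower c ψ n = c n * ψ (n + 1) := rfl
theorem seqRaise_zero (ψ : ℕ → ℂ) : seqRaise ψ 0 = 0 := rfl
theorem seqRaise_succ (ψ : ℕ → ℂ) (n : ℕ) : seqRaise ψ (n + 1) = ψ n := rfl

/-- Diagonal weights of `A` for an oscillator site. -/
def siteA (η p q u : ℂ) (n : ℕ) : ℂ :=
  p * (Complex.exp u / Complex.exp η ^ n) - q * (Complex.exp η ^ n / Complex.exp u)

/-- Diagonal weights of `D` for an oscillator site. -/
def siteD (η r s u : ℂ) (n : ℕ) : ℂ :=
  r * (Complex.exp u * Complex.exp η ^ n) - s / (Complex.exp u * Complex.exp η ^ n)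

/-- The weight of `C` between the levels `n` and `n - 1` of an oscillator site. -/
def siteC (η p q r s : ℂ) : ℕ → ℂ
  | 0 => 0
  | n + 1 => siteC η p q r s n + 2 * Complex.sinh η *
      (p * s / (Complex.exp η ^ n) ^ 2 - q * r * (Complex.exp η ^ n) ^ 2)

/-- The oscillator monodromy matrix. -/
def siteT (η p q r s u : ℂ) : Matrix (Fin 2) (Fin 2) (Module.End ℂ (ℕ → ℂ)) :=
  !![seqDiag (siteA η p q u), seqRaise;
     seqLower fun n => siteC η p q r s (n + 1), seqDiag (siteD η r s u)]

theorem sinh_eq_exp (x : ℂ) : Complex.sinh x = (Complex.exp x - 1 / Complex.exp x) / 2 := by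
  rw [Complex.sinh, Complex.exp_neg, one_div]

/-- On each coordinate n every component is an identity between rational functions of e^u, e^v, e^η
and e^{nη}. The recursion defining `siteC` supplies the relation between C and B; n = 0 is separate
because the raising operator vanishes there. -/
theorem site_rtt (η p q r s u v : ℂ) :
    operatorR (ℕ → ℂ) η (u - v) *
        ((siteT η p q r s u ⊗ₖ (1 : Matrix (Fin 2) (Fin 2) (Module.End ℂ (ℕ → ℂ)))) *
          ((1 : Matrix (Fin 2) (Fin 2) (Module.End ℂ (ℕ → ℂ))) ⊗ₖ siteT η p q r s v)) =
      (((1 : Matrix (Fin 2) (Fin 2) (Module.End ℂ (ℕ → ℂ))) ⊗ₖ siteT η p q r s v) *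
          (siteT η p q r s u ⊗ₖ (1 : Matrix (Fin 2) (Fin 2) (Module.End ℂ (ℕ → ℂ))))) *
        operatorR (ℕ → ℂ) η (u - v) := by
  rw [rtt_components (siteT η p q r s)]
  have hu := Complex.exp_ne_zero u
  have hv := Complex.exp_ne_zero v
  have he := Complex.exp_ne_zero η
  intro i k j l
  refine LinearMap.ext fun ψ => funext fun n => ?_
  have hen : Complex.exp η ^ n ≠ 0 := pow_ne_zero _ he
  fin_cases i <;> fin_cases k <;> fin_cases j <;> fin_cases l <;>
    simp [siteT, Module.End.mul_apply, seqDiag_apply, seqLower_apply, -mul_eq_mul_left_iff,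
      -mul_eq_mul_right_iff] <;>
    cases n <;>
    simp only [seqDiag_apply, seqLower_apply, seqRaise_zero, seqRaise_succ, siteA, siteD, siteC,
      sinh_eq_exp, Complex.exp_add, Complex.exp_sub, pow_succ, pow_zero, mul_zero,
      add_zero, zero_add] <;>
    (try simp only [pow_succ] at hen) <;>
    field_simp <;> ring

/-- An oscillator site as a generalized model. -/
def siteModel (η p q r s : ℂ) : GeneralizedModel η (ℕ → ℂ) where
  T := siteT η p q r s
  a u := p * Complex.exp u - q / Complex.exp u
  d u := r * Complex.exp u - s / Complex.exp u
  vac := Pi.single 0 1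
  dualVac := LinearMap.proj 0
  rtt := site_rtt η p q r s
  A_vac u := by
    ext n; cases n <;> simp [siteT, seqDiag_apply, siteA, div_eq_mul_inv]
  D_vac u := by
    ext n; cases n <;> simp [siteT, seqDiag_apply, siteD]
  C_vac u := by
    ext n; simp [siteT, seqLower_apply]
  dualVac_A u := by
    ext n; simp [siteT, seqDiag_apply, siteA, div_eq_mul_inv]
  dualVac_D u := by
    ext n; simp [siteT, seqDiag_apply, siteD]
  dualVac_B u := by
    ext n; simp [siteT, seqRaise_zero]
  dualVac_vac := by simp

/-- B and C of a site do not depend on the spectral parameter, while A and D are diagonal. -/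
theorem siteModel_entriesCommute (η p q r s : ℂ) :
    (siteModel η p q r s).EntriesCommute := by
  intro u v _ i j
  refine LinearMap.ext fun ψ => funext fun n => ?_
  fin_cases i <;> fin_cases j <;>
    simp [siteModel, siteT, seqDiag_apply] <;> ring

/-- There are models whose vacuum eigenvalues have prescribed zeros. -/
theorem exists_model (η : ℂ) (S T : Finset ℂ) :
    ∃ (V : Type) (_ : AddCommGroup V) (_ : Module ℂ V) (M : GeneralizedModel η V),
      M.EntriesCommute ∧ (∀ u ∈ S, M.a u = 0) ∧ (∀ u ∈ T, M.d u = 0) ∧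
      (∀ u, (∀ x ∈ S, Complex.sinh (u - x) ≠ 0) → M.a u ≠ 0) ∧
      (∀ u, (∀ x ∈ T, Complex.sinh (u - x) ≠ 0) → M.d u ≠ 0) := by
  induction S using Finset.induction_on with
  | empty =>
    induction T using Finset.induction_on with
    | empty =>
      refine ⟨ℕ → ℂ, inferInstance, inferInstance, siteModel η 1 0 1 0,
        siteModel_entriesCommute _ _ _ _ _, by simp, by simp, ?_, ?_⟩ <;>
      simp [siteModel]
    | insert y T _ ih =>
      obtain ⟨V, _, _, M, hc, hS, hT, ha, hd⟩ := ih
      -- Each prescribed zero costs one site: here d(u) = sinh(u - y), while a(u) = e^u never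
      -- vanishes.
      have hsite : ∀ u, (siteModel η 1 0 (Complex.exp (-y) / 2) (Complex.exp y / 2)).d u =
          Complex.sinh (u - y) := fun u => by
        simp only [siteModel, sinh_eq_exp, Complex.exp_sub, Complex.exp_neg]
        have := Complex.exp_ne_zero u
        have := Complex.exp_ne_zero y
        field_simp
      refine ⟨V ⊗[ℂ] (ℕ → ℂ), inferInstance, inferInstance,
        M.tensor (siteModel η 1 0 (Complex.exp (-y) / 2) (Complex.exp y / 2)),
        hc.tensor (siteModel_entriesCommute _ _ _ _ _), by simp, ?_, ?_, ?_⟩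
      · intro u hu
        change M.d u * _ = 0
        rw [hsite]
        rcases Finset.mem_insert.mp hu with rfl | hu
        · simp
        · rw [hT u hu, zero_mul]
      · intro u hu
        exact mul_ne_zero (ha u hu) (by simp [siteModel])
      · intro u hu
        change M.d u * _ ≠ 0
        rw [hsite]
        exact mul_ne_zero (hd u fun x hx => hu x (Finset.mem_insert_of_mem hx))
          (hu y (Finset.mem_insert_self _ _))
  | insert y S _ ih =>
    obtain ⟨V, _, _, M, hc, hS, hT, ha, hd⟩ := ih
    have hsite : ∀ u, (siteModel η (Complex.exp (-y) / 2) (Complex.exp y / 2) 1 0).a u =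
        Complex.sinh (u - y) := fun u => by
      simp only [siteModel, sinh_eq_exp, Complex.exp_sub, Complex.exp_neg]
      have := Complex.exp_ne_zero u
      have := Complex.exp_ne_zero y
      field_simp
    refine ⟨V ⊗[ℂ] (ℕ → ℂ), inferInstance, inferInstance,
      M.tensor (siteModel η (Complex.exp (-y) / 2) (Complex.exp y / 2) 1 0),
      hc.tensor (siteModel_entriesCommute _ _ _ _ _), ?_, ?_, ?_, ?_⟩
    · intro u hu
      change M.a u * _ = 0
      rw [hsite]
      rcases Finset.mem_insert.mp hu with rfl | hu
      · simp
      · rw [hS u hu, zero_mul]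
    · intro u hu
      change M.d u * _ = 0
      rw [hT u hu, zero_mul]
    · intro u hu
      change M.a u * _ ≠ 0
      rw [hsite]
      exact mul_ne_zero (ha u fun x hx => hu x (Finset.mem_insert_of_mem hx))
        (hu y (Finset.mem_insert_self _ _))
    · intro u hu
      exact mul_ne_zero (hd u hu) (by simp [siteModel])

/-! ### Action of A, D and C on the vectors B(y₁)⋯B(yₙ)|0⟩ -/

section Identities

variable {η u y k : ℂ}

/-- When A(u) passes B(y), the term in which it is absorbed at k arises in two ways, directly or
with y as intermediate argument; this adds the two weights. -/
theorem f_mul_g_add (huy : Complex.sinh (u - y) ≠ 0) (hyk : Complex.sinh (y - k) ≠ 0)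
    (huk : Complex.sinh (u - k) ≠ 0) :
    fFun η y u * gFun η u k + gFun η u y * gFun η y k = gFun η u k * fFun η y k := by
  have hyu := sinh_sub_ne_zero_symm huy
  have e1 : Complex.sinh (y - u) = -Complex.sinh (u - y) := sinh_sub_swap _ _
  unfold fFun gFun
  rw [e1]
  field_simp
  simp only [sinh_eq_exp, Complex.exp_sub, Complex.exp_add]
  have := Complex.exp_ne_zero u
  have := Complex.exp_ne_zero y
  have := Complex.exp_ne_zero k
  have := Complex.exp_ne_zero η
  field_simp
  ring

/-- The analogous merging of the two contributions at k when C passes B(y). -/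
theorem g_add_g_mul (huy : Complex.sinh (u - y) ≠ 0) (hyk : Complex.sinh (y - k) ≠ 0)
    (huk : Complex.sinh (u - k) ≠ 0) :
    gFun η u k + gFun η u y * gFun η y k * fFun η u k =
      gFun η u k * (fFun η y k * fFun η u y) := by
  unfold fFun gFun
  field_simp
  simp only [sinh_eq_exp, Complex.exp_sub, Complex.exp_add]
  have := Complex.exp_ne_zero u
  have := Complex.exp_ne_zero y
  have := Complex.exp_ne_zero k
  have := Complex.exp_ne_zero η
  field_simp
  ring

end Identities

theorem Sep.cons_cons {u y : ℂ} {Y : List ℂ} (h : Sep (u :: y :: Y)) :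
    Complex.sinh (u - y) ≠ 0 ∧ Sep (u :: Y) ∧ Sep (y :: Y) := by
  have h1 := List.pairwise_cons.mp h
  exact ⟨h1.1 y (by simp), h.sublist (by simp), h1.2⟩

theorem Sep.sinh_ne {u k : ℂ} {Y : List ℂ} (h : Sep (u :: Y)) (hk : k ∈ Y) :
    Complex.sinh (u - k) ≠ 0 :=
  (List.pairwise_cons.mp h).1 k hk

theorem Sep.ne {u k : ℂ} {Y : List ℂ} (h : Sep (u :: Y)) (hk : k ∈ Y) : u ≠ k := by
  rintro rfl; simpa using h.sinh_ne hk

namespace VacuumRep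

variable {η : ℂ} {V : Type*} [AddCommGroup V] [Module ℂ V] (R : VacuumRep η V)

/-- The operators `B` commute at separated points. -/
def CommB : Prop := ∀ u v, Complex.sinh (u - v) ≠ 0 → R.B u * R.B v = R.B v * R.B u

/-- The operators `C` commute at separated points. -/
def CommC : Prop := ∀ u v, Complex.sinh (u - v) ≠ 0 → R.C u * R.C v = R.C v * R.C u

/-- The vector `B(y₁) ⋯ B(yₙ)|0⟩`. -/
def vecB (Y : List ℂ) : V := (Y.map R.B).prod R.vac

theorem vecB_cons (y : ℂ) (Y : List ℂ) : R.vecB (y :: Y) = R.B y (R.vecB Y) := by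
  simp [vecB]

/-- Every unwanted term carries some d(y) with y ∈ Y, so the vector is an eigenvector without Bethe
equations. -/
theorem D_vecB {u : ℂ} {Y : List ℂ} (hs : Sep (u :: Y)) (hd : ∀ y ∈ Y, R.d y = 0) :
    R.D u (R.vecB Y) = (R.d u * (Y.map fun y => fFun η u y).prod) • R.vecB Y := by
  induction Y generalizing u with
  | nil => simp [vecB, R.D_vac]
  | cons y Y ih =>
    obtain ⟨h1, h2, h3⟩ := hs.cons_cons
    have hd' : ∀ y ∈ Y, R.d y = 0 := fun z hz => hd z (List.mem_cons_of_mem _ hz)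
    have := LinearMap.congr_fun (R.DB u y h1) (R.vecB Y)
    simp only [Module.End.mul_apply, LinearMap.add_apply, LinearMap.smul_apply] at this
    rw [vecB_cons, this, ih h2 hd', ih h3 hd', hd y (by simp)]
    simp only [zero_mul, zero_smul, map_zero, smul_zero, add_zero, map_smul, smul_smul,
      List.map_cons, List.prod_cons]
    congr 1; ring

theorem A_vecB_of_zero {u : ℂ} {Y : List ℂ} (hs : Sep (u :: Y)) (ha : ∀ y ∈ Y, R.a y = 0) :
    R.A u (R.vecB Y) = (R.a u * (Y.map fun y => fFun η y u).prod) • R.vecB Y := by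
  induction Y generalizing u with
  | nil => simp [vecB, R.A_vac]
  | cons y Y ih =>
    obtain ⟨h1, h2, h3⟩ := hs.cons_cons
    have ha' : ∀ y ∈ Y, R.a y = 0 := fun z hz => ha z (List.mem_cons_of_mem _ hz)
    have := LinearMap.congr_fun (R.AB u y h1) (R.vecB Y)
    simp only [Module.End.mul_apply, LinearMap.add_apply, LinearMap.smul_apply] at this
    rw [vecB_cons, this, ih h2 ha', ih h3 ha', ha y (by simp)]
    simp only [zero_mul, zero_smul, map_zero, smul_zero, add_zero, map_smul, smul_smul,
      List.map_cons, List.prod_cons]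
    congr 1; ring

theorem A_vecB (hB : R.CommB) {u : ℂ} {Y : List ℂ} (hs : Sep (u :: Y)) :
    R.A u (R.vecB Y) = (R.a u * (Y.map fun y => fFun η y u).prod) • R.vecB Y +
      (Y.map fun k => (gFun η u k * R.a k * ((Y.erase k).map fun l => fFun η l k).prod) •
        R.vecB (u :: Y.erase k)).sum := by
  induction Y generalizing u with
  | nil => simp [vecB, R.A_vac]
  | cons y Y ih =>
    obtain ⟨h1, h2, h3⟩ := hs.cons_cons
    have := LinearMap.congr_fun (R.AB u y h1) (R.vecB Y)
    simp only [Module.End.mul_apply, LinearMap.add_apply, LinearMap.smul_apply] at this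
    rw [vecB_cons, this, ih h2, ih h3]
    simp only [map_add, map_smul, smul_add, smul_smul, List.map_cons, List.prod_cons,
      List.sum_cons, List.erase_cons_head, map_list_sum, List.smul_sum, List.map_map,
      Function.comp_def]
    have hsum : (Y.map fun k => (gFun η u k * R.a k *
          (((y :: Y).erase k).map fun l => fFun η l k).prod) •
          R.vecB (u :: (y :: Y).erase k)).sum =
        (Y.map fun k => (fFun η y u * (gFun η u k * R.a k *
          ((Y.erase k).map fun l => fFun η l k).prod)) • R.B y (R.vecB (u :: Y.erase k))).sum +
        (Y.map fun k => (gFun η u y * (gFun η y k * R.a k *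
          ((Y.erase k).map fun l => fFun η l k).prod)) •
            R.B u (R.vecB (y :: Y.erase k))).sum := by
      rw [← List.sum_map_add]
      refine congrArg List.sum (List.map_congr_left fun k hk => ?_)
      have hyk : y ≠ k := h3.ne hk
      have hBB := LinearMap.congr_fun (hB y u (sinh_sub_ne_zero_symm h1)) (R.vecB (Y.erase k))
      simp only [Module.End.mul_apply] at hBB
      rw [List.erase_cons_tail (by simpa using hyk), R.vecB_cons u, R.vecB_cons y,
        R.vecB_cons u, hBB, ← add_smul, List.map_cons, List.prod_cons]
      congr 1
      have := f_mul_g_add h1 (h3.sinh_ne hk) (h2.sinh_ne hk) (η := η)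
      linear_combination (-R.a k * ((Y.erase k).map fun l => fFun η l k).prod) * this
    rw [hsum, R.vecB_cons u]
    module

/-- With d = 0 on Y, only A(y)D(x) survives in the commutator of C(x) with B(y). The D acts
diagonally, and the wanted and unwanted terms of A together remove one point k from Y. -/
theorem C_vecB (hB : R.CommB) {x : ℂ} {Y : List ℂ} (hs : Sep (x :: Y))
    (hd : ∀ y ∈ Y, R.d y = 0) :
    R.C x (R.vecB Y) =
      (Y.map fun k => (gFun η x k * R.a k * R.d x *
        ((Y.erase k).map fun l => fFun η l k * fFun η x l).prod) • R.vecB (Y.erase k)).sum := by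
  induction Y with
  | nil => simp [vecB, R.C_vac]
  | cons y Y ih =>
    obtain ⟨h1, h2, h3⟩ := hs.cons_cons
    have hd' : ∀ y ∈ Y, R.d y = 0 := fun z hz => hd z (List.mem_cons_of_mem _ hz)
    have := LinearMap.congr_fun (R.CB x y h1) (R.vecB Y)
    simp only [Module.End.mul_apply, LinearMap.add_apply, LinearMap.smul_apply,
      LinearMap.sub_apply] at this
    rw [vecB_cons, this, ih h2 hd', R.D_vecB h2 hd', R.D_vecB h3 hd', hd y (by simp)]
    simp only [zero_mul, zero_smul, map_zero, sub_zero, map_smul]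
    rw [R.A_vecB hB h3]
    simp only [map_smul, smul_add, smul_smul, List.map_cons,
      List.sum_cons, List.erase_cons_head, map_list_sum, List.smul_sum, List.map_map,
      Function.comp_def]
    have hsum : (Y.map fun k => (gFun η x k * R.a k * R.d x *
          (((y :: Y).erase k).map fun l => fFun η l k * fFun η x l).prod) •
          R.vecB ((y :: Y).erase k)).sum =
        (Y.map fun k => (gFun η x k * R.a k * R.d x *
          ((Y.erase k).map fun l => fFun η l k * fFun η x l).prod) •
            R.B y (R.vecB (Y.erase k))).sum +
        (Y.map fun k => (gFun η x y * (R.d x * (Y.map fun l => fFun η x l).prod *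
          (gFun η y k * R.a k * ((Y.erase k).map fun l => fFun η l k).prod))) •
            R.vecB (y :: Y.erase k)).sum := by
      rw [← List.sum_map_add]
      refine congrArg List.sum (List.map_congr_left fun k hk => ?_)
      have hyk : y ≠ k := h3.ne hk
      rw [List.erase_cons_tail (by simpa using hyk), R.vecB_cons y, ← add_smul, List.map_cons,
        List.prod_cons, ← List.prod_map_erase (fun l => fFun η x l) hk, List.prod_map_mul]
      congr 1
      have := g_add_g_mul h1 (h3.sinh_ne hk) (h2.sinh_ne hk) (η := η)
      linear_combination (-R.a k * R.d x * ((Y.erase k).map fun l => fFun η l k).prod *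
        ((Y.erase k).map fun l => fFun η x l).prod) * this
    rw [hsum, List.prod_map_mul]
    module

end VacuumRep

/-! ### The domain wall partition function on lists -/

/-- The partition function of the six-vertex model with domain wall boundary conditions, as
produced by the commutation of the operators `C` with the operators `B`. -/
def zList (η : ℂ) : List ℂ → List ℂ → ℂ
  | [], Y => if Y = [] then 1 else 0
  | x :: X, Y => (Y.map fun y => gFun η x y *
      ((Y.erase y).map fun l => fFun η l y * fFun η x l).prod * zList η X (Y.erase y)).sum

namespace VacuumRep

variable {η : ℂ} {V : Type*} [AddCommGroup V] [Module ℂ V] (R : VacuumRep η V)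

/-- Iterating `C_vecB` gives the recursion of `zList`. The list X is reversed because the operator
next to the Bethe vector acts first, whereas the recursion consumes the head. -/
theorem scalarProduct_reverse (hB : R.CommB) {X Y : List ℂ} (hs : Sep (X ++ Y))
    (hd : ∀ y ∈ Y, R.d y = 0) :
    R.scalarProduct X.reverse Y =
      (Y.map R.a).prod * (X.map R.d).prod * zList η X Y := by
  induction X generalizing Y with
  | nil =>
    cases Y with
    | nil => simp [scalarProduct, zList, R.dual_vac]
    | cons y Y => simp [scalarProduct, zList, R.dual_B]
  | cons x X ih =>
    have hxY : Sep (x :: Y) := hs.sublist (by simp)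
    have h1 : R.scalarProduct (x :: X).reverse Y =
        R.dualVac ((X.reverse.map R.C).prod (R.C x (R.vecB Y))) := by
      simp [scalarProduct, vecB]
    rw [h1, R.C_vecB hB hxY hd]
    simp only [map_list_sum, map_smul, List.map_map, Function.comp_def, zList]
    rw [← List.sum_map_mul_left]
    refine congrArg List.sum (List.map_congr_left fun k hk => ?_)
    have h2 : R.dualVac ((X.reverse.map R.C).prod (R.vecB (Y.erase k))) =
        R.scalarProduct X.reverse (Y.erase k) := rfl
    rw [h2, ih (hs.sublist ?_) fun y hy => hd y (List.mem_of_mem_erase hy),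
      ← List.prod_map_erase R.a hk, List.map_cons, List.prod_cons, smul_eq_mul]
    · ring
    · rw [List.cons_append]
      exact List.Sublist.cons _ (List.Sublist.append_left List.erase_sublist _)

end VacuumRep

theorem Sep.map_neg {X : List ℂ} (h : Sep X) : Sep (X.map Neg.neg) := by
  unfold Sep at h ⊢
  rw [List.pairwise_map]
  refine h.imp fun {u v} h => ?_
  rw [neg_sub_neg]
  exact sinh_sub_ne_zero_symm h

theorem prod_map_ne_zero {a : ℂ → ℂ} {Y : List ℂ} (h : ∀ y ∈ Y, a y ≠ 0) :
    (Y.map a).prod ≠ 0 := by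
  refine List.prod_ne_zero fun h0 => ?_
  obtain ⟨y, hy, hy0⟩ := List.mem_map.mp h0
  exact h y hy hy0

namespace VacuumRep

variable {η : ℂ} {V : Type*} [AddCommGroup V] [Module ℂ V] {R : VacuumRep η V}

theorem CommC.transpose (h : R.CommC) : R.transpose.CommB := fun u v huv => by
  change LinearMap.dualMap _ * LinearMap.dualMap _ = LinearMap.dualMap _ * LinearMap.dualMap _
  rw [← dualMap_mul, ← dualMap_mul, h u v huv]

theorem CommC.reflect (h : R.CommC) : R.reflect.CommC := fun u v huv =>
  h (-u) (-v) (by rw [neg_sub_neg]; exact sinh_sub_ne_zero_symm huv)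

theorem CommB.reflect (h : R.CommB) : R.reflect.CommB := fun u v huv =>
  h (-u) (-v) (by rw [neg_sub_neg]; exact sinh_sub_ne_zero_symm huv)

theorem scalarProduct_perm (hB : R.CommB) (hC : R.CommC) {X X' Y Y' : List ℂ}
    (hX : X.Perm X') (hY : Y.Perm Y') (hsX : Sep X) (hsY : Sep Y) :
    R.scalarProduct X Y = R.scalarProduct X' Y' := by
  unfold scalarProduct
  rw [(hX.map R.C).prod_eq' (List.pairwise_map.mpr (hsX.imp fun {u v} h => hC u v h)),
    (hY.map R.B).prod_eq' (List.pairwise_map.mpr (hsY.imp fun {u v} h => hB u v h))]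

theorem transpose_vecB (X : List ℂ) (x : V) :
    R.transpose.vecB X x = R.dualVac ((X.reverse.map R.C).prod x) :=
  prod_dualMap R.C X R.dualVac x

end VacuumRep

theorem GeneralizedModel.EntriesCommute.commB {η : ℂ} {V : Type*} [AddCommGroup V] [Module ℂ V]
    {M : GeneralizedModel η V} (h : M.EntriesCommute) : M.toRep.CommB :=
  fun u v huv => h u v huv 0 1

theorem GeneralizedModel.EntriesCommute.commC {η : ℂ} {V : Type*} [AddCommGroup V] [Module ℂ V]
    {M : GeneralizedModel η V} (h : M.EntriesCommute) : M.toRep.CommC :=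
  fun u v huv => h u v huv 1 0

/-- Representations with commuting `B` and `C` and with eigenvalues vanishing only where
prescribed. -/
theorem exists_rep (η : ℂ) (S T : List ℂ) :
    ∃ (V : Type) (_ : AddCommGroup V) (_ : Module ℂ V) (R : VacuumRep η V),
      R.CommB ∧ R.CommC ∧ (∀ u ∈ S, R.a u = 0) ∧ (∀ u ∈ T, R.d u = 0) ∧
      (∀ u, (∀ x ∈ S, Complex.sinh (u - x) ≠ 0) → R.a u ≠ 0) ∧
      (∀ u, (∀ x ∈ T, Complex.sinh (u - x) ≠ 0) → R.d u ≠ 0) := by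
  obtain ⟨V, i₁, i₂, M, hc, h1, h2, h3, h4⟩ := exists_model η S.toFinset T.toFinset
  refine ⟨V, i₁, i₂, M.toRep, hc.commB, hc.commC, ?_, ?_, ?_, ?_⟩
  · exact fun u hu => h1 u (List.mem_toFinset.mpr hu)
  · exact fun u hu => h2 u (List.mem_toFinset.mpr hu)
  · exact fun u hu => h3 u fun x hx => hu x (List.mem_toFinset.mp hx)
  · exact fun u hu => h4 u fun x hx => hu x (List.mem_toFinset.mp hx)

theorem Sep.append_sinh_ne {X Y : List ℂ} (h : Sep (X ++ Y)) {x y : ℂ} (hx : x ∈ X)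
    (hy : y ∈ Y) : Complex.sinh (x - y) ≠ 0 :=
  (List.pairwise_append.mp h).2.2 x hx y hy

/-- The recursion is not visibly symmetric, but the scalar product it computes is, in a model with
commuting B's and C's. There d vanishes on Y, while a on Y and d on X are nonzero and can be
cancelled. -/
theorem zList_perm {η : ℂ} {X X' Y Y' : List ℂ} (hX : X.Perm X') (hY : Y.Perm Y')
    (hs : Sep (X ++ Y)) : zList η X Y = zList η X' Y' := by
  obtain ⟨V, _, _, R, hB, hC, -, hT, ha, hd⟩ := exists_rep η [] Y
  have h1 := R.scalarProduct_reverse hB hs hT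
  have h2 := R.scalarProduct_reverse hB (hs.perm (hX.append hY))
    fun y hy => hT y (hY.mem_iff.mpr hy)
  have hsX : Sep X := hs.sublist (List.sublist_append_left _ _)
  rw [R.scalarProduct_perm hB hC ((List.reverse_perm X).trans
    (hX.trans (List.reverse_perm X').symm)) hY (hsX.perm (List.reverse_perm X).symm)
    (hs.sublist (List.sublist_append_right _ _)), h2, ← (hX.map R.d).prod_eq,
    ← (hY.map R.a).prod_eq] at h1
  refine (mul_left_cancel₀ (mul_ne_zero (prod_map_ne_zero fun y _ => ha y (by simp))
    (prod_map_ne_zero fun x hx => hd x fun y hy => hs.append_sinh_ne hx hy)) h1).symm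

/-- In a model with a = 0 on X and d = 0 on Y the same scalar product can be evaluated by moving the
C's to the right, or the B's to the left. The second evaluation is the first one in the reflected
and transposed representation. -/
theorem zList_neg {η : ℂ} {X Y : List ℂ} (hs : Sep (X ++ Y)) :
    zList η (Y.map Neg.neg) (X.map Neg.neg) = zList η X Y := by
  obtain ⟨V, _, _, R, hB, hC, hS, hT, ha, hd⟩ := exists_rep η X Y
  have h1 := R.scalarProduct_reverse hB hs hT
  have hs' : Sep (Y.map Neg.neg ++ X.map Neg.neg) := by
    rw [← List.map_append]
    exact (hs.perm List.perm_append_comm).map_neg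
  have h2 := R.reflect.transpose.scalarProduct_reverse hC.reflect.transpose hs'
    (by
      intro y hy
      obtain ⟨x, hx, rfl⟩ := List.mem_map.mp hy
      change R.a (- -x) = 0
      rw [neg_neg, hS x hx])
  rw [VacuumRep.scalarProduct_transpose, VacuumRep.scalarProduct_reflect, List.reverse_reverse,
    List.map_map, ← List.map_reverse, List.map_map] at h2
  have hid : (Neg.neg ∘ Neg.neg : ℂ → ℂ) = id := by ext; simp
  have e1 : (X.map Neg.neg).map R.reflect.transpose.a = X.map R.d := by
    simp [VacuumRep.reflect, VacuumRep.transpose]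
  have e2 : (Y.map Neg.neg).map R.reflect.transpose.d = Y.map R.a := by
    simp [VacuumRep.reflect, VacuumRep.transpose]
  rw [hid, List.map_id, List.map_id, h1, e1, e2, mul_comm (X.map R.d).prod] at h2
  refine (mul_left_cancel₀ (mul_ne_zero (prod_map_ne_zero fun y hy => ha y fun x hx => ?_)
    (prod_map_ne_zero fun x hx => hd x fun y hy => hs.append_sinh_ne hx hy)) h2).symm
  exact sinh_sub_ne_zero_symm (hs.append_sinh_ne hx hy)

/-- Both sides evaluate the matrix element with A(u) inserted between the C's and the B's. Since a =
0 on X, A(u) acts diagonally to the left; to the right it gives the usual wanted and unwanted terms.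
The zeros of d on u and Y make all the scalar products partition functions. -/
theorem zList_transfer {η u : ℂ} {X Y : List ℂ} (hs : Sep (X ++ u :: Y)) :
    (Y.map fun l => fFun η l u).prod * zList η X Y +
      (Y.map fun k => gFun η u k * ((Y.erase k).map fun l => fFun η l k).prod *
        zList η X (u :: Y.erase k)).sum =
      (X.map fun x => fFun η x u).prod * zList η X Y := by
  obtain ⟨V, _, _, R, hB, hC, hS, hT, ha, hd⟩ := exists_rep η X (u :: Y)
  have hsY : Sep (u :: Y) := hs.sublist (List.sublist_append_right _ _)
  have hsX : Sep (u :: X) := hs.sublist (by simp) |>.perm (List.perm_append_singleton u X)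
  have hXY : Sep (X ++ Y) := hs.sublist (List.Sublist.append_left (List.sublist_cons_self _ _) _)
  have haY : ∀ y ∈ u :: Y, R.a y ≠ 0 := fun y hy => ha y fun x hx =>
    sinh_sub_ne_zero_symm (hs.append_sinh_ne hx hy)
  have hdX : ∀ x ∈ X, R.d x ≠ 0 := fun x hx => hd x fun y hy => hs.append_sinh_ne hx hy
  have hZ := R.scalarProduct_reverse hB hXY fun y hy => hT y (List.mem_cons_of_mem _ hy)
  have hl := LinearMap.congr_fun (R.transpose.A_vecB_of_zero hsX hS) (R.vecB Y)
  have hl' : R.transpose.A u (R.transpose.vecB X) (R.vecB Y) =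
      R.transpose.vecB X (R.A u (R.vecB Y)) := rfl
  have hv : ∀ Y', R.transpose.vecB X (R.vecB Y') = R.scalarProduct X.reverse Y' :=
    fun Y' => R.transpose_vecB X _
  rw [hl', R.A_vecB hB hsY, LinearMap.smul_apply] at hl
  simp only [map_add, map_smul, map_list_sum, List.map_map, Function.comp_def, hv,
    smul_eq_mul] at hl
  have hr : (Y.map fun k => gFun η u k * R.a k * ((Y.erase k).map fun l => fFun η l k).prod *
        R.scalarProduct X.reverse (u :: Y.erase k)).sum =
      R.a u * (Y.map R.a).prod * (X.map R.d).prod *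
        (Y.map fun k => gFun η u k * ((Y.erase k).map fun l => fFun η l k).prod *
        zList η X (u :: Y.erase k)).sum := by
    rw [← List.sum_map_mul_left]
    refine congrArg List.sum (List.map_congr_left fun k hk => ?_)
    have hsub : List.Sublist (u :: Y.erase k) (u :: Y) := List.Sublist.cons_cons _ List.erase_sublist
    rw [R.scalarProduct_reverse hB (hs.sublist (List.Sublist.append_left hsub _))
      fun y hy => hT y (hsub.subset hy), ← List.prod_map_erase R.a hk, List.map_cons,
      List.prod_cons]
    ring
  rw [hr, hZ] at hl
  have hne : R.a u * (Y.map R.a).prod * (X.map R.d).prod ≠ 0 :=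
    mul_ne_zero (mul_ne_zero (haY u (by simp)) (prod_map_ne_zero fun y hy =>
      haY y (List.mem_cons_of_mem _ hy))) (prod_map_ne_zero hdX)
  refine mul_left_cancel₀ hne ?_
  have ht : R.transpose.a u = R.a u := rfl
  rw [ht] at hl
  linear_combination hl

/-! ### Coefficients of the scalar product from products of two models -/

/-- `∏ f(x, y)` over `x ∈ X`, `y ∈ Y`. -/
def fCross (η : ℂ) (X Y : List ℂ) : ℂ := (X.map fun x => (Y.map fun y => fFun η x y).prod).prod

theorem fCross_cons_left (η x : ℂ) (X Y : List ℂ) :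
    fCross η (x :: X) Y = (Y.map fun y => fFun η x y).prod * fCross η X Y := by
  simp [fCross]

theorem fCross_cons_right (η y : ℂ) (X Y : List ℂ) :
    fCross η X (y :: Y) = (X.map fun x => fFun η x y).prod * fCross η X Y := by
  simp [fCross, List.prod_map_mul]

theorem Sep.forall' {L : List ℂ} (h : Sep L) {p q : ℂ} (hp : p ∈ L) (hq : q ∈ L)
    (hne : p ≠ q) : Complex.sinh (p - q) ≠ 0 := by
  have : Std.Symm fun u v : ℂ => Complex.sinh (u - v) ≠ 0 :=
    ⟨fun _ _ h => sinh_sub_ne_zero_symm h⟩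
  exact List.Pairwise.forall h hp hq hne

section Tensor

variable {η : ℂ} {V W : Type*} [AddCommGroup V] [Module ℂ V] [AddCommGroup W] [Module ℂ W]
  (M₁ : GeneralizedModel η V) (M₂ : GeneralizedModel η W)

/-- In the product B = A ⊗ B + B ⊗ D, one summand dies at each point: B ⊗ D on J, where d₂ = 0, and
A ⊗ B off J, where a₁ = 0. The same zeros make A₁ and D₂ diagonal on the vectors already built,
which gives the f-factors. -/
theorem tensor_vecB (J : Finset ℂ) {Y : List ℂ} (hs : Sep Y)
    (h₁ : ∀ y ∈ Y, y ∉ J → M₁.a y = 0) (h₂ : ∀ y ∈ Y, y ∈ J → M₂.d y = 0) :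
    (M₁.tensor M₂).toRep.vecB Y =
      (((Y.filter (· ∈ J)).map M₁.a).prod * ((Y.filter (· ∉ J)).map M₂.d).prod *
        fCross η (Y.filter (· ∉ J)) (Y.filter (· ∈ J))) •
      (M₁.toRep.vecB (Y.filter (· ∉ J)) ⊗ₜ[ℂ] M₂.toRep.vecB (Y.filter (· ∈ J))) := by
  induction Y with
  | nil => simp [VacuumRep.vecB, fCross, GeneralizedModel.toRep, GeneralizedModel.tensor]
  | cons y Y ih =>
    have hs' : Sep Y := hs.sublist (List.sublist_cons_self _ _)
    have hB : ∀ v w, (M₁.tensor M₂).toRep.B y (v ⊗ₜ w) =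
        M₁.toRep.A y v ⊗ₜ M₂.toRep.B y w + M₁.toRep.B y v ⊗ₜ M₂.toRep.D y w :=
      fun v w => GeneralizedModel.tensorT_tmul M₁ M₂ y 0 1 v w
    have hA₁ := M₁.toRep.A_vecB_of_zero (u := y) (Y := Y.filter (· ∉ J))
      (hs.sublist (List.Sublist.cons_cons _ List.filter_sublist)) fun z hz => by
        simp only [List.mem_filter, decide_eq_true_eq] at hz
        exact h₁ z (List.mem_cons_of_mem _ hz.1) hz.2
    have hD₂ := M₂.toRep.D_vecB (u := y) (Y := Y.filter (· ∈ J))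
      (hs.sublist (List.Sublist.cons_cons _ List.filter_sublist)) fun z hz => by
        simp only [List.mem_filter, decide_eq_true_eq] at hz
        exact h₂ z (List.mem_cons_of_mem _ hz.1) hz.2
    have ha : M₁.toRep.a y = M₁.a y := rfl
    have hd : M₂.toRep.d y = M₂.d y := rfl
    rw [VacuumRep.vecB_cons, ih hs' (fun z hz => h₁ z (List.mem_cons_of_mem _ hz))
      (fun z hz => h₂ z (List.mem_cons_of_mem _ hz)), map_smul, hB, hA₁, hD₂, ha, hd]
    by_cases hy : y ∈ J
    · rw [h₂ y (by simp) hy, List.filter_cons_of_pos (by simpa using hy),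
        List.filter_cons_of_neg (by simpa using hy), zero_mul, zero_smul,
        TensorProduct.tmul_zero, add_zero, ← TensorProduct.smul_tmul', smul_smul,
        fCross_cons_right, M₂.toRep.vecB_cons, List.map_cons, List.prod_cons]
      congr 1; ring
    · rw [h₁ y (by simp) hy, List.filter_cons_of_neg (by simpa using hy),
        List.filter_cons_of_pos (by simpa using hy), zero_mul, zero_smul,
        TensorProduct.zero_tmul, zero_add, TensorProduct.tmul_smul, smul_smul,
        fCross_cons_left, M₁.toRep.vecB_cons, List.map_cons, List.prod_cons]
      congr 1; ring

/-- The dual counterpart, with C = C ⊗ A + D ⊗ C: on J only C ⊗ A survives, off J only D ⊗ C. -/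
theorem tensor_transpose_vecB (J : Finset ℂ) {X : List ℂ} (hs : Sep X)
    (h₁ : ∀ x ∈ X, x ∈ J → M₁.d x = 0) (h₂ : ∀ x ∈ X, x ∉ J → M₂.a x = 0) (v : V) (w : W) :
    (M₁.tensor M₂).toRep.transpose.vecB X (v ⊗ₜ w) =
      (((X.filter (· ∉ J)).map M₁.d).prod * ((X.filter (· ∈ J)).map M₂.a).prod *
        fCross η (X.filter (· ∉ J)) (X.filter (· ∈ J))) *
      (M₁.toRep.transpose.vecB (X.filter (· ∈ J)) v *
        M₂.toRep.transpose.vecB (X.filter (· ∉ J)) w) := by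
  induction X generalizing v w with
  | nil => simp [VacuumRep.vecB, fCross, GeneralizedModel.toRep, VacuumRep.transpose,
      GeneralizedModel.tensor, GeneralizedModel.tensorDual_tmul]
  | cons x X ih =>
    have hs' : Sep X := hs.sublist (List.sublist_cons_self _ _)
    have hC : (M₁.tensor M₂).toRep.C x (v ⊗ₜ w) =
        M₁.toRep.C x v ⊗ₜ M₂.toRep.A x w + M₁.toRep.D x v ⊗ₜ M₂.toRep.C x w :=
      GeneralizedModel.tensorT_tmul M₁ M₂ x 1 0 v w
    have hD₁ := LinearMap.congr_fun (M₁.toRep.transpose.D_vecB (u := x) (Y := X.filter (· ∈ J))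
      (hs.sublist (List.Sublist.cons_cons _ List.filter_sublist)) fun z hz => by
        simp only [List.mem_filter, decide_eq_true_eq] at hz
        exact h₁ z (List.mem_cons_of_mem _ hz.1) hz.2) v
    have hA₂ := LinearMap.congr_fun (M₂.toRep.transpose.A_vecB_of_zero (u := x)
      (Y := X.filter (· ∉ J))
      (hs.sublist (List.Sublist.cons_cons _ List.filter_sublist)) fun z hz => by
        simp only [List.mem_filter, decide_eq_true_eq] at hz
        exact h₂ z (List.mem_cons_of_mem _ hz.1) hz.2) w
    have hd : M₁.toRep.transpose.d x = M₁.d x := rfl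
    have ha : M₂.toRep.transpose.a x = M₂.a x := rfl
    change M₁.toRep.transpose.vecB _ (M₁.toRep.D x v) = _ at hD₁
    change M₂.toRep.transpose.vecB _ (M₂.toRep.A x w) = _ at hA₂
    have ih' := ih hs' (fun z hz => h₁ z (List.mem_cons_of_mem _ hz))
      (fun z hz => h₂ z (List.mem_cons_of_mem _ hz))
    have hl : (M₁.tensor M₂).toRep.transpose.vecB (x :: X) (v ⊗ₜ w) =
        (M₁.tensor M₂).toRep.transpose.vecB X ((M₁.tensor M₂).toRep.C x (v ⊗ₜ w)) := by
      rw [VacuumRep.vecB_cons]; rfl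
    rw [hl, hC, map_add, ih', ih', hD₁, hA₂, LinearMap.smul_apply, LinearMap.smul_apply, hd, ha]
    by_cases hx : x ∈ J
    · have h3 : M₁.toRep.transpose.vecB (x :: X.filter (· ∈ J)) v =
          M₁.toRep.transpose.vecB (X.filter (· ∈ J)) (M₁.toRep.C x v) := by
        rw [VacuumRep.vecB_cons]; rfl
      rw [h₁ x (by simp) hx, List.filter_cons_of_neg (by simpa using hx),
        List.filter_cons_of_pos (by simpa using hx), h3,
        fCross_cons_right, List.map_cons, List.prod_cons]
      simp only [smul_eq_mul]
      ring
    · have h3 : M₂.toRep.transpose.vecB (x :: X.filter (· ∉ J)) w =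
          M₂.toRep.transpose.vecB (X.filter (· ∉ J)) (M₂.toRep.C x w) := by
        rw [VacuumRep.vecB_cons]; rfl
      rw [h₂ x (by simp) hx, List.filter_cons_of_pos (by simpa using hx),
        List.filter_cons_of_neg (by simpa using hx), h3,
        fCross_cons_left, List.map_cons, List.prod_cons]
      simp only [smul_eq_mul]
      ring

end Tensor

/-- The coefficient of `∏_{p ∈ J} a(p) ∏_{p ∉ J} d(p)` in the scalar product. -/
def spCoeff (η : ℂ) (X Y : List ℂ) (J : Finset ℂ) : ℂ :=
  fCross η (X.filter (· ∉ J)) (X.filter (· ∈ J)) *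
    fCross η (Y.filter (· ∉ J)) (Y.filter (· ∈ J)) *
    (zList η (X.filter (· ∉ J)) (Y.filter (· ∈ J)) *
      zList η (Y.filter (· ∉ J)) (X.filter (· ∈ J)))

/-- Reflection exchanges a and d, so zeros of a on Y serve as well; `zList_neg` removes the
resulting signs and swaps the two arguments. -/
theorem VacuumRep.scalarProduct_reverse' {η : ℂ} {V : Type*} [AddCommGroup V] [Module ℂ V]
    (R : VacuumRep η V) (hB : R.CommB) {X Y : List ℂ} (hs : Sep (X ++ Y))
    (ha : ∀ y ∈ Y, R.a y = 0) :
    R.scalarProduct X.reverse Y = (Y.map R.d).prod * (X.map R.a).prod * zList η Y X := by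
  have h := R.reflect.scalarProduct_reverse hB.reflect (X := X.map Neg.neg) (Y := Y.map Neg.neg)
    (by rw [← List.map_append]; exact hs.map_neg)
    (by
      intro y hy
      obtain ⟨x, hx, rfl⟩ := List.mem_map.mp hy
      change R.a (- -x) = 0
      rw [neg_neg, ha x hx])
  have hid : (Neg.neg ∘ Neg.neg : ℂ → ℂ) = id := by ext; simp
  have e1 : (X.map Neg.neg).map R.reflect.d = X.map R.a := by simp [VacuumRep.reflect]
  have e2 : (Y.map Neg.neg).map R.reflect.a = Y.map R.d := by simp [VacuumRep.reflect]
  rw [scalarProduct_reflect, ← List.map_reverse, List.map_map, List.map_map, hid, List.map_id,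
    List.map_id, e1, e2, zList_neg (hs.perm List.perm_append_comm)] at h
  exact h

theorem tensor_scalarProduct {η : ℂ} {V W : Type*} [AddCommGroup V] [Module ℂ V]
    [AddCommGroup W] [Module ℂ W] {M₁ : GeneralizedModel η V} {M₂ : GeneralizedModel η W}
    (hc₁ : M₁.EntriesCommute) (hc₂ : M₂.EntriesCommute) (J : Finset ℂ) {X Y : List ℂ}
    (hs : Sep (X ++ Y))
    (hY₁ : ∀ y ∈ Y, y ∉ J → M₁.a y = 0) (hY₂ : ∀ y ∈ Y, y ∈ J → M₂.d y = 0)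
    (hX₁ : ∀ x ∈ X, x ∈ J → M₁.d x = 0) (hX₂ : ∀ x ∈ X, x ∉ J → M₂.a x = 0) :
    (M₁.tensor M₂).toRep.scalarProduct X.reverse Y =
      spCoeff η X Y J * ((((X ++ Y).filter (· ∈ J)).map (M₁.tensor M₂).a).prod *
        (((X ++ Y).filter (· ∉ J)).map (M₁.tensor M₂).d).prod) := by
  have hsX : Sep X := hs.sublist (List.sublist_append_left _ _)
  have hsY : Sep Y := hs.sublist (List.sublist_append_right _ _)
  have h0 : (M₁.tensor M₂).toRep.scalarProduct X.reverse Y =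
      (M₁.tensor M₂).toRep.transpose.vecB X ((M₁.tensor M₂).toRep.vecB Y) :=
    (VacuumRep.transpose_vecB X _).symm
  have h1 : ∀ X' Y', M₁.toRep.transpose.vecB X' (M₁.toRep.vecB Y') =
      M₁.toRep.scalarProduct X'.reverse Y' := fun X' Y' => VacuumRep.transpose_vecB X' _
  have h2 : ∀ X' Y', M₂.toRep.transpose.vecB X' (M₂.toRep.vecB Y') =
      M₂.toRep.scalarProduct X'.reverse Y' := fun X' Y' => VacuumRep.transpose_vecB X' _
  rw [h0, tensor_vecB M₁ M₂ J hsY hY₁ hY₂, map_smul,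
    tensor_transpose_vecB M₁ M₂ J hsX hX₁ hX₂, h1, h2,
    M₁.toRep.scalarProduct_reverse' hc₁.commB
      (hs.sublist (List.filter_sublist.append List.filter_sublist)) ?_,
    M₂.toRep.scalarProduct_reverse hc₂.commB
      (hs.sublist (List.filter_sublist.append List.filter_sublist)) ?_]
  · have ha : (M₁.tensor M₂).a = fun u => M₁.a u * M₂.a u := rfl
    have hd : (M₁.tensor M₂).d = fun u => M₁.d u * M₂.d u := rfl
    have e1 : M₁.toRep.a = M₁.a := rfl
    have e2 : M₁.toRep.d = M₁.d := rfl
    have e3 : M₂.toRep.a = M₂.a := rfl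
    have e4 : M₂.toRep.d = M₂.d := rfl
    rw [ha, hd, e1, e2, e3, e4, List.filter_append, List.filter_append, List.map_append,
      List.map_append, List.prod_append, List.prod_append, List.prod_map_mul, List.prod_map_mul,
      List.prod_map_mul, List.prod_map_mul, spCoeff, smul_eq_mul]
    ring
  · intro y hy
    simp only [List.mem_filter, decide_eq_true_eq] at hy
    exact hY₂ y hy.1 hy.2
  · intro y hy
    simp only [List.mem_filter, decide_eq_true_eq] at hy
    exact hY₁ y hy.1 hy.2

theorem filter_mem_toFinset {L : List ℂ} {J : Finset ℂ} (hJ : J ⊆ L.toFinset) :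
    (L.filter (· ∈ J)).toFinset = J := by
  ext p
  simp only [List.toFinset_filter, Finset.mem_filter, decide_eq_true_eq]
  exact ⟨fun h => h.2, fun h => ⟨hJ h, h⟩⟩

theorem filter_notMem_toFinset (L : List ℂ) (J : Finset ℂ) :
    (L.filter (· ∉ J)).toFinset = L.toFinset \ J := by
  ext p
  simp

/-- The scalar product as a multilinear function of the vacuum eigenvalues. -/
theorem VacuumRep.scalarProduct_eq_sum {η : ℂ} {V : Type*} [AddCommGroup V] [Module ℂ V]
    (R : VacuumRep η V) {X Y : List ℂ} (hs : Sep (X ++ Y)) :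
    R.scalarProduct X.reverse Y = ∑ J ∈ (X ++ Y).toFinset.powerset,
      spCoeff η X Y J * ((∏ p ∈ J, R.a p) * ∏ p ∈ (X ++ Y).toFinset \ J, R.d p) := by
  set w : List (Letter × ℂ) := X.reverse.map (fun x => (Letter.C, x)) ++
    Y.map fun y => (Letter.B, y) with hw
  have hpts : (points w).Perm (X ++ Y) := by
    simp only [hw, points, List.map_append, List.map_map, Function.comp_def, List.map_id']
    exact (List.reverse_perm X).append_right Y
  obtain ⟨c, hcoef⟩ := isUniversal_word (η := η) w (hs.perm hpts.symm)
  rw [List.toFinset_eq_of_perm _ _ hpts] at hcoef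
  -- Needed twice, since the given space and the model spaces live in different universes.
  -- Functionals on words mention no space, so the coefficients c are common to both.
  have heval : ∀ {V' : Type _} [AddCommGroup V'] [Module ℂ V'] (R' : VacuumRep η V'),
      R'.evalWord w = R'.scalarProduct X.reverse Y := by
    intro V' _ _ R'
    simp [hw, evalWord, scalarProduct, op, Function.comp_def]
  have heval' : ∀ {V' : Type} [AddCommGroup V'] [Module ℂ V'] (R' : VacuumRep η V'),
      R'.evalWord w = R'.scalarProduct X.reverse Y := by
    intro V' _ _ R'
    simp [hw, evalWord, scalarProduct, op, Function.comp_def]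
  rw [← heval, hcoef _ _ _ R.evalWord_isVacuumFunctional]
  refine Finset.sum_congr rfl fun J hJ => ?_
  congr 1
  have hJP := Finset.mem_powerset.mp hJ
  -- The zeros are distributed so that each factor meets the hypotheses of `tensor_scalarProduct`,
  -- while in the product a vanishes at the points off J and d at those in J, and nowhere else among
  -- the points.
  obtain ⟨V₁, _, _, M₁, hc₁, hS₁, hT₁, ha₁, hd₁⟩ := exists_model η
    (Y.filter (· ∉ J)).toFinset (X.filter (· ∈ J)).toFinset
  obtain ⟨V₂, _, _, M₂, hc₂, hS₂, hT₂, ha₂, hd₂⟩ := exists_model η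
    (X.filter (· ∉ J)).toFinset (Y.filter (· ∈ J)).toFinset
  simp only [List.mem_toFinset, List.mem_filter, decide_eq_true_eq, and_imp] at hS₁ hT₁ ha₁ hd₁
  simp only [List.mem_toFinset, List.mem_filter, decide_eq_true_eq, and_imp] at hS₂ hT₂ ha₂ hd₂
  have hE := hcoef _ _ _ (M₁.tensor M₂).toRep.evalWord_isVacuumFunctional
  have hsep : ∀ p ∈ X ++ Y, ∀ q ∈ X ++ Y, p ≠ q → Complex.sinh (p - q) ≠ 0 :=
    fun p hp q hq hne => hs.forall' hp hq hne
  have hdisj : ∀ x ∈ X, ∀ y ∈ Y, x ≠ y := fun x hx y hy => by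
    rintro rfl; simpa using hs.append_sinh_ne hx hy
  have ha0 : ∀ p ∈ X ++ Y, p ∉ J → (M₁.tensor M₂).toRep.a p = 0 := by
    intro p hp hpJ
    change M₁.a p * M₂.a p = 0
    rcases List.mem_append.mp hp with h | h
    · rw [hS₂ p h hpJ, mul_zero]
    · rw [hS₁ p h hpJ, zero_mul]
  have hd0 : ∀ p ∈ X ++ Y, p ∈ J → (M₁.tensor M₂).toRep.d p = 0 := by
    intro p hp hpJ
    change M₁.d p * M₂.d p = 0
    rcases List.mem_append.mp hp with h | h
    · rw [hT₁ p h hpJ, zero_mul]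
    · rw [hT₂ p h hpJ, mul_zero]
  have ha1 : ∀ p ∈ X ++ Y, p ∈ J → (M₁.tensor M₂).toRep.a p ≠ 0 := by
    intro p hp hpJ
    refine mul_ne_zero (ha₁ p fun q hq hqJ => ?_) (ha₂ p fun q hq hqJ => ?_)
    · exact hsep p hp q (List.mem_append_right _ hq) (by rintro rfl; exact hqJ hpJ)
    · exact hsep p hp q (List.mem_append_left _ hq) (by rintro rfl; exact hqJ hpJ)
  have hd1 : ∀ p ∈ X ++ Y, p ∉ J → (M₁.tensor M₂).toRep.d p ≠ 0 := by
    intro p hp hpJ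
    refine mul_ne_zero (hd₁ p fun q hq hqJ => ?_) (hd₂ p fun q hq hqJ => ?_)
    · exact hsep p hp q (List.mem_append_left _ hq) (by rintro rfl; exact hpJ hqJ)
    · exact hsep p hp q (List.mem_append_right _ hq) (by rintro rfl; exact hpJ hqJ)
  rw [heval', tensor_scalarProduct hc₁ hc₂ J hs hS₁ hT₂ hT₁ hS₂,
    Finset.sum_eq_single_of_mem J hJ] at hE
  · have hnd := hs.nodup
    rw [← List.prod_toFinset _ (hnd.filter _), ← List.prod_toFinset _ (hnd.filter _),
      filter_mem_toFinset hJP, filter_notMem_toFinset] at hE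
    refine (mul_right_cancel₀ (mul_ne_zero (Finset.prod_ne_zero_iff.mpr fun p hp =>
      ha1 p (List.mem_toFinset.mp (hJP hp)) hp) (Finset.prod_ne_zero_iff.mpr fun p hp =>
      hd1 p (List.mem_toFinset.mp (Finset.mem_sdiff.mp hp).1) (Finset.mem_sdiff.mp hp).2))
      hE).symm
  -- A subset other than J either misses a point of J, where d = 0, or contains a point off J, where
  -- a = 0.
  · intro J' hJ' hne
    have hJP' := Finset.mem_powerset.mp hJ'
    by_cases hsub : J' ⊆ J
    · obtain ⟨p, hp, hp'⟩ := Finset.not_subset.mp fun h => hne (Finset.Subset.antisymm hsub h)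
      rw [Finset.prod_eq_zero (Finset.mem_sdiff.mpr ⟨hJP hp, hp'⟩)
        (hd0 p (List.mem_toFinset.mp (hJP hp)) hp), mul_zero, mul_zero]
    · obtain ⟨p, hp, hp'⟩ := Finset.not_subset.mp hsub
      rw [Finset.prod_eq_zero hp (ha0 p (List.mem_toFinset.mp (hJP' hp)) hp'), zero_mul,
        mul_zero]

/-! ### The partition function on finite sets -/

/-- Two disjoint finite sets whose points are all separated modulo `iπ`. -/
structure SepPair (X Y : Finset ℂ) : Prop where
  left : ∀ p ∈ X, ∀ q ∈ X, p ≠ q → Complex.sinh (p - q) ≠ 0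
  right : ∀ p ∈ Y, ∀ q ∈ Y, p ≠ q → Complex.sinh (p - q) ≠ 0
  cross : ∀ p ∈ X, ∀ q ∈ Y, Complex.sinh (p - q) ≠ 0

namespace SepPair

variable {X Y : Finset ℂ}

theorem mono (h : SepPair X Y) {X' Y' : Finset ℂ} (hX : X' ⊆ X) (hY : Y' ⊆ Y) :
    SepPair X' Y' :=
  ⟨fun p hp q hq => h.left p (hX hp) q (hX hq), fun p hp q hq => h.right p (hY hp) q (hY hq),
    fun p hp q hq => h.cross p (hX hp) q (hY hq)⟩

theorem symm (h : SepPair X Y) : SepPair Y X :=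
  ⟨h.right, h.left, fun p hp q hq => sinh_sub_ne_zero_symm (h.cross q hq p hp)⟩

theorem neg (h : SepPair X Y) : SepPair (X.image Neg.neg) (Y.image Neg.neg) := by
  refine ⟨?_, ?_, ?_⟩ <;> simp only [Finset.forall_mem_image] <;> intro p hp q hq
  · intro hne
    rw [neg_sub_neg]
    exact h.left q hq p hp fun h => hne (by rw [h])
  · intro hne
    rw [neg_sub_neg]
    exact h.right q hq p hp fun h => hne (by rw [h])
  · rw [neg_sub_neg]
    exact sinh_sub_ne_zero_symm (h.cross p hp q hq)

theorem notMem (h : SepPair X Y) {p : ℂ} (hp : p ∈ X) : p ∉ Y := fun hq => by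
  simpa using h.cross p hp p hq

theorem sep (h : SepPair X Y) {L L' : List ℂ} (hL : L.toFinset = X) (hL' : L'.toFinset = Y)
    (hn : L.Nodup) (hn' : L'.Nodup) : Sep (L ++ L') := by
  subst hL hL'
  refine List.pairwise_append.mpr ⟨?_, ?_, ?_⟩
  · exact hn.imp_of_mem fun {p q} hp hq hne =>
      h.left p (List.mem_toFinset.mpr hp) q (List.mem_toFinset.mpr hq) hne
  · exact hn'.imp_of_mem fun {p q} hp hq hne =>
      h.right p (List.mem_toFinset.mpr hp) q (List.mem_toFinset.mpr hq) hne
  · exact fun p hp q hq =>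
      h.cross p (List.mem_toFinset.mpr hp) q (List.mem_toFinset.mpr hq)

theorem sep_toList (h : SepPair X Y) : Sep (X.toList ++ Y.toList) :=
  h.sep (Finset.toList_toFinset X) (Finset.toList_toFinset Y) X.nodup_toList Y.nodup_toList

end SepPair

theorem Sep.sepPair {L L' : List ℂ} (h : Sep (L ++ L')) : SepPair L.toFinset L'.toFinset := by
  refine ⟨?_, ?_, ?_⟩ <;> intro p hp q hq <;> rw [List.mem_toFinset] at hp hq
  · exact h.forall' (List.mem_append_left _ hp) (List.mem_append_left _ hq)
  · exact h.forall' (List.mem_append_right _ hp) (List.mem_append_right _ hq)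
  · exact h.append_sinh_ne hp hq

/-- The domain wall partition function of two finite sets of points. -/
def zF (η : ℂ) (X Y : Finset ℂ) : ℂ := zList η X.toList Y.toList

theorem zList_eq_zF {η : ℂ} {X Y : List ℂ} (h : Sep (X ++ Y)) :
    zList η X Y = zF η X.toFinset Y.toFinset :=
  zList_perm (List.toFinset_toList (h.sublist (List.sublist_append_left _ _)).nodup).symm
    (List.toFinset_toList (h.sublist (List.sublist_append_right _ _)).nodup).symm h

theorem zF_empty_left (η : ℂ) (Y : Finset ℂ) : zF η ∅ Y = if Y = ∅ then 1 else 0 := by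
  simp [zF, zList]

variable {η : ℂ}

theorem toList_erase_perm (Y : Finset ℂ) (y : ℂ) :
    (Y.toList.erase y).Perm (Y.erase y).toList := by
  refine (List.perm_ext_iff_of_nodup (Y.nodup_toList.erase _) (Finset.nodup_toList _)).mpr ?_
  intro a
  rw [Y.nodup_toList.mem_erase_iff]
  simp

theorem toList_insert_perm {Y : Finset ℂ} {y : ℂ} (h : y ∉ Y) :
    (insert y Y).toList.Perm (y :: Y.toList) :=
  Finset.toList_insert h

theorem prod_erase_toList (Y : Finset ℂ) (y : ℂ) (F : ℂ → ℂ) :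
    ((Y.toList.erase y).map F).prod = ∏ l ∈ Y.erase y, F l := by
  rw [((toList_erase_perm Y y).map F).prod_eq, Finset.prod_map_toList]

theorem zF_insert_left {X Y : Finset ℂ} {x : ℂ} (hx : x ∉ X) (h : SepPair (insert x X) Y) :
    zF η (insert x X) Y = ∑ y ∈ Y, gFun η x y *
      (∏ l ∈ Y.erase y, fFun η l y * fFun η x l) * zF η X (Y.erase y) := by
  have h' : SepPair X Y := h.mono (Finset.subset_insert _ _) subset_rfl
  rw [zF, zList_perm (toList_insert_perm hx) (List.Perm.refl _) h.sep_toList, zList,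
    ← Finset.sum_map_toList]
  refine congrArg List.sum (List.map_congr_left fun y hy => ?_)
  rw [prod_erase_toList, zF, zList_perm (List.Perm.refl _) (toList_erase_perm Y y)]
  exact h'.sep_toList.sublist (List.Sublist.append_left List.erase_sublist _)

theorem image_neg_toList_perm (X : Finset ℂ) :
    (X.image Neg.neg).toList.Perm (X.toList.map Neg.neg) := by
  refine (List.perm_ext_iff_of_nodup (Finset.nodup_toList _)
    (X.nodup_toList.map neg_injective)).mpr fun a => ?_
  simp

theorem zF_neg {X Y : Finset ℂ} (h : SepPair X Y) :
    zF η (Y.image Neg.neg) (X.image Neg.neg) = zF η X Y := by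
  rw [zF, zF, ← zList_neg h.sep_toList]
  exact zList_perm (image_neg_toList_perm Y) (image_neg_toList_perm X) h.symm.neg.sep_toList

/-- The recursion expands in a point of the first set; negating all points exchanges the two sets
and gives the expansion in a point of the second. -/
theorem zF_insert_right {X Y : Finset ℂ} {y : ℂ} (hy : y ∉ Y) (h : SepPair X (insert y Y)) :
    zF η X (insert y Y) = ∑ x ∈ X, gFun η x y *
      (∏ l ∈ X.erase x, fFun η x l * fFun η l y) * zF η (X.erase x) Y := by
  have hn : -y ∉ Y.image Neg.neg := by simpa using hy
  have hsep := h.symm.neg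
  rw [Finset.image_insert] at hsep
  rw [← zF_neg h, Finset.image_insert, zF_insert_left hn hsep,
    Finset.sum_image fun _ _ _ _ h => neg_injective h]
  refine Finset.sum_congr rfl fun x hx => ?_
  rw [← Finset.image_erase neg_injective, Finset.prod_image fun _ _ _ _ h => neg_injective h,
    gFun_neg, zF_neg (h.mono (Finset.erase_subset _ _) (Finset.subset_insert _ _))]
  simp only [fFun_neg]

theorem zF_transfer {X Y : Finset ℂ} {u : ℂ} (hu : u ∉ Y) (h : SepPair X (insert u Y)) :
    (∏ l ∈ Y, fFun η l u) * zF η X Y +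
      ∑ k ∈ Y, gFun η u k * (∏ l ∈ Y.erase k, fFun η l k) * zF η X (insert u (Y.erase k)) =
    (∏ x ∈ X, fFun η x u) * zF η X Y := by
  have hs : Sep (X.toList ++ u :: Y.toList) :=
    h.sep_toList.perm (List.Perm.append_left _ (toList_insert_perm hu))
  have ht := zList_transfer (η := η) hs
  rw [Finset.prod_map_toList, Finset.prod_map_toList] at ht
  rw [← Finset.sum_map_toList]
  refine Eq.trans (congrArg₂ _ rfl (congrArg List.sum (List.map_congr_left fun k hk => ?_))) ht
  have hk' : u ∉ Y.erase k := fun h => hu (Finset.mem_of_mem_erase h)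
  rw [prod_erase_toList, zF, zList_perm (List.Perm.refl _) ((toList_insert_perm hk').trans
    ((toList_erase_perm Y k).symm.cons u))]
  exact (h.mono subset_rfl (Finset.insert_subset_insert _ (Finset.erase_subset _ _))).sep_toList

theorem zF_transfer' {X Y : Finset ℂ} {u : ℂ} (hu : u ∉ X) (h : SepPair (insert u X) Y) :
    (∏ l ∈ X, fFun η u l) * zF η X Y +
      ∑ k ∈ X, gFun η k u * (∏ l ∈ X.erase k, fFun η k l) * zF η (insert u (X.erase k)) Y =
    (∏ y ∈ Y, fFun η u y) * zF η X Y := by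
  have hn : -u ∉ X.image Neg.neg := by simpa using hu
  have hsep := h.symm.neg
  rw [Finset.image_insert] at hsep
  have ht := zF_transfer (η := η) hn hsep
  have h' : SepPair X Y := h.mono (Finset.subset_insert _ _) subset_rfl
  rw [zF_neg h', Finset.sum_image fun _ _ _ _ h => neg_injective h,
    Finset.prod_image fun _ _ _ _ h => neg_injective h,
    Finset.prod_image fun _ _ _ _ h => neg_injective h] at ht
  simp only [fFun_neg] at ht
  rw [← ht]
  congr 1
  refine Finset.sum_congr rfl fun k hk => ?_
  rw [← Finset.image_erase neg_injective, Finset.prod_image fun _ _ _ _ h => neg_injective h,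
    gFun_neg, ← Finset.image_insert, zF_neg]
  · simp only [fFun_neg]
  · exact h.mono (Finset.insert_subset_insert _ (Finset.erase_subset _ _)) subset_rfl

/-! ### Trigonometric polynomials and the partition function as one of them -/

/-- Trigonometric polynomials of degree `n`: `e^{-nz} p(e^{2z})` with `p` of degree at most `n`. -/
def TrigPoly (n : ℕ) (φ : ℂ → ℂ) : Prop :=
  ∃ p : Polynomial ℂ, p.natDegree ≤ n ∧
    ∀ z, φ z = Complex.exp (-(n * z)) * p.eval (Complex.exp (2 * z))

namespace TrigPoly

variable {m n : ℕ} {φ ψ : ℂ → ℂ}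

theorem const (c : ℂ) : TrigPoly 0 fun _ => c :=
  ⟨Polynomial.C c, by simp, fun z => by simp⟩

theorem zero (n : ℕ) : TrigPoly n fun _ => 0 := ⟨0, by simp, fun z => by simp⟩

theorem sinh_sub (c : ℂ) : TrigPoly 1 fun z => Complex.sinh (z - c) := by
  refine ⟨Polynomial.C (Complex.exp (-c) / 2) * Polynomial.X - Polynomial.C (Complex.exp c / 2),
    by compute_degree, fun z => ?_⟩
  have h : Complex.exp (2 * z) = Complex.exp z * Complex.exp z := by
    rw [← Complex.exp_add]; congr 1; ring
  simp only [Polynomial.eval_sub, Polynomial.eval_mul, Polynomial.eval_C, Polynomial.eval_X,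
    Nat.cast_one, one_mul, Complex.sinh, h, neg_sub, Complex.exp_sub, Complex.exp_neg]
  field_simp

theorem sinh_sub_add (c η : ℂ) : TrigPoly 1 fun z => Complex.sinh (z - c + η) := by
  simpa only [sub_sub_eq_add_sub, add_sub_right_comm] using sinh_sub (c - η)

theorem sinh_sub_sub (c η : ℂ) : TrigPoly 1 fun z => Complex.sinh (z - c - η) := by
  simpa only [sub_sub] using sinh_sub (c + η)

theorem mul (hφ : TrigPoly m φ) (hψ : TrigPoly n ψ) : TrigPoly (m + n) fun z => φ z * ψ z := by
  obtain ⟨p, hp, hp'⟩ := hφ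
  obtain ⟨q, hq, hq'⟩ := hψ
  refine ⟨p * q, Polynomial.natDegree_mul_le_of_le hp hq, fun z => ?_⟩
  have h : -(((m + n : ℕ) : ℂ) * z) = -(m * z) + -(n * z) := by push_cast; ring
  simp only [hp', hq', Polynomial.eval_mul, h, Complex.exp_add]
  ring

theorem const_mul (c : ℂ) (hφ : TrigPoly n φ) : TrigPoly n fun z => c * φ z := by
  simpa using (const c).mul hφ

theorem mul_const (c : ℂ) (hφ : TrigPoly n φ) : TrigPoly n fun z => φ z * c := by
  simpa using hφ.mul (const c)

theorem add (hφ : TrigPoly n φ) (hψ : TrigPoly n ψ) : TrigPoly n fun z => φ z + ψ z := by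
  obtain ⟨p, hp, hp'⟩ := hφ
  obtain ⟨q, hq, hq'⟩ := hψ
  exact ⟨p + q, Polynomial.natDegree_add_le_of_degree_le hp hq, fun z => by
    simp only [hp', hq', Polynomial.eval_add]; ring⟩

theorem sub (hφ : TrigPoly n φ) (hψ : TrigPoly n ψ) : TrigPoly n fun z => φ z - ψ z := by
  simpa [sub_eq_add_neg] using hφ.add (hψ.const_mul (-1))

theorem sum {ι : Type*} (S : Finset ι) {φ : ι → ℂ → ℂ} (h : ∀ i ∈ S, TrigPoly n (φ i)) :
    TrigPoly n fun z => ∑ i ∈ S, φ i z := by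
  classical
  induction S using Finset.induction_on with
  | empty => simpa using zero n
  | insert i S hi ih =>
    simp only [Finset.sum_insert hi]
    exact (h i (Finset.mem_insert_self _ _)).add
      (ih fun j hj => h j (Finset.mem_insert_of_mem hj))

theorem prod {ι : Type*} (S : Finset ι) {φ : ι → ℂ → ℂ} (h : ∀ i, TrigPoly 1 (φ i)) :
    TrigPoly S.card fun z => ∏ i ∈ S, φ i z := by
  classical
  induction S using Finset.induction_on with
  | empty => simpa using const 1
  | insert i S hi ih =>
    simp only [Finset.prod_insert hi, Finset.card_insert_of_notMem hi, add_comm S.card]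
    exact (h i).mul ih

theorem exp_two_mul_ne {u v : ℂ} (h : Complex.sinh (u - v) ≠ 0) :
    Complex.exp (2 * u) ≠ Complex.exp (2 * v) := by
  intro he
  apply h
  have h2 (x : ℂ) : Complex.exp (2 * x) = Complex.exp x ^ 2 := by
    rw [← Complex.exp_nat_mul]; norm_cast
  rw [h2, h2] at he
  rw [sinh_eq_exp, Complex.exp_sub]
  have hu := Complex.exp_ne_zero u
  have hv := Complex.exp_ne_zero v
  rw [div_eq_zero_iff, sub_eq_zero]
  left
  field_simp
  exact he

/-- Points separated modulo iπ have distinct e^{2z}, so the underlying polynomial has more roots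
than its degree. -/
theorem eq_zero (hφ : TrigPoly n φ) {S : Finset ℂ} (hS : n < S.card)
    (hsep : ∀ u ∈ S, ∀ v ∈ S, u ≠ v → Complex.sinh (u - v) ≠ 0) (h0 : ∀ u ∈ S, φ u = 0)
    (z : ℂ) : φ z = 0 := by
  obtain ⟨p, hp, hp'⟩ := hφ
  have hinj : Set.InjOn (fun u => Complex.exp (2 * u)) S := fun u hu v hv he => by
    by_contra hne
    exact exp_two_mul_ne (hsep u hu v hv hne) he
  have : p = 0 := by
    refine Polynomial.eq_zero_of_natDegree_lt_card_of_eval_eq_zero' p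
      (S.image fun u => Complex.exp (2 * u)) ?_ ?_
    · simp only [Finset.forall_mem_image]
      intro u hu
      have := h0 u hu
      rw [hp'] at this
      exact (mul_eq_zero.mp this).resolve_left (Complex.exp_ne_zero _)
    · rw [Finset.card_image_of_injOn hinj]
      omega
  rw [hp', this, Polynomial.eval_zero, mul_zero]

theorem congr_degree (hφ : TrigPoly m φ) (h : m = n) : TrigPoly n φ := h ▸ hφ

end TrigPoly

/-- The trigonometric polynomial in `z` obtained from `zF η (insert z X) Y` by clearing
denominators. -/
def zPolyLeft (η : ℂ) (X Y : Finset ℂ) (z : ℂ) : ℂ :=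
  ∑ y ∈ Y, Complex.sinh η * (∏ l ∈ Y.erase y, fFun η l y * Complex.sinh (z - l + η)) *
    zF η X (Y.erase y)

/-- The trigonometric polynomial in `z` obtained from `zF η X (insert z Y)` by clearing
denominators. -/
def zPolyRight (η : ℂ) (X Y : Finset ℂ) (z : ℂ) : ℂ :=
  ∑ x ∈ X, -Complex.sinh η * (∏ l ∈ X.erase x, fFun η x l * Complex.sinh (z - l - η)) *
    zF η (X.erase x) Y

theorem trigPoly_zPolyLeft (X Y : Finset ℂ) {m n : ℕ} {φ : ℂ → ℂ} (hφ : TrigPoly m φ)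
    (h : m + Y.card = n + 1) : TrigPoly n fun z => φ z * zPolyLeft η X Y z := by
  simp only [zPolyLeft, Finset.mul_sum, Finset.prod_mul_distrib]
  refine TrigPoly.sum _ fun y hy => ?_
  have hc := Finset.card_erase_add_one hy
  refine (hφ.mul (((TrigPoly.prod (Y.erase y) fun l =>
    TrigPoly.sinh_sub_add l η).const_mul _).const_mul _ |>.mul_const _)).congr_degree ?_
  omega

theorem trigPoly_zPolyRight (X Y : Finset ℂ) {m n : ℕ} {φ : ℂ → ℂ} (hφ : TrigPoly m φ)
    (h : m + X.card = n + 1) : TrigPoly n fun z => φ z * zPolyRight η X Y z := by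
  simp only [zPolyRight, Finset.mul_sum, Finset.prod_mul_distrib]
  refine TrigPoly.sum _ fun y hy => ?_
  have hc := Finset.card_erase_add_one hy
  refine (hφ.mul (((TrigPoly.prod (X.erase y) fun l =>
    TrigPoly.sinh_sub_sub l η).const_mul _).const_mul _ |>.mul_const _)).congr_degree ?_
  omega

theorem fFun_mul_sinh {u v : ℂ} (h : Complex.sinh (u - v) ≠ 0) :
    fFun η u v * Complex.sinh (u - v) = Complex.sinh (u - v + η) := div_mul_cancel₀ _ h

theorem fFun_mul_sinh' {u v : ℂ} (h : Complex.sinh (u - v) ≠ 0) :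
    fFun η u v * Complex.sinh (v - u) = Complex.sinh (v - u - η) := by
  have h' : v - u - η = -(u - v + η) := by ring
  rw [sinh_sub_swap v u, mul_neg, fFun_mul_sinh h, h', Complex.sinh_neg]

theorem fFun_mul_sinh_eta {u v : ℂ} :
    fFun η u v * Complex.sinh η = gFun η u v * Complex.sinh (u - v + η) := by
  rw [fFun, gFun]; ring

theorem zPolyLeft_eq {X Y : Finset ℂ} {z : ℂ} (hz : z ∉ X) (h : SepPair (insert z X) Y) :
    zPolyLeft η X Y z = zF η (insert z X) Y * ∏ y ∈ Y, Complex.sinh (z - y) := by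
  rw [zF_insert_left hz h, zPolyLeft, Finset.sum_mul]
  refine Finset.sum_congr rfl fun y hy => ?_
  have hc := h.cross z (Finset.mem_insert_self _ _)
  have hp : ∏ l ∈ Y.erase y, fFun η l y * Complex.sinh (z - l + η) =
      (∏ l ∈ Y.erase y, fFun η l y * fFun η z l) * ∏ l ∈ Y.erase y, Complex.sinh (z - l) := by
    rw [← Finset.prod_mul_distrib]
    refine Finset.prod_congr rfl fun l hl => ?_
    rw [mul_assoc, fFun_mul_sinh (hc l (Finset.mem_of_mem_erase hl))]
  have hg : Complex.sinh η = gFun η z y * Complex.sinh (z - y) :=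
    (div_mul_cancel₀ _ (hc y hy)).symm
  rw [hp, ← Finset.mul_prod_erase _ _ hy]
  linear_combination ((∏ l ∈ Y.erase y, fFun η l y * fFun η z l) *
    (∏ l ∈ Y.erase y, Complex.sinh (z - l)) * zF η X (Y.erase y)) * hg

theorem zPolyRight_eq {X Y : Finset ℂ} {z : ℂ} (hz : z ∉ Y) (h : SepPair X (insert z Y)) :
    zPolyRight η X Y z = zF η X (insert z Y) * ∏ x ∈ X, Complex.sinh (z - x) := by
  rw [zF_insert_right hz h, zPolyRight, Finset.sum_mul]
  refine Finset.sum_congr rfl fun x hx => ?_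
  have hc := fun x hx => h.cross x hx z (Finset.mem_insert_self _ _)
  have hp : ∏ l ∈ X.erase x, fFun η x l * Complex.sinh (z - l - η) =
      (∏ l ∈ X.erase x, fFun η x l * fFun η l z) * ∏ l ∈ X.erase x, Complex.sinh (z - l) := by
    rw [← Finset.prod_mul_distrib]
    refine Finset.prod_congr rfl fun l hl => ?_
    rw [mul_assoc, fFun_mul_sinh' (hc l (Finset.mem_of_mem_erase hl))]
  have hg : -Complex.sinh η = gFun η x z * Complex.sinh (z - x) := by
    rw [sinh_sub_swap, mul_neg, gFun, div_mul_cancel₀ _ (hc x hx)]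
  rw [hp, ← Finset.mul_prod_erase _ _ hx]
  linear_combination ((∏ l ∈ X.erase x, fFun η x l * fFun η l z) *
    (∏ l ∈ X.erase x, Complex.sinh (z - l)) * zF η (X.erase x) Y) * hg

/-- This is the residue of the partition function at z = y. All terms of the recursion contribute,
those with k ≠ y through f(y, k) sinh η = g(y, k) sinh(y - k + η); after a common factor is removed
they form the left side of `zF_transfer`. -/
theorem zPolyLeft_node {X Y : Finset ℂ} {y : ℂ} (hy : y ∈ Y) (h : SepPair X Y) :
    zPolyLeft η X Y y = Complex.sinh η * (∏ l ∈ Y.erase y, Complex.sinh (y - l + η)) *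
      ((∏ x ∈ X, fFun η x y) * zF η X (Y.erase y)) := by
  have ht := zF_transfer (η := η) (X := X) (Finset.notMem_erase y Y)
    (by rwa [Finset.insert_erase hy])
  rw [← ht, zPolyLeft, ← Finset.add_sum_erase _ _ hy, mul_add, Finset.prod_mul_distrib,
    Finset.mul_sum]
  refine congrArg₂ _ (by ring) (Finset.sum_congr rfl fun k hk => ?_)
  have hk' : y ∈ Y.erase k :=
    Finset.mem_erase.mpr ⟨(Finset.ne_of_mem_erase hk).symm, hy⟩
  have hE : (Y.erase y).erase k = (Y.erase k).erase y := Finset.erase_right_comm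
  rw [← Finset.mul_prod_erase _ _ hk', ← Finset.mul_prod_erase _ _ hk, Finset.prod_mul_distrib,
    hE, Finset.insert_erase hk', sub_self, zero_add]
  linear_combination (Complex.sinh η * (∏ l ∈ (Y.erase k).erase y, fFun η l k) *
    (∏ l ∈ (Y.erase k).erase y, Complex.sinh (y - l + η)) * zF η X (Y.erase k)) *
    fFun_mul_sinh_eta (η := η) (u := y) (v := k)

theorem zPolyRight_node {X Y : Finset ℂ} {x : ℂ} (hx : x ∈ X) (h : SepPair X Y) :
    zPolyRight η X Y x = -Complex.sinh η * (∏ l ∈ X.erase x, Complex.sinh (x - l - η)) *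
      ((∏ y ∈ Y, fFun η x y) * zF η (X.erase x) Y) := by
  have ht := zF_transfer' (η := η) (Y := Y) (Finset.notMem_erase x X)
    (by rwa [Finset.insert_erase hx])
  rw [← ht, zPolyRight, ← Finset.add_sum_erase _ _ hx, mul_add, Finset.prod_mul_distrib,
    Finset.mul_sum]
  refine congrArg₂ _ (by ring) (Finset.sum_congr rfl fun k hk => ?_)
  have hk' : x ∈ X.erase k :=
    Finset.mem_erase.mpr ⟨(Finset.ne_of_mem_erase hk).symm, hx⟩
  have hE : (X.erase x).erase k = (X.erase k).erase x := Finset.erase_right_comm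
  have hs : Complex.sinh (x - k - η) = -Complex.sinh (k - x + η) := by
    rw [← Complex.sinh_neg]; congr 1; ring
  rw [← Finset.mul_prod_erase _ _ hk', ← Finset.mul_prod_erase _ _ hk, Finset.prod_mul_distrib,
    hE, Finset.insert_erase hk', sub_self, zero_sub, Complex.sinh_neg, hs]
  linear_combination (Complex.sinh η * (∏ l ∈ (X.erase k).erase x, fFun η k l) *
    (∏ l ∈ (X.erase k).erase x, Complex.sinh (x - l - η)) * zF η (X.erase k) Y) *
    fFun_mul_sinh_eta (η := η) (u := k) (v := x)

/-! ### Sums over bipartitions of products of two partition functions -/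

/-- The sum over partitions of `Λ` of products of two domain wall partition functions. -/
def pairSum (η : ℂ) (Λ Ya Yd : Finset ℂ) : ℂ :=
  ∑ I ∈ Λ.powerset, (∏ i ∈ I, ∏ j ∈ Λ \ I, fFun η i j) * (zF η (Λ \ I) Ya * zF η Yd I)

/-- The trigonometric polynomial in `z` obtained from `pairSum η (insert z Λ) Ya Yd` by clearing
denominators. -/
def pairPoly (η : ℂ) (Λ Ya Yd : Finset ℂ) (z : ℂ) : ℂ :=
  ∑ I ∈ Λ.powerset, (∏ i ∈ I, ∏ j ∈ Λ \ I, fFun η i j) *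
    ((∏ i ∈ I, Complex.sinh (z - i - η)) * (∏ j ∈ Λ \ I, Complex.sinh (z - j)) *
        (∏ y ∈ Yd, Complex.sinh (z - y)) * zPolyLeft η (Λ \ I) Ya z * zF η Yd I +
      (∏ j ∈ Λ \ I, Complex.sinh (z - j + η)) * (∏ i ∈ I, Complex.sinh (z - i)) *
        (∏ y ∈ Ya, Complex.sinh (z - y)) * zPolyRight η Yd I z * zF η (Λ \ I) Ya)

theorem trigPoly_pairPoly (Λ Ya Yd : Finset ℂ) {n : ℕ}
    (h : n + 1 = Λ.card + Ya.card + Yd.card) : TrigPoly n (pairPoly η Λ Ya Yd) := by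
  have hS (S : Finset ℂ) := TrigPoly.prod S TrigPoly.sinh_sub
  refine TrigPoly.sum _ fun I hI => ?_
  have hc := Finset.card_sdiff_add_card_eq_card (Finset.mem_powerset.mp hI)
  refine TrigPoly.const_mul _ (TrigPoly.add ?_ ?_)
  · refine (trigPoly_zPolyLeft _ _ (((TrigPoly.prod I fun i => TrigPoly.sinh_sub_sub i η).mul
      (hS (Λ \ I))).mul (hS Yd)) ?_).mul_const _
    omega
  · refine (trigPoly_zPolyRight _ _ (((TrigPoly.prod (Λ \ I) fun i =>
      TrigPoly.sinh_sub_add i η).mul (hS I)).mul (hS Ya)) ?_).mul_const _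
    omega

theorem prod_fFun_insert_right {I B : Finset ℂ} {z : ℂ} (hz : z ∉ B)
    (h : ∀ i ∈ I, Complex.sinh (i - z) ≠ 0) :
    (∏ i ∈ I, ∏ j ∈ insert z B, fFun η i j) * ∏ i ∈ I, Complex.sinh (z - i) =
      (∏ i ∈ I, ∏ j ∈ B, fFun η i j) * ∏ i ∈ I, Complex.sinh (z - i - η) := by
  rw [← Finset.prod_mul_distrib, ← Finset.prod_mul_distrib]
  refine Finset.prod_congr rfl fun i hi => ?_
  rw [Finset.prod_insert hz, ← fFun_mul_sinh' (h i hi)]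
  ring

theorem prod_fFun_insert_left {I B : Finset ℂ} {z : ℂ} (hz : z ∉ I)
    (h : ∀ j ∈ B, Complex.sinh (z - j) ≠ 0) :
    (∏ i ∈ insert z I, ∏ j ∈ B, fFun η i j) * ∏ j ∈ B, Complex.sinh (z - j) =
      (∏ i ∈ I, ∏ j ∈ B, fFun η i j) * ∏ j ∈ B, Complex.sinh (z - j + η) := by
  rw [Finset.prod_insert hz, mul_comm (∏ j ∈ B, fFun η z j), mul_assoc,
    ← Finset.prod_mul_distrib]
  congr 1
  exact Finset.prod_congr rfl fun j hj => fFun_mul_sinh (h j hj)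

/-- For each I ⊆ Λ, the two summands of `pairPoly` are the cases where z joins the complement of I
or I itself. -/
theorem pairPoly_eq {Λ Ya Yd : Finset ℂ} {z : ℂ} (hz : z ∉ Λ)
    (h : SepPair (insert z Λ) (Ya ∪ Yd)) :
    pairPoly η Λ Ya Yd z = pairSum η (insert z Λ) Ya Yd * ((∏ j ∈ Λ, Complex.sinh (z - j)) *
      ((∏ y ∈ Ya, Complex.sinh (z - y)) * ∏ y ∈ Yd, Complex.sinh (z - y))) := by
  have hzΛ (j) (hj : j ∈ Λ) : Complex.sinh (z - j) ≠ 0 :=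
    h.left z (Finset.mem_insert_self _ _) j (Finset.mem_insert_of_mem hj) fun he => hz (he ▸ hj)
  rw [pairSum, Finset.sum_powerset_insert hz, add_mul, Finset.sum_mul, Finset.sum_mul,
    ← Finset.sum_add_distrib]
  refine Finset.sum_congr rfl fun I hI => ?_
  have hI' := Finset.mem_powerset.mp hI
  have hzI : z ∉ I := fun h => hz (hI' h)
  have hzB : z ∉ Λ \ I := fun h => hz (Finset.sdiff_subset h)
  have h1 : insert z Λ \ I = insert z (Λ \ I) := Finset.insert_sdiff_of_notMem _ hzI
  have h2 : insert z Λ \ insert z I = Λ \ I := by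
    rw [Finset.insert_sdiff_insert, Finset.sdiff_insert, Finset.erase_eq_of_notMem hzB]
  have hl := zPolyLeft_eq (η := η) hzB (h.mono (Finset.insert_subset_insert _ Finset.sdiff_subset)
    Finset.subset_union_left)
  have hr := zPolyRight_eq (η := η) hzI (h.symm.mono Finset.subset_union_right
    (Finset.insert_subset_insert _ hI'))
  have e1 := prod_fFun_insert_right (η := η) (I := I) hzB
    fun i hi => sinh_sub_ne_zero_symm (hzΛ i (hI' hi))
  have e2 := prod_fFun_insert_left (η := η) (B := Λ \ I) hzI
    fun j hj => hzΛ j (Finset.sdiff_subset hj)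
  rw [h1, h2, hl, hr, ← Finset.prod_sdiff hI']
  linear_combination (-((∏ j ∈ Λ \ I, Complex.sinh (z - j)) * (∏ y ∈ Yd, Complex.sinh (z - y)) *
      (zF η (insert z (Λ \ I)) Ya * ∏ y ∈ Ya, Complex.sinh (z - y)) * zF η Yd I)) * e1 -
    ((∏ i ∈ I, Complex.sinh (z - i)) * (∏ y ∈ Ya, Complex.sinh (z - y)) *
      (zF η Yd (insert z I) * ∏ y ∈ Yd, Complex.sinh (z - y)) * zF η (Λ \ I) Ya) * e2

/-- The poles of f at coinciding points of Λ are only apparent: the contributions of I and `insert z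
I` cancel. -/
theorem pairPoly_left_node {Λ Ya Yd : Finset ℂ} {z : ℂ} (hz : z ∈ Λ)
    (h : SepPair Λ (Ya ∪ Yd)) : pairPoly η Λ Ya Yd z = 0 := by
  rw [← Finset.insert_erase hz] at h ⊢
  replace hz := Finset.notMem_erase z Λ
  generalize Λ.erase z = Λ at *
  have hzΛ (j) (hj : j ∈ Λ) : Complex.sinh (z - j) ≠ 0 :=
    h.left z (Finset.mem_insert_self _ _) j (Finset.mem_insert_of_mem hj) fun he => hz (he ▸ hj)
  rw [pairPoly, Finset.sum_powerset_insert hz, ← Finset.sum_add_distrib]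
  refine Finset.sum_eq_zero fun I hI => ?_
  have hI' := Finset.mem_powerset.mp hI
  have hzI : z ∉ I := fun h => hz (hI' h)
  have hzB : z ∉ Λ \ I := fun h => hz (Finset.sdiff_subset h)
  have h1 : insert z Λ \ I = insert z (Λ \ I) := Finset.insert_sdiff_of_notMem _ hzI
  have h2 : insert z Λ \ insert z I = Λ \ I := by
    rw [Finset.insert_sdiff_insert, Finset.sdiff_insert, Finset.erase_eq_of_notMem hzB]
  have hl := zPolyLeft_eq (η := η) hzB (h.mono (Finset.insert_subset_insert _ Finset.sdiff_subset)
    Finset.subset_union_left)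
  have hr := zPolyRight_eq (η := η) hzI (h.symm.mono Finset.subset_union_right
    (Finset.insert_subset_insert _ hI'))
  have e1 := prod_fFun_insert_right (η := η) (I := I) hzB
    fun i hi => sinh_sub_ne_zero_symm (hzΛ i (hI' hi))
  have e2 := prod_fFun_insert_left (η := η) (B := Λ \ I) hzI
    fun j hj => hzΛ j (Finset.sdiff_subset hj)
  rw [h1, h2, hl, hr]
  simp only [Finset.prod_insert hzB (f := fun j => Complex.sinh (z - j)),
    Finset.prod_insert hzB (f := fun j => Complex.sinh (z - j + η)),
    Finset.prod_insert hzI (f := fun j => Complex.sinh (z - j)),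
    Finset.prod_insert hzI (f := fun j => Complex.sinh (z - j - η)),
    sub_self, Complex.sinh_zero, zero_mul, zero_sub, zero_add, add_zero, mul_zero,
    Complex.sinh_neg]
  linear_combination (Complex.sinh η * (∏ j ∈ Λ \ I, Complex.sinh (z - j + η)) *
      (∏ y ∈ Ya, Complex.sinh (z - y)) * (zF η Yd (insert z I) * ∏ y ∈ Yd, Complex.sinh (z - y)) *
      zF η (insert z (Λ \ I)) Ya) * e1 -
    (Complex.sinh η * (∏ i ∈ I, Complex.sinh (z - i - η)) * (∏ y ∈ Yd, Complex.sinh (z - y)) *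
      (zF η (insert z (Λ \ I)) Ya * ∏ y ∈ Ya, Complex.sinh (z - y)) * zF η Yd (insert z I)) * e2

/-- The factor ∏ sinh(z - y) over Ya kills the terms with z in I. In the others `zPolyLeft_node`
removes z from Ya, and its f-factors complete a product over all of Λ that no longer depends on I.
-/
theorem pairPoly_right_node {Λ Ya Yd : Finset ℂ} {z : ℂ} (hz : z ∈ Ya)
    (h : SepPair Λ (Ya ∪ Yd)) :
    pairPoly η Λ Ya Yd z = Complex.sinh η * (∏ x ∈ Λ, Complex.sinh (z - x - η)) *
      ((∏ l ∈ Ya.erase z, Complex.sinh (z - l + η)) * ∏ l ∈ Yd, Complex.sinh (z - l)) *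
      pairSum η Λ (Ya.erase z) Yd := by
  rw [pairPoly, pairSum, Finset.mul_sum]
  refine Finset.sum_congr rfl fun I hI => ?_
  have hI' := Finset.mem_powerset.mp hI
  have h0 : ∏ y ∈ Ya, Complex.sinh (z - y) = 0 := Finset.prod_eq_zero hz (by simp)
  have hp : (∏ x ∈ Λ \ I, fFun η x z) * ∏ j ∈ Λ \ I, Complex.sinh (z - j) =
      ∏ j ∈ Λ \ I, Complex.sinh (z - j - η) := by
    rw [← Finset.prod_mul_distrib]
    exact Finset.prod_congr rfl fun j hj => fFun_mul_sinh'
      (h.cross j (Finset.sdiff_subset hj) z (Finset.mem_union_left _ hz))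
  rw [zPolyLeft_node hz (h.mono Finset.sdiff_subset Finset.subset_union_left), h0,
    ← Finset.prod_sdiff hI', ← hp]
  ring

theorem pairPoly_right_node' {Λ Ya Yd : Finset ℂ} {z : ℂ} (hz : z ∈ Yd)
    (h : SepPair Λ (Ya ∪ Yd)) :
    pairPoly η Λ Ya Yd z = -Complex.sinh η * (∏ x ∈ Λ, Complex.sinh (z - x + η)) *
      ((∏ l ∈ Yd.erase z, Complex.sinh (z - l - η)) * ∏ l ∈ Ya, Complex.sinh (z - l)) *
      pairSum η Λ Ya (Yd.erase z) := by
  rw [pairPoly, pairSum, Finset.mul_sum]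
  refine Finset.sum_congr rfl fun I hI => ?_
  have hI' := Finset.mem_powerset.mp hI
  have h0 : ∏ y ∈ Yd, Complex.sinh (z - y) = 0 := Finset.prod_eq_zero hz (by simp)
  have hp : (∏ x ∈ I, fFun η z x) * ∏ j ∈ I, Complex.sinh (z - j) =
      ∏ j ∈ I, Complex.sinh (z - j + η) := by
    rw [← Finset.prod_mul_distrib]
    exact Finset.prod_congr rfl fun j hj => fFun_mul_sinh (sinh_sub_ne_zero_symm
      (h.cross j (hI' hj) z (Finset.mem_union_right _ hz)))
  rw [zPolyRight_node hz (h.symm.mono Finset.subset_union_right hI'), h0,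
    ← Finset.prod_sdiff hI' (f := fun x => Complex.sinh (z - x + η)), ← hp]
  ring

/-! ### The determinant side and the interpolation argument -/

/-- `∏_{k < j} sinh(xₖ - xⱼ)`. -/
def sinhVandermonde {N : ℕ} (x : Fin N → ℂ) : ℂ :=
  ∏ j, ∏ k ∈ Finset.Iio j, Complex.sinh (x k - x j)

theorem prod_succAbove_lt_sign {N : ℕ} (k : Fin (N + 1)) :
    ∏ l : Fin N, (if k.succAbove l < k then (-1 : ℂ) else 1) = (-1) ^ (k : ℕ) := by
  rw [Finset.prod_ite, Finset.prod_const, Finset.prod_const_one, mul_one]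
  congr 1
  have h : ∀ l : Fin N, k.succAbove l < k ↔ (l : ℕ) < k := fun l => by
    rw [Fin.succAbove_lt_iff_castSucc_lt]; rfl
  simp only [h]
  rw [Fin.card_filter_val_lt, min_eq_right (Nat.lt_succ_iff.mp k.isLt)]

theorem sinhVandermonde_succAbove {N : ℕ} (x : Fin (N + 1) → ℂ) (k : Fin (N + 1)) :
    sinhVandermonde x = (-1) ^ (k : ℕ) * (∏ l, Complex.sinh (x k - x (k.succAbove l))) *
      sinhVandermonde (x ∘ k.succAbove) := by
  have hI {n : ℕ} (j : Fin n) (F : Fin n → ℂ) :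
      ∏ i ∈ Finset.Iio j, F i = ∏ i, if i < j then F i else 1 := by
    rw [← Finset.prod_filter]; congr 1; ext; simp
  simp only [sinhVandermonde, hI]
  have hk (j : Fin (N + 1)) := Fin.prod_univ_succAbove
    (fun i => if i < j then Complex.sinh (x i - x j) else 1) k
  rw [Fin.prod_univ_succAbove _ k]
  simp only [hk, lt_irrefl, if_false, one_mul, Finset.prod_mul_distrib]
  simp only [Fin.succAbove_lt_succAbove_iff]
  rw [← mul_assoc, ← prod_succAbove_lt_sign]
  refine congrArg₂ (· * ·) ?_ rfl
  rw [← Finset.prod_mul_distrib, ← Finset.prod_mul_distrib]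
  refine Finset.prod_congr rfl fun l _ => ?_
  rcases lt_or_gt_of_ne (Fin.succAbove_ne k l) with h | h
  · rw [if_pos h, if_neg h.le.not_gt, if_pos h, sinh_sub_swap]; ring
  · rw [if_neg h.le.not_gt, if_pos h, if_neg h.le.not_gt]

/-- `±sinh η`, with sign `+` for `m ∈ J`. -/
def colConst (η : ℂ) (J : Finset ℂ) (m : ℂ) : ℂ :=
  if m ∈ J then Complex.sinh η else -Complex.sinh η

/-- `sinh(x - m ± η)`, with sign `+` for `m ∈ J`. -/
def colShift (η : ℂ) (J : Finset ℂ) (m x : ℂ) : ℂ :=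
  if m ∈ J then Complex.sinh (x - m + η) else Complex.sinh (x - m - η)

/-- The matrix with columns of one of the two types occurring in `Ω_κ`. -/
def colMatrix (η : ℂ) (J : Finset ℂ) {N : ℕ} (lam mu : Fin N → ℂ) : Matrix (Fin N) (Fin N) ℂ :=
  Matrix.of fun j k => colConst η J (mu k) / Complex.sinh (lam j - mu k) *
    ∏ i, if i = j then 1 else colShift η J (mu k) (lam i)

/-- The expansion along the first row of `colMatrix` as a trigonometric polynomial in the first
row variable. -/
def detPoly (η : ℂ) (J : Finset ℂ) {N : ℕ} (lam : Fin N → ℂ) (mu : Fin (N + 1) → ℂ) (z : ℂ) : ℂ :=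
  ∑ k : Fin (N + 1), (-1) ^ (k : ℕ) *
    (colConst η J (mu k) * ∏ i, colShift η J (mu k) (lam i)) *
    (∏ l, Complex.sinh (z - mu (k.succAbove l))) *
    (∏ l, colShift η J (mu (k.succAbove l)) z) * (colMatrix η J lam (mu ∘ k.succAbove)).det

theorem trigPoly_colShift (J : Finset ℂ) (m : ℂ) : TrigPoly 1 (colShift η J m) := by
  unfold colShift
  split_ifs
  · exact TrigPoly.sinh_sub_add m η
  · exact TrigPoly.sinh_sub_sub m η

theorem trigPoly_detPoly (J : Finset ℂ) {N : ℕ} (lam : Fin N → ℂ) (mu : Fin (N + 1) → ℂ) :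
    TrigPoly (N + N) (detPoly η J lam mu) := by
  refine TrigPoly.sum _ fun k _ => ?_
  have h1 := TrigPoly.prod Finset.univ fun l : Fin N => TrigPoly.sinh_sub (mu (k.succAbove l))
  have h2 := TrigPoly.prod Finset.univ fun l : Fin N =>
    trigPoly_colShift (η := η) J (mu (k.succAbove l))
  rw [Finset.card_univ, Fintype.card_fin] at h1 h2
  exact ((h1.const_mul _).mul h2).mul_const _

/-- In each minor of the first row, `lam 0` enters only through a common factor of each column, so
it can be pulled out of the determinant. -/
theorem detPoly_eq (J : Finset ℂ) {N : ℕ} (lam : Fin (N + 1) → ℂ) (mu : Fin (N + 1) → ℂ)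
    (h : ∀ k, Complex.sinh (lam 0 - mu k) ≠ 0) :
    detPoly η J (lam ∘ Fin.succ) mu (lam 0) =
      (colMatrix η J lam mu).det * ∏ k, Complex.sinh (lam 0 - mu k) := by
  rw [Matrix.det_succ_row_zero, Finset.sum_mul, detPoly]
  refine Finset.sum_congr rfl fun k _ => ?_
  have hminor : (colMatrix η J lam mu).submatrix Fin.succ k.succAbove =
      Matrix.of fun i j => colShift η J (mu (k.succAbove j)) (lam 0) *
        colMatrix η J (lam ∘ Fin.succ) (mu ∘ k.succAbove) i j := by
    ext i j
    simp only [colMatrix, Matrix.submatrix_apply, Matrix.of_apply, Fin.prod_univ_succ,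
      (Fin.succ_ne_zero _).symm, if_false, Fin.succ_inj, Function.comp_apply]
    ring
  rw [hminor, Matrix.det_mul_row, Fin.prod_univ_succAbove _ k]
  simp only [colMatrix, Matrix.of_apply, Fin.prod_univ_succ (n := N), if_true, one_mul,
    Fin.succ_ne_zero, if_false, Function.comp_apply]
  have := h k
  field_simp

theorem detPoly_left_node (J : Finset ℂ) {N : ℕ} (lam : Fin N → ℂ) (mu : Fin (N + 1) → ℂ)
    (j : Fin N) (h : ∀ k, Complex.sinh (lam j - mu k) ≠ 0) :
    detPoly η J lam mu (lam j) = 0 := by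
  -- Repeating `lam j` as the first row variable produces a matrix with two equal rows.
  have := detPoly_eq (η := η) J (Fin.cons (lam j) lam : Fin (N + 1) → ℂ) mu (by simpa using h)
  have hs : (Fin.cons (lam j) lam : Fin (N + 1) → ℂ) ∘ Fin.succ = lam := by ext; simp
  rw [hs, Fin.cons_zero, Matrix.det_zero_of_row_eq (Fin.succ_ne_zero j).symm, zero_mul] at this
  · exact this
  · ext k
    simp only [colMatrix, Matrix.of_apply, Fin.prod_univ_succ (n := N), if_true, one_mul,
      Fin.succ_ne_zero, if_false, (Fin.succ_ne_zero _).symm, Fin.cons_zero, Fin.cons_succ,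
      Fin.succ_inj]
    congr 1
    rw [← Finset.mul_prod_erase _ _ (Finset.mem_univ j),
      ← Finset.mul_prod_erase _ (fun i => if i = j then 1 else _) (Finset.mem_univ j), if_pos rfl,
      one_mul]
    congr 1
    exact Finset.prod_congr rfl fun i hi => (if_neg (Finset.ne_of_mem_erase hi)).symm

theorem detPoly_right_node (J : Finset ℂ) {N : ℕ} (lam : Fin N → ℂ) (mu : Fin (N + 1) → ℂ)
    (k : Fin (N + 1)) :
    detPoly η J lam mu (mu k) = (-1) ^ (k : ℕ) *
      (colConst η J (mu k) * ∏ i, colShift η J (mu k) (lam i)) *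
      (∏ l, Complex.sinh (mu k - mu (k.succAbove l))) *
      (∏ l, colShift η J (mu (k.succAbove l)) (mu k)) *
      (colMatrix η J lam (mu ∘ k.succAbove)).det := by
  refine Finset.sum_eq_single k (fun m _ hm => ?_) (by simp)
  obtain ⟨l, hl⟩ := Fin.exists_succAbove_eq hm.symm
  have : ∏ l, Complex.sinh (mu k - mu (m.succAbove l)) = 0 :=
    Finset.prod_eq_zero (Finset.mem_univ l) (by rw [hl, sub_self, Complex.sinh_zero])
  rw [this]
  ring

theorem image_comp_succAbove {N : ℕ} {mu : Fin (N + 1) → ℂ} (hmu : Function.Injective mu)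
    (k : Fin (N + 1)) :
    Finset.univ.image (mu ∘ k.succAbove) = (Finset.univ.image mu).erase (mu k) := by
  rw [← Finset.image_image, ← Finset.image_erase hmu]
  congr 1
  ext i
  simp

theorem prod_comp_succAbove {N : ℕ} {mu : Fin (N + 1) → ℂ} (hmu : Function.Injective mu)
    (k : Fin (N + 1)) (F : ℂ → ℂ) :
    ∏ l, F (mu (k.succAbove l)) = ∏ y ∈ (Finset.univ.image mu).erase (mu k), F y := by
  rw [← image_comp_succAbove hmu,
    Finset.prod_image fun _ _ _ _ h => (hmu.comp Fin.succAbove_right_injective) h]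
  rfl

theorem injective_of_sinh_ne {N : ℕ} {x : Fin N → ℂ}
    (h : ∀ j k, j ≠ k → Complex.sinh (x j - x k) ≠ 0) : Function.Injective x := fun j k he => by
  by_contra hne
  exact h j k hne (by rw [he, sub_self, Complex.sinh_zero])

theorem sepPair_image {N N' : ℕ} {lam : Fin N → ℂ} {mu : Fin N' → ℂ}
    (hlam : ∀ j k, j ≠ k → Complex.sinh (lam j - lam k) ≠ 0)
    (hmu : ∀ j k, j ≠ k → Complex.sinh (mu j - mu k) ≠ 0)
    (hlm : ∀ j k, Complex.sinh (lam j - mu k) ≠ 0) :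
    SepPair (Finset.univ.image lam) (Finset.univ.image mu) := by
  refine ⟨?_, ?_, ?_⟩ <;> simp only [Finset.forall_mem_image] <;> intro j _ k _
  · exact fun h => hlam j k fun e => h (by rw [e])
  · exact fun h => hmu j k fun e => h (by rw [e])
  · exact hlm j k

theorem prod_colShift (J Y : Finset ℂ) (x : ℂ) :
    ∏ y ∈ Y, colShift η J y x = (∏ y ∈ Y with y ∈ J, Complex.sinh (x - y + η)) *
      ∏ y ∈ Y with y ∉ J, Complex.sinh (x - y - η) := by
  rw [← Finset.prod_filter_mul_prod_filter_not Y (· ∈ J)]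
  congr 1 <;> refine Finset.prod_congr rfl fun y hy => ?_
  · rw [colShift, if_pos (Finset.mem_filter.mp hy).2]
  · rw [colShift, if_neg (Finset.mem_filter.mp hy).2]

theorem sinh_sub_add_neg (x y : ℂ) :
    Complex.sinh (x - y + η) = -1 * Complex.sinh (y - x - η) := by
  rw [neg_one_mul, ← Complex.sinh_neg]; congr 1; ring

theorem sinh_sub_sub_neg (x y : ℂ) :
    Complex.sinh (x - y - η) = -1 * Complex.sinh (y - x + η) := by
  rw [neg_one_mul, ← Complex.sinh_neg]; congr 1; ring

/-- The inductive step of `pairSum_eq_det` at the node μ_k. The f-factors linking μ_k to the other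
class of μ's turn sinh(μ_k - μ_l) into the shifted sines of the determinant, and (-1)^N comes from
reversing the N differences λ_i - μ_k. -/
theorem pairPoly_eq_detPoly_right_node (J : Finset ℂ) {N : ℕ} (lam : Fin N → ℂ)
    (mu : Fin (N + 1) → ℂ) (k : Fin (N + 1))
    (hlam : ∀ j k, j ≠ k → Complex.sinh (lam j - lam k) ≠ 0)
    (hmu : ∀ j k, j ≠ k → Complex.sinh (mu j - mu k) ≠ 0)
    (hlm : ∀ j k, Complex.sinh (lam j - mu k) ≠ 0)
    (ih : sinhVandermonde (-lam) * sinhVandermonde (mu ∘ k.succAbove) *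
      (∏ m ∈ Finset.univ.image (mu ∘ k.succAbove) with m ∈ J,
        ∏ l ∈ Finset.univ.image (mu ∘ k.succAbove) with l ∉ J, fFun η l m) *
      pairSum η (Finset.univ.image lam) {m ∈ Finset.univ.image (mu ∘ k.succAbove) | m ∈ J}
        {l ∈ Finset.univ.image (mu ∘ k.succAbove) | l ∉ J} =
      (colMatrix η J lam (mu ∘ k.succAbove)).det) :
    sinhVandermonde (-lam) * (-1) ^ N * sinhVandermonde mu *
      (∏ k ∈ Finset.univ.image mu with k ∈ J, ∏ l ∈ Finset.univ.image mu with l ∉ J, fFun η l k) *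
      pairPoly η (Finset.univ.image lam) {k ∈ Finset.univ.image mu | k ∈ J}
        {l ∈ Finset.univ.image mu | l ∉ J} (mu k) = detPoly η J lam mu (mu k) := by
  have hmu' := injective_of_sinh_ne hmu
  have hlam' := injective_of_sinh_ne hlam
  have hsep := sepPair_image hlam hmu hlm
  have hk : mu k ∈ Finset.univ.image mu := Finset.mem_image_of_mem _ (Finset.mem_univ k)
  rw [detPoly_right_node, ← ih, image_comp_succAbove hmu', sinhVandermonde_succAbove mu k,
    prod_comp_succAbove hmu' k fun y => Complex.sinh (mu k - y),
    prod_comp_succAbove hmu' k fun y => colShift η J y (mu k), prod_colShift]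
  generalize Finset.univ.image mu = Y at *
  rw [← Finset.filter_union_filter_not_eq (· ∈ J) Y] at hsep
  have hpos (i : Fin N) : Complex.sinh (mu k - lam i - η) =
      -1 * Complex.sinh (lam i - mu k + η) := sinh_sub_sub_neg _ _
  have hneg (i : Fin N) : Complex.sinh (mu k - lam i + η) =
      -1 * Complex.sinh (lam i - mu k - η) := sinh_sub_add_neg _ _
  have hone := neg_one_pow_eq_or ℂ N
  have hY (y) (hy : y ∈ Y) (hne : y ≠ mu k) : Complex.sinh (y - mu k) ≠ 0 :=
    hsep.right _ (by rwa [Finset.filter_union_filter_not_eq]) _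
      (by rwa [Finset.filter_union_filter_not_eq]) hne
  rw [← Finset.prod_filter_mul_prod_filter_not (Y.erase (mu k)) (· ∈ J)
    fun y => Complex.sinh (mu k - y)]
  by_cases hJ : mu k ∈ J
  · have hka : mu k ∈ {m ∈ Y | m ∈ J} := Finset.mem_filter.mpr ⟨hk, hJ⟩
    have h1 : {m ∈ Y.erase (mu k) | m ∈ J} = {m ∈ Y | m ∈ J}.erase (mu k) :=
      Finset.filter_erase _ _ _
    have h2 : {m ∈ Y.erase (mu k) | m ∉ J} = {m ∈ Y | m ∉ J} := by
      rw [Finset.filter_erase]; simp [hJ]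
    have hf : (∏ l ∈ Y with l ∉ J, fFun η l (mu k)) * ∏ l ∈ Y with l ∉ J, Complex.sinh (mu k - l) =
        ∏ l ∈ Y with l ∉ J, Complex.sinh (mu k - l - η) := by
      rw [← Finset.prod_mul_distrib]
      refine Finset.prod_congr rfl fun l hl => fFun_mul_sinh' ?_
      rw [Finset.mem_filter] at hl
      exact hY l hl.1 fun e => hl.2 (by rwa [e])
    rw [pairPoly_right_node hka hsep, Finset.prod_image fun _ _ _ _ h => hlam' h, h1, h2, ← hf,
      ← Finset.mul_prod_erase _ _ hka]
    simp only [hpos, colConst, colShift, if_pos hJ, Finset.prod_mul_distrib, Finset.prod_const,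
      Finset.card_univ, Fintype.card_fin]
    rcases hone with e | e <;> rw [e] <;> ring
  · have hkd : mu k ∈ {m ∈ Y | m ∉ J} := Finset.mem_filter.mpr ⟨hk, hJ⟩
    have h1 : {m ∈ Y.erase (mu k) | m ∈ J} = {m ∈ Y | m ∈ J} := by
      rw [Finset.filter_erase]; simp [hJ]
    have h2 : {m ∈ Y.erase (mu k) | m ∉ J} = {m ∈ Y | m ∉ J}.erase (mu k) :=
      Finset.filter_erase _ _ _
    have hf : (∏ l ∈ Y with l ∈ J, fFun η (mu k) l) * ∏ l ∈ Y with l ∈ J, Complex.sinh (mu k - l) =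
        ∏ l ∈ Y with l ∈ J, Complex.sinh (mu k - l + η) := by
      rw [← Finset.prod_mul_distrib]
      refine Finset.prod_congr rfl fun l hl => fFun_mul_sinh (sinh_sub_ne_zero_symm ?_)
      rw [Finset.mem_filter] at hl
      exact hY l hl.1 fun e => hJ (e ▸ hl.2)
    have hF : ∏ m ∈ Y with m ∈ J, ∏ l ∈ Y with l ∉ J, fFun η l m =
        (∏ m ∈ Y with m ∈ J, fFun η (mu k) m) *
          ∏ m ∈ Y with m ∈ J, ∏ l ∈ ({l ∈ Y | l ∉ J}.erase (mu k)), fFun η l m := by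
      rw [← Finset.prod_mul_distrib]
      exact Finset.prod_congr rfl fun m _ => (Finset.mul_prod_erase _ _ hkd).symm
    rw [pairPoly_right_node' hkd hsep, Finset.prod_image fun _ _ _ _ h => hlam' h, h1, h2, ← hf, hF]
    simp only [hneg, colConst, colShift, if_neg hJ, Finset.prod_mul_distrib, Finset.prod_const,
      Finset.card_univ, Fintype.card_fin]
    rcases hone with e | e <;> rw [e] <;> ring

/-- For N + 1 variables, both sides times ∏ sinh(λ₀ - μ_k) are trigonometric polynomials of degree
2N in the first λ. They agree at 2N + 1 nodes: at the other N λ's, where both vanish, and at the N +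
1 μ's, by the induction hypothesis with μ_k removed. -/
theorem pairSum_eq_det (J : Finset ℂ) {N : ℕ} (lam mu : Fin N → ℂ)
    (hlam : ∀ j k, j ≠ k → Complex.sinh (lam j - lam k) ≠ 0)
    (hmu : ∀ j k, j ≠ k → Complex.sinh (mu j - mu k) ≠ 0)
    (hlm : ∀ j k, Complex.sinh (lam j - mu k) ≠ 0) :
    sinhVandermonde (-lam) * sinhVandermonde mu *
      (∏ k ∈ Finset.univ.image mu with k ∈ J, ∏ l ∈ Finset.univ.image mu with l ∉ J, fFun η l k) *
      pairSum η (Finset.univ.image lam) {k ∈ Finset.univ.image mu | k ∈ J}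
        {l ∈ Finset.univ.image mu | l ∉ J} = (colMatrix η J lam mu).det := by
  induction N with
  | zero => simp [sinhVandermonde, pairSum, zF_empty_left]
  | succ N ih =>
    have hmu' := injective_of_sinh_ne hmu
    have hlam' := injective_of_sinh_ne hlam
    have hins : Finset.univ.image lam =
        insert (lam 0) (Finset.univ.image (lam ∘ Fin.succ)) := by
      ext x
      simp [Fin.exists_fin_succ, eq_comm]
    have hsep : SepPair (insert (lam 0) (Finset.univ.image (lam ∘ Fin.succ)))
        (Finset.univ.image mu) := by
      rw [← hins]
      exact sepPair_image hlam hmu hlm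
    have hz : lam 0 ∉ Finset.univ.image (lam ∘ Fin.succ) := by
      simp only [Finset.mem_image, not_exists, not_and]
      exact fun j _ h => Fin.succ_ne_zero j (hlam' h)
    have hsucc (j k : Fin N) (h : j ≠ k) :
        Complex.sinh ((lam ∘ Fin.succ) j - (lam ∘ Fin.succ) k) ≠ 0 :=
      hlam _ _ fun e => h (Fin.succ_injective _ e)
    have hlm' (j : Fin N) (k) : Complex.sinh ((lam ∘ Fin.succ) j - mu k) ≠ 0 := hlm _ _
    have hsepΛ := hsep.mono (Finset.subset_insert _ _) subset_rfl
    have hcardΛ : (Finset.univ.image (lam ∘ Fin.succ)).card = N := by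
      rw [Finset.card_image_of_injective _ (hlam'.comp (Fin.succ_injective _)), Finset.card_univ,
        Fintype.card_fin]
    have hcardY : (Finset.univ.image mu).card = N + 1 := by
      rw [Finset.card_image_of_injective _ hmu', Finset.card_univ, Fintype.card_fin]
    have hunion := Finset.filter_union_filter_not_eq (· ∈ J) (Finset.univ.image mu)
    have key : ∀ z, sinhVandermonde (-(lam ∘ Fin.succ)) * (-1) ^ N * sinhVandermonde mu *
        (∏ k ∈ Finset.univ.image mu with k ∈ J, ∏ l ∈ Finset.univ.image mu with l ∉ J,
          fFun η l k) *
        pairPoly η (Finset.univ.image (lam ∘ Fin.succ)) {k ∈ Finset.univ.image mu | k ∈ J}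
          {l ∈ Finset.univ.image mu | l ∉ J} z - detPoly η J (lam ∘ Fin.succ) mu z = 0 := by
      refine TrigPoly.eq_zero (n := N + N) (((trigPoly_pairPoly _ _ _ ?_).const_mul _).sub
        (trigPoly_detPoly _ _ _))
        (S := Finset.univ.image (lam ∘ Fin.succ) ∪ Finset.univ.image mu) ?_ ?_ ?_
      · have := Finset.card_filter_add_card_filter_not (s := Finset.univ.image mu) (· ∈ J)
        omega
      · rw [Finset.card_union_of_disjoint
          (Finset.disjoint_left.mpr fun _ h => hsepΛ.notMem h)]
        omega
      · intro u hu v hv huv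
        rcases Finset.mem_union.mp hu with hu | hu <;> rcases Finset.mem_union.mp hv with hv | hv
        · exact hsepΛ.left u hu v hv huv
        · exact hsepΛ.cross u hu v hv
        · exact hsepΛ.symm.cross u hu v hv
        · exact hsepΛ.right u hu v hv huv
      · intro u hu
        rcases Finset.mem_union.mp hu with hu | hu
        · rw [pairPoly_left_node hu (by rwa [hunion])]
          obtain ⟨j, -, rfl⟩ := Finset.mem_image.mp hu
          rw [detPoly_left_node _ _ _ _ (hlm' j), mul_zero, sub_zero]
        · obtain ⟨k, -, rfl⟩ := Finset.mem_image.mp hu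
          rw [sub_eq_zero]
          refine pairPoly_eq_detPoly_right_node J _ mu k hsucc hmu hlm' (ih _ _ hsucc
            (fun j l h => hmu _ _ fun e => h (Fin.succAbove_right_injective e))
            fun j l => hlm _ _)
    have h0 := key (lam 0)
    have hprod : ∏ y ∈ Finset.univ.image mu, Complex.sinh (lam 0 - y) ≠ 0 :=
      Finset.prod_ne_zero_iff.mpr fun y hy => hsep.cross _ (Finset.mem_insert_self _ _) y hy
    have hV : sinhVandermonde (-lam) = (-1) ^ N *
        (∏ j ∈ Finset.univ.image (lam ∘ Fin.succ), Complex.sinh (lam 0 - j)) *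
        sinhVandermonde (-(lam ∘ Fin.succ)) := by
      have hs (l : Fin N) : Complex.sinh ((-lam) 0 - (-lam) ((0 : Fin (N + 1)).succAbove l)) =
          -1 * Complex.sinh (lam 0 - lam l.succ) := by
        rw [neg_one_mul, ← Complex.sinh_neg]
        congr 1
        simp only [Pi.neg_apply, Fin.zero_succAbove]
        ring
      rw [sinhVandermonde_succAbove _ 0, Finset.prod_image fun _ _ _ _ h =>
        (hlam'.comp (Fin.succ_injective _)) h]
      simp only [hs, Finset.prod_mul_distrib, Finset.prod_const, Finset.card_univ,
        Fintype.card_fin, Fin.val_zero, pow_zero, one_mul]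
      rfl
    rw [pairPoly_eq hz (by rwa [hunion]), Finset.prod_filter_mul_prod_filter_not, detPoly_eq _ _ _
      (fun k => hlm 0 k), ← Finset.prod_image (s := Finset.univ) (g := mu)
      (f := fun y => Complex.sinh (lam 0 - y)) fun _ _ _ _ h => hmu' h, ← hins] at h0
    refine mul_right_cancel₀ hprod ?_
    rw [hV]
    linear_combination h0

/-! ### Use of the twisted Bethe equations -/

theorem zF_eq_zero_of_sinh_eta {X I : Finset ℂ} (hη : Complex.sinh η = 0) (hI : I.Nonempty)
    (h : SepPair X I) : zF η X I = 0 := by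
  induction X using Finset.induction_on with
  | empty => rw [zF_empty_left, if_neg hI.ne_empty]
  | insert x X hx _ =>
    rw [zF_insert_left hx h]
    exact Finset.sum_eq_zero fun y _ => by simp [gFun, hη]

/-- The partition function vanishes when the second set contains a nonempty subset closed under
the shift by `-η` modulo `iπ`. -/
theorem zF_eq_zero_of_shift_closed {X I S : Finset ℂ} (hS : S.Nonempty) (hSI : S ⊆ I)
    (hc : ∀ y ∈ S, ∃ l ∈ S, l ≠ y ∧ Complex.sinh (l - y + η) = 0) (h : SepPair X I) :
    zF η X I = 0 := by
  induction X using Finset.induction_on generalizing I with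
  | empty => rw [zF_empty_left, if_neg (hS.mono hSI).ne_empty]
  | insert x X hx ih =>
    rw [zF_insert_left hx h]
    refine Finset.sum_eq_zero fun y hy => ?_
    by_cases hyS : y ∈ S
    · obtain ⟨l, hl, hne, h0⟩ := hc y hyS
      have : ∏ l ∈ I.erase y, fFun η l y * fFun η x l = 0 :=
        Finset.prod_eq_zero (Finset.mem_erase.mpr ⟨hne, hSI hl⟩) (by simp [fFun, h0])
      rw [this, mul_zero, zero_mul]
    · rw [ih (Finset.subset_erase.mpr ⟨hSI, hyS⟩)
        (h.mono (Finset.subset_insert _ _) (Finset.erase_subset _ _)), mul_zero]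

theorem prod_erase_sinh_shift (I : Finset ℂ) :
    ∏ i ∈ I, ∏ j ∈ I.erase i, Complex.sinh (j - i - η) =
      ∏ i ∈ I, ∏ j ∈ I.erase i, Complex.sinh (j - i + η) := by
  have hsign : ∏ i ∈ I, ∏ _j ∈ I.erase i, (-1 : ℂ) = 1 := by
    rw [Finset.prod_congr rfl fun i hi => by
      rw [Finset.prod_const, Finset.card_erase_of_mem hi], Finset.prod_const, ← pow_mul, mul_comm]
    exact (Nat.even_mul_pred_self _).neg_one_pow
  rw [Finset.prod_comm' (t' := I) (s' := fun j => I.erase j)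
    fun i j => by simp only [Finset.mem_erase]; tauto]
  simp only [sinh_sub_sub_neg, Finset.prod_mul_distrib, hsign, one_mul]

theorem sinh_eq_zero_of_shift {u v w : ℂ} (hu : Complex.sinh (u - w + η) = 0)
    (hv : Complex.sinh (v - w + η) = 0) : Complex.sinh (u - v) = 0 := by
  have h : u - v = (u - w + η) - (v - w + η) := by ring
  rw [h, Complex.sinh_sub, hu, hv, zero_mul, mul_zero, sub_zero]

/-- The Bethe equations are multiplied over i ∈ I. Their factors internal to I have equal products
on both sides and cancel if nonzero. Since λ_j - λ_k = ±η modulo iπ is not excluded they may vanish;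
then either the partition function is zero or both products are. -/
theorem onShell_prod_eq {a d : ℂ → ℂ} {κ : ℂ} {Λ I X : Finset ℂ} (hI : I ⊆ Λ)
    (hη : Complex.sinh η ≠ 0) (hΛ : SepPair X Λ)
    (hB : ∀ j ∈ Λ, a j * ∏ k ∈ Λ, Complex.sinh (k - j + η) +
      κ * d j * ∏ k ∈ Λ, Complex.sinh (k - j - η) = 0) :
    (∏ i ∈ I, a i * ∏ j ∈ Λ \ I, Complex.sinh (j - i + η)) * zF η X I =
      (∏ i ∈ I, κ * d i * ∏ j ∈ Λ \ I, Complex.sinh (j - i - η)) * zF η X I := by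
  set u := fun i => a i * ∏ j ∈ Λ \ I, Complex.sinh (j - i + η) with hu
  set v := fun i => κ * d i * ∏ j ∈ Λ \ I, Complex.sinh (j - i - η) with hv
  set p := fun i => ∏ j ∈ I.erase i, Complex.sinh (j - i + η) with hp
  set q := fun i => ∏ j ∈ I.erase i, Complex.sinh (j - i - η) with hq
  -- The factors k = i of the two products are sinh η and -sinh η, which accounts for the sign.
  have hBI (i) (hi : i ∈ I) : u i * p i = v i * q i := by
    have := hB i (hI hi)
    rw [← Finset.prod_sdiff hI, ← Finset.prod_sdiff hI, ← Finset.mul_prod_erase _ _ hi,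
      ← Finset.mul_prod_erase _ _ hi, sub_self, zero_add, zero_sub, Complex.sinh_neg] at this
    apply mul_left_cancel₀ hη
    linear_combination this
  have hsep := hΛ.mono subset_rfl hI
  by_cases hp0 : ∀ i ∈ I, p i ≠ 0
  · congr 1
    apply mul_right_cancel₀ (Finset.prod_ne_zero_iff.mpr hp0)
    rw [← Finset.prod_mul_distrib, Finset.prod_congr rfl hBI, Finset.prod_mul_distrib]
    exact congrArg _ (prod_erase_sinh_shift I)
  push Not at hp0
  set S := {i ∈ I | p i = 0} with hS
  set S' := {i ∈ I | q i = 0} with hS'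
  have hpS (i) : i ∈ S ↔ i ∈ I ∧ ∃ l ∈ I, l ≠ i ∧ Complex.sinh (l - i + η) = 0 := by
    simp only [hS, Finset.mem_filter, hp, Finset.prod_eq_zero_iff, Finset.mem_erase]
    grind
  have hqS (i) : i ∈ S' ↔ i ∈ I ∧ ∃ l ∈ I, l ≠ i ∧ Complex.sinh (i - l + η) = 0 := by
    simp only [hS', Finset.mem_filter, hq, Finset.prod_eq_zero_iff, Finset.mem_erase,
      sinh_sub_sub_neg (η := η) _ i, neg_one_mul, neg_eq_zero]
    grind
  -- A point of S has its shift by -η (modulo iπ) in I, and that shift lies in S'. If S' ⊆ S, then S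
  -- is closed under the shift and the partition function vanishes.
  by_cases hsub : S' ⊆ S
  · rw [zF_eq_zero_of_shift_closed (S := S) (I := I) ?_ (Finset.filter_subset _ _) ?_ hsep,
      mul_zero, mul_zero]
    · obtain ⟨i, hi⟩ := hp0
      exact ⟨i, Finset.mem_filter.mpr hi⟩
    · intro y hy
      obtain ⟨hyI, l, hl, hne, h0⟩ := (hpS y).mp hy
      exact ⟨l, hsub ((hqS l).mpr ⟨hl, y, hyI, hne.symm, h0⟩), hne, h0⟩
  -- The shift by +η (modulo iπ) maps S' injectively into S, so S ⊆ S' would force equality.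
  have hsub' : ¬ S ⊆ S' := fun hle => by
    have hpred (i) (hi : i ∈ S') : ∃ l ∈ S, Complex.sinh (i - l + η) = 0 := by
      obtain ⟨hiI, l, hl, hne, h0⟩ := (hqS i).mp hi
      exact ⟨l, (hpS l).mpr ⟨hl, i, hiI, hne.symm, h0⟩, h0⟩
    choose! φ hφ hφ0 using hpred
    refine hsub (Finset.eq_of_subset_of_card_le hle
      (Finset.card_le_card_of_injOn φ hφ fun i hi i' hi' he => ?_)).ge
    by_contra hne
    have h1 := hφ0 i hi
    rw [he] at h1
    exact hsep.right i ((hqS i).mp hi).1 i' ((hqS i').mp hi').1 hne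
      (sinh_eq_zero_of_shift h1 (hφ0 i' hi'))
  -- Here q i = 0 ≠ p i gives u i = 0, and p k = 0 ≠ q k gives v k = 0, so both products vanish.
  obtain ⟨i, hi, hi'⟩ := Finset.not_subset.mp hsub
  obtain ⟨k, hk, hk'⟩ := Finset.not_subset.mp hsub'
  have hiI := (Finset.mem_filter.mp hi).1
  have hkI := (Finset.mem_filter.mp hk).1
  have hui : u i = 0 := by
    have := hBI i hiI
    rw [(Finset.mem_filter.mp hi).2, mul_zero] at this
    exact (mul_eq_zero.mp this).resolve_right fun h => hi' (Finset.mem_filter.mpr ⟨hiI, h⟩)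
  have hvk : v k = 0 := by
    have := (hBI k hkI).symm
    rw [(Finset.mem_filter.mp hk).2, mul_zero] at this
    exact (mul_eq_zero.mp this).resolve_right fun h => hk' (Finset.mem_filter.mpr ⟨hkI, h⟩)
  rw [Finset.prod_eq_zero hiI hui, Finset.prod_eq_zero hkI hvk]

theorem onShell_term_eq {a d : ℂ → ℂ} {κ : ℂ} {Λ I X : Finset ℂ} (hI : I ⊆ Λ)
    (hΛ : SepPair X Λ)
    (hB : ∀ j ∈ Λ, a j * ∏ k ∈ Λ, Complex.sinh (k - j + η) +
      κ * d j * ∏ k ∈ Λ, Complex.sinh (k - j - η) = 0) :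
    (∏ i ∈ I, a i) * (∏ i ∈ I, ∏ j ∈ Λ \ I, fFun η j i) * zF η X I =
      κ ^ I.card * (∏ i ∈ I, d i) * (∏ i ∈ I, ∏ j ∈ Λ \ I, fFun η i j) * zF η X I := by
  by_cases hη : Complex.sinh η = 0
  · rcases I.eq_empty_or_nonempty with rfl | hne
    · simp
    · rw [zF_eq_zero_of_sinh_eta hη hne (hΛ.mono subset_rfl hI), mul_zero, mul_zero]
  have hs (i) (hi : i ∈ I) (j) (hj : j ∈ Λ \ I) : Complex.sinh (j - i) ≠ 0 := by
    rw [Finset.mem_sdiff] at hj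
    exact hΛ.right j hj.1 i (hI hi) fun e => hj.2 (e ▸ hi)
  have h0 : ∏ i ∈ I, ∏ j ∈ Λ \ I, Complex.sinh (j - i) ≠ 0 :=
    Finset.prod_ne_zero_iff.mpr fun i hi => Finset.prod_ne_zero_iff.mpr (hs i hi)
  have h1 : (∏ i ∈ I, ∏ j ∈ Λ \ I, fFun η j i) * ∏ i ∈ I, ∏ j ∈ Λ \ I, Complex.sinh (j - i) =
      ∏ i ∈ I, ∏ j ∈ Λ \ I, Complex.sinh (j - i + η) := by
    simp only [← Finset.prod_mul_distrib]
    exact Finset.prod_congr rfl fun i hi => Finset.prod_congr rfl fun j hj =>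
      fFun_mul_sinh (hs i hi j hj)
  have h2 : (∏ i ∈ I, ∏ j ∈ Λ \ I, fFun η i j) * ∏ i ∈ I, ∏ j ∈ Λ \ I, Complex.sinh (j - i) =
      ∏ i ∈ I, ∏ j ∈ Λ \ I, Complex.sinh (j - i - η) := by
    simp only [← Finset.prod_mul_distrib]
    exact Finset.prod_congr rfl fun i hi => Finset.prod_congr rfl fun j hj =>
      fFun_mul_sinh' (sinh_sub_ne_zero_symm (hs i hi j hj))
  have h3 := onShell_prod_eq hI hη hΛ hB
  simp only [Finset.prod_mul_distrib, Finset.prod_const, ← h1, ← h2] at h3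
  apply mul_left_cancel₀ h0
  linear_combination h3

theorem fCross_eq {L L' : List ℂ} (h : L.Nodup) (h' : L'.Nodup) :
    fCross η L L' = ∏ y ∈ L'.toFinset, ∏ x ∈ L.toFinset, fFun η x y := by
  rw [Finset.prod_comm, fCross, List.prod_toFinset _ h]
  simp only [List.prod_toFinset _ h']

theorem sum_powerset_union {A B : Finset ℂ} (h : Disjoint A B) (F : Finset ℂ → ℂ) :
    ∑ J ∈ (A ∪ B).powerset, F J = ∑ I ∈ A.powerset, ∑ J ∈ B.powerset, F (I ∪ J) := by
  rw [← Finset.sum_product']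
  symm
  refine Finset.sum_nbij' (fun p => p.1 ∪ p.2) (fun J => (J ∩ A, J ∩ B)) ?_ ?_ ?_ ?_ ?_
  · intro p hp
    simp only [Finset.mem_product, Finset.mem_powerset] at hp ⊢
    exact Finset.union_subset_union hp.1 hp.2
  · intro J _
    simp [Finset.inter_subset_right]
  · intro p hp
    simp only [Finset.mem_product, Finset.mem_powerset] at hp
    have h1 : Disjoint p.2 A := (h.mono_right hp.2).symm
    have h2 : Disjoint p.1 B := h.mono_left hp.1
    simp only [Finset.union_inter_distrib_right]
    rw [Finset.disjoint_iff_inter_eq_empty.mp h1, Finset.disjoint_iff_inter_eq_empty.mp h2,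
      Finset.inter_eq_left.mpr hp.1, Finset.inter_eq_left.mpr hp.2, Finset.union_empty,
      Finset.empty_union]
  · intro J hJ
    rw [Finset.mem_powerset] at hJ
    rw [← Finset.inter_union_distrib_left, Finset.inter_eq_left.mpr hJ]
  · exact fun _ _ => rfl

/-- The subset indexing a coefficient is split into its parts I ⊆ X and J ⊆ Y, so that the Bethe
equations can be applied to I at fixed J. -/
theorem VacuumRep.scalarProduct_eq_sum_sum {V : Type*} [AddCommGroup V] [Module ℂ V]
    (R : VacuumRep η V) {L L' : List ℂ} (hs : Sep (L ++ L')) {X Y : Finset ℂ}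
    (hX : L.toFinset = X) (hY : L'.toFinset = Y) :
    R.scalarProduct L.reverse L' = ∑ I ∈ X.powerset, ∑ J ∈ Y.powerset,
      ((∏ i ∈ I, R.a i) * (∏ i ∈ I, ∏ j ∈ X \ I, fFun η j i) * zF η (Y \ J) I) *
        (∏ j ∈ X \ I, R.d j) * ((∏ k ∈ J, R.a k) * (∏ l ∈ Y \ J, R.d l) *
        (∏ k ∈ J, ∏ l ∈ Y \ J, fFun η l k)) * zF η (X \ I) J := by
  have hdisj : Disjoint X Y := by
    subst hX hY
    exact Finset.disjoint_left.mpr fun _ h => hs.sepPair.notMem h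
  rw [R.scalarProduct_eq_sum hs, List.toFinset_append, hX, hY, sum_powerset_union hdisj]
  refine Finset.sum_congr rfl fun I hI => Finset.sum_congr rfl fun J hJ => ?_
  rw [Finset.mem_powerset] at hI hJ
  have hIJ : Disjoint I J := hdisj.mono hI hJ
  have hJX : Disjoint X J := hdisj.mono_right hJ
  have hIY : Disjoint Y I := (hdisj.mono_left hI).symm
  have hn := hs.nodup
  have hnL := hn.of_append_left
  have hnL' := hn.of_append_right
  have hfil (p q : ℂ → Bool) : Sep (L.filter p ++ L'.filter q) :=
    hs.sublist (List.Sublist.append List.filter_sublist List.filter_sublist)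
  have hfil' (p q : ℂ → Bool) : Sep (L'.filter p ++ L.filter q) :=
    (hs.perm List.perm_append_comm).sublist
      (List.Sublist.append List.filter_sublist List.filter_sublist)
  have e1 : X \ (I ∪ J) = X \ I := by
    rw [← Finset.sup_eq_union, ← sdiff_sdiff, sdiff_right_comm,
      Finset.sdiff_eq_self_of_disjoint hJX]
  have e2 : Y \ (I ∪ J) = Y \ J := by
    rw [← Finset.sup_eq_union, ← sdiff_sdiff, Finset.sdiff_eq_self_of_disjoint hIY]
  have m1 : (L.filter (· ∈ I ∪ J)).toFinset = I := by
    ext p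
    have h1 : p ∈ X → p ∉ J := fun h => Finset.disjoint_left.mp hJX h
    have h2 := @hI p
    simp only [List.toFinset_filter, hX, Finset.mem_filter, decide_eq_true_eq, Finset.mem_union]
    tauto
  have m2 : (L'.filter (· ∈ I ∪ J)).toFinset = J := by
    ext p
    have h1 : p ∈ Y → p ∉ I := fun h => Finset.disjoint_left.mp hIY h
    have h2 := @hJ p
    simp only [List.toFinset_filter, hY, Finset.mem_filter, decide_eq_true_eq, Finset.mem_union]
    tauto
  have hd : (X ∪ Y) \ (I ∪ J) = X \ I ∪ Y \ J := by
    rw [Finset.union_sdiff_distrib, e1, e2]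
  rw [spCoeff, fCross_eq (hnL.filter _) (hnL.filter _), fCross_eq (hnL'.filter _) (hnL'.filter _),
    zList_eq_zF (hfil _ _), zList_eq_zF (hfil' _ _), filter_notMem_toFinset,
    filter_notMem_toFinset, hX, hY, m1, m2, e1, e2, hd, Finset.prod_union hIJ,
    Finset.prod_union (hdisj.mono Finset.sdiff_subset Finset.sdiff_subset)]
  ring

theorem zF_eq_zero_of_card_ne {X Y : Finset ℂ} (hc : X.card ≠ Y.card) (h : SepPair X Y) :
    zF η X Y = 0 := by
  induction X using Finset.induction_on generalizing Y with
  | empty =>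
    rw [zF_empty_left, if_neg]
    rintro rfl
    exact hc rfl
  | insert x X hx ih =>
    rw [zF_insert_left hx h]
    refine Finset.sum_eq_zero fun y hy => ?_
    rw [ih _ (h.mono (Finset.subset_insert _ _) (Finset.erase_subset _ _)), mul_zero]
    rw [Finset.card_insert_of_notMem hx] at hc
    have := Finset.card_erase_add_one hy
    omega

/-- After a is traded for κ d on I, the d's on I and on its complement combine into the full
product, and the sum over I is exactly `pairSum`. -/
theorem VacuumRep.scalarProduct_onShell {V : Type*} [AddCommGroup V] [Module ℂ V]
    (R : VacuumRep η V) {L L' : List ℂ} (hs : Sep (L ++ L')) {X Y : Finset ℂ}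
    (hX : L.toFinset = X) (hY : L'.toFinset = Y) {κ : ℂ}
    (hB : ∀ j ∈ X, R.a j * ∏ k ∈ X, Complex.sinh (k - j + η) +
      κ * R.d j * ∏ k ∈ X, Complex.sinh (k - j - η) = 0) :
    R.scalarProduct L.reverse L' = (∏ j ∈ X, R.d j) * ∑ J ∈ Y.powerset,
      (∏ k ∈ J, R.a k) * (∏ l ∈ Y \ J, κ * R.d l) *
        ((∏ k ∈ J, ∏ l ∈ Y \ J, fFun η l k) * pairSum η X J (Y \ J)) := by
  have hsep : SepPair X Y := by
    subst hX hY
    exact hs.sepPair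
  rw [R.scalarProduct_eq_sum_sum hs hX hY, Finset.sum_comm, Finset.mul_sum]
  refine Finset.sum_congr rfl fun J hJ => ?_
  rw [pairSum, Finset.mul_sum, Finset.mul_sum, Finset.mul_sum]
  refine Finset.sum_congr rfl fun I hI => ?_
  rw [Finset.mem_powerset] at hI hJ
  have hsep' : SepPair (Y \ J) X := hsep.symm.mono Finset.sdiff_subset subset_rfl
  -- The partition function vanishes unless |I| = |Y \ J|, so the powers of κ can be moved from the
  -- λ's to the μ's outside J.
  have hκ : κ ^ I.card * zF η (Y \ J) I = κ ^ (Y \ J).card * zF η (Y \ J) I := by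
    by_cases hc : (Y \ J).card = I.card
    · rw [hc]
    · rw [zF_eq_zero_of_card_ne hc (hsep'.mono subset_rfl hI), mul_zero, mul_zero]
  rw [onShell_term_eq hI hsep' hB, Finset.prod_mul_distrib, Finset.prod_const,
    ← Finset.prod_sdiff hI]
  linear_combination ((∏ i ∈ I, R.d i) * (∏ i ∈ I, ∏ j ∈ X \ I, fFun η i j) *
    (∏ j ∈ X \ I, R.d j) * ((∏ k ∈ J, R.a k) * (∏ l ∈ Y \ J, R.d l) *
        (∏ k ∈ J, ∏ l ∈ Y \ J, fFun η l k)) * zF η (X \ I) J) * hκ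

/-! ### Column expansion of det Ω and conclusion -/

theorem sum_powerset_image {N : ℕ} {mu : Fin N → ℂ} (hmu : Function.Injective mu)
    (F : Finset ℂ → ℂ) :
    ∑ J ∈ (Finset.univ.image mu).powerset, F J =
      ∑ t ∈ (Finset.univ : Finset (Fin N)).powerset, F (t.image mu) := by
  rw [Finset.powerset_image, Finset.sum_image fun _ _ _ _ h => Finset.image_injective hmu h]

/-- In each term of Ω the shifted sine in the denominator of t cancels the factor i = j of the
product, leaving a(μ_k) and κ d(μ_k) times entries of `colMatrix`. The determinant is then expanded
by multilinearity in the columns, J being the set of μ_k whose a-part is chosen. -/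
theorem det_Omega_eq {V : Type*} [AddCommGroup V] [Module ℂ V] (M : GeneralizedModel η V)
    (κ : ℂ) {N : ℕ} (lam mu : Fin N → ℂ)
    (hmu : ∀ j k, j ≠ k → Complex.sinh (mu j - mu k) ≠ 0)
    (hlm : ∀ j k, Complex.sinh (lam j - mu k) ≠ 0)
    (hlmη : ∀ j k, Complex.sinh (lam j - mu k + η) ≠ 0)
    (hmlη : ∀ j k, Complex.sinh (mu k - lam j + η) ≠ 0) :
    (M.Omega κ lam mu lam).det = ∑ J ∈ (Finset.univ.image mu).powerset,
      (∏ k ∈ J, M.a k) * (∏ l ∈ Finset.univ.image mu \ J, κ * M.d l) *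
        (colMatrix η J lam mu).det := by
  have hmu' := injective_of_sinh_ne hmu
  have hentry (j k) : M.Omega κ lam mu lam j k =
      M.a (mu k) * colMatrix η (Finset.univ.image mu) lam mu j k +
        κ * M.d (mu k) * colMatrix η ∅ lam mu j k := by
    have h1 := hlm j k
    have h2 := hlmη j k
    have h3 : Complex.sinh (lam j - mu k - η) ≠ 0 := by
      rw [sinh_sub_sub_neg, neg_one_mul]
      exact neg_ne_zero.mpr (hmlη j k)
    have hprod (F : Fin N → ℂ) : ∏ i, F i = F j * ∏ i, if i = j then 1 else F i := by
      rw [← Finset.mul_prod_erase _ _ (Finset.mem_univ j),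
        ← Finset.mul_prod_erase _ (fun i => if i = j then 1 else F i) (Finset.mem_univ j),
        if_pos rfl, one_mul]
      congr 1
      exact Finset.prod_congr rfl fun i hi => (if_neg (Finset.ne_of_mem_erase hi)).symm
    simp only [GeneralizedModel.Omega, colMatrix, Matrix.of_apply, colConst, colShift, tFun,
      Finset.mem_image_of_mem mu (Finset.mem_univ _), if_true, Finset.notMem_empty, if_false]
    rw [hprod fun i => Complex.sinh (lam i - mu k + η), hprod fun i =>
      Complex.sinh (lam i - mu k - η), sinh_sub_swap (mu k), sinh_sub_add_neg (mu k)]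
    field_simp
    ring
  rw [sum_powerset_image hmu', Matrix.det_apply]
  simp only [hentry, Finset.prod_add, Finset.smul_sum]
  rw [Finset.sum_comm]
  refine Finset.sum_congr rfl fun t _ => ?_
  rw [Matrix.det_apply, Finset.mul_sum]
  refine Finset.sum_congr rfl fun σ _ => ?_
  rw [← Finset.image_sdiff _ _ hmu', Finset.prod_image fun _ _ _ _ h => hmu' h,
    Finset.prod_image fun _ _ _ _ h => hmu' h, mul_smul_comm,
    ← Finset.prod_sdiff (Finset.subset_univ t)
      (f := fun k => colMatrix η (t.image mu) lam mu (σ k) k)]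
  have ht (k) : mu k ∈ t.image mu ↔ k ∈ t := by
    rw [Function.Injective.mem_finset_image hmu']
  have e1 : ∏ k ∈ t, colMatrix η (Finset.univ.image mu) lam mu (σ k) k =
      ∏ k ∈ t, colMatrix η (t.image mu) lam mu (σ k) k :=
    Finset.prod_congr rfl fun k hk => by
      simp only [colMatrix, colConst, colShift, Matrix.of_apply, if_pos ((ht k).mpr hk),
        if_pos (Finset.mem_image_of_mem mu (Finset.mem_univ k))]
  have e2 : ∏ k ∈ Finset.univ \ t, colMatrix η ∅ lam mu (σ k) k =
      ∏ k ∈ Finset.univ \ t, colMatrix η (t.image mu) lam mu (σ k) k :=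
    Finset.prod_congr rfl fun k hk => by
      have hk := mt (ht k).mp (Finset.mem_sdiff.mp hk).2
      simp only [colMatrix, colConst, colShift, Matrix.of_apply, if_neg hk, Finset.notMem_empty,
        if_false]
  rw [← e1, ← e2, Finset.prod_mul_distrib, Finset.prod_mul_distrib]
  congr 1
  ring

/-- The representation is allowed to differ from the model, with the same a and d, so that the
transpose can be used; the lists are arbitrary orderings because reversal and transposition change
the order and no commutation is assumed. -/
theorem scalarProduct_eq_det {V : Type*} [AddCommGroup V] [Module ℂ V]
    (M : GeneralizedModel η V) {W : Type*} [AddCommGroup W] [Module ℂ W] (R : VacuumRep η W)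
    (ha : R.a = M.a) (hd : R.d = M.d) (κ : ℂ) {N : ℕ} (lam mu : Fin N → ℂ)
    (hlam : ∀ j k, j ≠ k → Complex.sinh (lam j - lam k) ≠ 0)
    (hmu : ∀ j k, j ≠ k → Complex.sinh (mu j - mu k) ≠ 0)
    (hlm : ∀ j k, Complex.sinh (lam j - mu k) ≠ 0)
    (hlmη : ∀ j k, Complex.sinh (lam j - mu k + η) ≠ 0)
    (hmlη : ∀ j k, Complex.sinh (mu k - lam j + η) ≠ 0)
    (hBethe : M.TwistedBethe κ lam) {L L' : List ℂ} (hL : L.Perm (List.ofFn lam))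
    (hL' : L'.Perm (List.ofFn mu)) :
    R.scalarProduct L.reverse L' = (∏ j, M.d (lam j)) /
      (∏ j, ∏ k ∈ Finset.Iio j, Complex.sinh (lam j - lam k) * Complex.sinh (mu k - mu j)) *
        (M.Omega κ lam mu lam).det := by
  have hlam' := injective_of_sinh_ne hlam
  have hmu' := injective_of_sinh_ne hmu
  have hX : L.toFinset = Finset.univ.image lam := by
    ext; simp [hL.mem_iff]
  have hY : L'.toFinset = Finset.univ.image mu := by
    ext; simp [hL'.mem_iff]
  have hs : Sep (L ++ L') := (sepPair_image hlam hmu hlm).sep hX hY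
    (hL.nodup_iff.mpr (List.nodup_ofFn.mpr hlam')) (hL'.nodup_iff.mpr (List.nodup_ofFn.mpr hmu'))
  have hB : ∀ j ∈ Finset.univ.image lam, R.a j * ∏ k ∈ Finset.univ.image lam,
      Complex.sinh (k - j + η) + κ * R.d j * ∏ k ∈ Finset.univ.image lam,
      Complex.sinh (k - j - η) = 0 := by
    simp only [Finset.forall_mem_image, ha, hd]
    intro j _
    rw [Finset.prod_image fun _ _ _ _ h => hlam' h, Finset.prod_image fun _ _ _ _ h => hlam' h]
    exact hBethe j
  have hV : ∏ j, ∏ k ∈ Finset.Iio j, Complex.sinh (lam j - lam k) * Complex.sinh (mu k - mu j) =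
      sinhVandermonde (-lam) * sinhVandermonde mu := by
    simp only [sinhVandermonde, Pi.neg_apply, neg_sub_neg, Finset.prod_mul_distrib]
  have hV0 : sinhVandermonde (-lam) * sinhVandermonde mu ≠ 0 := by
    rw [← hV]
    exact Finset.prod_ne_zero_iff.mpr fun j _ => Finset.prod_ne_zero_iff.mpr fun k hk =>
      mul_ne_zero (hlam _ _ (Finset.mem_Iio.mp hk).ne') (hmu _ _ (Finset.mem_Iio.mp hk).ne)
  rw [R.scalarProduct_onShell hs hX hY hB, hV, div_mul_eq_mul_div, eq_div_iff hV0,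
    det_Omega_eq M κ lam mu hmu hlm hlmη hmlη, ha, hd,
    Finset.prod_image fun _ _ _ _ h => hlam' h, mul_assoc, Finset.sum_mul]
  congr 1
  refine Finset.sum_congr rfl fun J hJ => ?_
  rw [Finset.mem_powerset] at hJ
  have h1 : {k ∈ Finset.univ.image mu | k ∈ J} = J := by
    rw [Finset.filter_mem_eq_inter, Finset.inter_eq_right.mpr hJ]
  have h2 : {k ∈ Finset.univ.image mu | k ∉ J} = Finset.univ.image mu \ J :=
    Finset.filter_notMem_eq_sdiff
  have hdet := pairSum_eq_det (η := η) J lam mu hlam hmu hlm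
  rw [h1, h2] at hdet
  rw [← hdet]
  ring

end AlgebraicBetheAnsatz

end

theorem mainTheorem3 {η : ℂ} {V : Type*} [AddCommGroup V] [Module ℂ V]
    (M : AlgebraicBetheAnsatz.GeneralizedModel η V) (κ : ℂ) {N : ℕ} (lam mu : Fin N → ℂ)
    (hlam : ∀ j k, j ≠ k → Complex.sinh (lam j - lam k) ≠ 0)
    (hmu : ∀ j k, j ≠ k → Complex.sinh (mu j - mu k) ≠ 0)
    (hlm : ∀ j k, Complex.sinh (lam j - mu k) ≠ 0)
    (hlmη : ∀ j k, Complex.sinh (lam j - mu k + η) ≠ 0)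
    (hmlη : ∀ j k, Complex.sinh (mu k - lam j + η) ≠ 0)
    (hBethe : M.TwistedBethe κ lam) :
    M.dualVac (M.prodC mu (M.betheVector lam)) =
        (∏ j, M.d (lam j)) /
            (∏ j, ∏ k ∈ Finset.Iio j,
              Complex.sinh (lam j - lam k) * Complex.sinh (mu k - mu j)) *
          (M.Omega κ lam mu lam).det ∧
      M.dualBetheVector lam (M.prodB mu M.vac) =
        (∏ j, M.d (lam j)) /
            (∏ j, ∏ k ∈ Finset.Iio j,
              Complex.sinh (lam j - lam k) * Complex.sinh (mu k - mu j)) *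
          (M.Omega κ lam mu lam).det := by
  have hsp (x y : Fin N → ℂ) : M.dualVac (M.prodC x (M.prodB y M.vac)) =
      M.toRep.scalarProduct (List.ofFn x) (List.ofFn y) := by
    simp only [AlgebraicBetheAnsatz.VacuumRep.scalarProduct, List.map_ofFn]
    rfl
  constructor
  -- With the Bethe roots in the B's, the transposed representation exchanges B and C and moves the
  -- roots into the C's.
  · have h := AlgebraicBetheAnsatz.scalarProduct_eq_det M M.toRep.transpose rfl rfl κ lam mu hlam
      hmu hlm hlmη hmlη hBethe (List.Perm.refl _) (List.reverse_perm _)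
    rw [AlgebraicBetheAnsatz.VacuumRep.scalarProduct_transpose, List.reverse_reverse,
      List.reverse_reverse] at h
    exact (hsp mu lam).trans h
  · have h := AlgebraicBetheAnsatz.scalarProduct_eq_det M M.toRep rfl rfl κ lam mu hlam
      hmu hlm hlmη hmlη hBethe (List.reverse_perm _) (List.Perm.refl _)
    rw [List.reverse_reverse] at h
    exact (hsp lam mu).trans h
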